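/- Let $(\Omega,\mathcal F,\mathbb P)$ be a complete probability space carrying an $r$-dimensional standard Brownian motion $w=(w_1,\dots,w_r)$, with filtration the usual augmentation of the natural filtration of $w$. For real $n\times n$ matrices $A,C_1,\dots,C_r$, call $(A,C_1,\dots,C_r)$ mean-square stable if for every $x\in\mathbb R^n$ the solution of $$dX(t)=AX(t)\,dt+\sum_{l=1}^r C_lX(t)\,dw_l(t),\qquad X(0)=x,$$ satisfies $\lim_{t\to\infty}\mathbb E[X(t)^\top X(t)]=0$. Let $A,C_l\in\mathbb R^{n\times n}$, $B,D_l\in\mathbb R^{n\times m}$ ($1\le l\le r$), $Q\in\mathbb R^{n\times n}$ and $R\in\mathbb R^{m\times m}$. For symmetric $P\in\mathbb R^{n\times n}$ put $$\mathcal Q(P)=PA+A^\top P+\sum_{l=1}^rC_l^\top PC_l+Q,\quad \mathcal S(P)=B^\top P+\sum_{l=1}^rD_l^\top PC_l,\quad \mathcal R(P)=R+\sum_{l=1}^rD_l^\top PD_l,$$ $$\Lambda(P)=\begin{bmatrix}\mathcal Q(P)&\mathcal S(P)^\top\\ \mathcal S(P)&\mathcal R(P)\end{bmatrix},\qquad \Gamma=\{P=P^\top:\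 \Lambda(P)\succeq0,\ \mathcal R(P)\succ0\}.$$ A stabilizing solution of the algebraic Riccati equation $$\mathcal Q(P)-\mathcal S(P)^\top\mathcal R(P)^{-1}\mathcal S(P)=0\tag{ARE}$$ is a symmetric matrix $P$ with $\mathcal R(P)$ invertible that satisfies (ARE) and for which, with $K(P)=-\mathcal R(P)^{-1}\mathcal S(P)$, the system $(A+BK(P),C_1+D_1K(P),\dots,C_r+D_rK(P))$ is mean-square stable. Suppose that 1. $0\in\Gamma$; 2. $[A,C_1,\dots,C_r;B,D_1,\dots,D_r]$ is mean-square stabilizable: there is $\varTheta\in\mathbb R^{m\times n}$ such that $(A+B\varTheta,C_1+D_1\varTheta,\dots,C_r+D_r\varTheta)$ is mean-square stable; 3. there are $q\ge 0$ and $E_0,E_1,\dots,E_r\in\mathbb R^{q\times n}$ with $\sum_{l=0}^rE_l^\top E_l=Q$ such that $[E_0,\dots,E_r;A,C_1,\dots,C_r]$ is stochastically detectable: there is $\varTheta\in\mathbb R^{n\times q}$ such that $(A+\varTheta E_0,C_1+\varTheta E_1,\dots,C_r+\varTheta E_r)$ is mean-square stable. Then (ARE) has a stabilizing solution $P$ with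 $P\succeq0$ and $\mathcal R(P)=R+\sum_{l=1}^rD_l^\top PD_l\succ0$, and $P$ is the only stabilizing solution of (ARE). -/

import Mathlib

open MeasureTheory ProbabilityTheory Filter Topology
open scoped NNReal ENNReal Matrix

noncomputable section

/-- `w = (w 0, …, w (r-1))` is an `r`-dimensional standard Brownian motion under `P`: each component
is a standard real Brownian motion, and the components are independent as processes. -/
structure IsStandardBrownianMotion {Ω : Type*} [MeasurableSpace Ω] (P : Measure Ω) {r : ℕ}
    (w : Fin r → ℝ≥0 → Ω → ℝ) : Prop where
  isBrownianReal : ∀ l, IsBrownianReal (w l) P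
  iIndepFun : iIndepFun (fun l ω t => w l t ω) P

/-- The natural filtration of `w` completed by the `P`-null sets: at time `t` it is generated by the
events that depend on a single `w l u` with `u ≤ t`, and by the null events. -/
def completedNaturalFiltration {Ω : Type*} [mΩ : MeasurableSpace Ω] (P : Measure Ω) {r : ℕ}
    (w : Fin r → ℝ≥0 → Ω → ℝ) : Filtration ℝ≥0 mΩ where
  seq t := MeasurableSpace.generateFrom
    {s | MeasurableSet s ∧
      ((∃ l, ∃ u ≤ t, ∃ b : Set ℝ, MeasurableSet b ∧ s = w l u ⁻¹' b) ∨ P s = 0)}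
  mono' t t' htt' := by
    refine MeasurableSpace.generateFrom_mono ?_
    rintro s ⟨hs, ⟨l, u, hu, h⟩ | h⟩
    · exact ⟨hs, Or.inl ⟨l, u, hu.trans htt', h⟩⟩
    · exact ⟨hs, Or.inr h⟩
  le' t := MeasurableSpace.generateFrom_le fun _ hs => hs.1

/-- The usual augmentation of the natural filtration of `w` (completed and made right-continuous).
On a complete probability space it satisfies the usual conditions. -/
def augmentedFiltration {Ω : Type*} [mΩ : MeasurableSpace Ω] (P : Measure Ω) {r : ℕ}
    (w : Fin r → ℝ≥0 → Ω → ℝ) : Filtration ℝ≥0 mΩ :=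
  (completedNaturalFiltration P w).rightCont

/-- Elementary integrands `∑_{k < N} ξ_k 1_{(t_k, t_{k+1}]}` with `t_0 ≤ t_1 ≤ …` and each `ξ_k`
square integrable and measurable at time `t_k`. -/
structure ElementaryProcess {Ω : Type*} [mΩ : MeasurableSpace Ω] (P : Measure Ω)
    (ℱ : Filtration ℝ≥0 mΩ) where
  N : ℕ
  time : ℕ → ℝ≥0
  time_mono : Monotone time
  coeff : ℕ → Ω → ℝ
  coeff_measurable : ∀ k, Measurable[ℱ (time k)] (coeff k)
  coeff_memLp : ∀ k, MemLp (coeff k) 2 P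

namespace ElementaryProcess

variable {Ω : Type*} [mΩ : MeasurableSpace Ω] {P : Measure Ω} {ℱ : Filtration ℝ≥0 mΩ}

/-- The value at time `s` of an elementary process. -/
def eval (V : ElementaryProcess P ℱ) (s : ℝ≥0) (ω : Ω) : ℝ :=
  ∑ k ∈ Finset.range V.N,
    (Set.Ioc (V.time k) (V.time (k + 1))).indicator (fun _ => V.coeff k ω) s

/-- The stochastic integral over `[0, t]` of an elementary process against `β`. -/
def integral (V : ElementaryProcess P ℱ) (β : ℝ≥0 → Ω → ℝ) (t : ℝ≥0) (ω : Ω) : ℝ :=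
  ∑ k ∈ Finset.range V.N,
    V.coeff k ω * (β (min (V.time (k + 1)) t) ω - β (min (V.time k) t) ω)

end ElementaryProcess

/-- The random variable `I` is (a version of) the Itô integral `∫_0^t φ dβ`: it is the limit in
`L²(P)` of the integrals of elementary processes that converge to `φ` in `L²([0, t] × Ω)`.
Time is integrated over the real interval `[0, t]`. -/
def IsItoIntegral {Ω : Type*} [mΩ : MeasurableSpace Ω] (P : Measure Ω) (ℱ : Filtration ℝ≥0 mΩ)
    (β : ℝ≥0 → Ω → ℝ) (φ : ℝ≥0 → Ω → ℝ) (t : ℝ≥0) (I : Ω → ℝ) : Prop :=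
  AEMeasurable I P ∧ ∃ V : ℕ → ElementaryProcess P ℱ,
    Tendsto (fun k => ∫⁻ ω, (∫⁻ s in Set.Ioc (0 : ℝ) t,
      ‖(V k).eval s.toNNReal ω - φ s.toNNReal ω‖ₑ ^ 2) ∂P) atTop (𝓝 0) ∧
    Tendsto (fun k => ∫⁻ ω, ‖(V k).integral β t ω - I ω‖ₑ ^ 2 ∂P) atTop (𝓝 0)

/-- `X` is a solution on `[0, ∞)` of
`dX = A X dt + ∑_l C_l X dw_l`, `X(0) = x`: a progressively measurable process with continuous
paths, square integrable on bounded time intervals, that satisfies the integral equation. -/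
structure IsSDESolution {Ω : Type*} [MeasurableSpace Ω] (P : Measure Ω) {r n : ℕ}
    (w : Fin r → ℝ≥0 → Ω → ℝ) (A : Matrix (Fin n) (Fin n) ℝ)
    (C : Fin r → Matrix (Fin n) (Fin n) ℝ) (x : Fin n → ℝ)
    (X : ℝ≥0 → Ω → Fin n → ℝ) : Prop where
  progressive : IsProgressive (augmentedFiltration P w) X
  continuous : ∀ᵐ ω ∂P, Continuous fun t => X t ω
  sq_integrable : ∀ T : ℝ≥0,
    ∫⁻ ω, (∫⁻ s in Set.Ioc (0 : ℝ) T, ‖X s.toNNReal ω‖ₑ ^ 2) ∂P < ∞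
  equation : ∀ t : ℝ≥0, ∃ I : Fin r → Fin n → Ω → ℝ,
    (∀ l i, IsItoIntegral P (augmentedFiltration P w) (w l)
      (fun s ω => (C l *ᵥ X s ω) i) t (I l i)) ∧
    ∀ᵐ ω ∂P, ∀ i, X t ω i =
      x i + (∫ s in (0 : ℝ)..t, (A *ᵥ X s.toNNReal ω) i) + ∑ l, I l i ω

/-- The system `(A, C_1, …, C_r)` is mean-square stable: for every initial state the solution of
`dX = A X dt + ∑_l C_l X dw_l` exists and satisfies `E[X(t)ᵀ X(t)] → 0` as `t → ∞`.
(Solutions are unique up to indistinguishability and have finite second moments.) -/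
def IsMeanSquareStable {Ω : Type*} [MeasurableSpace Ω] (P : Measure Ω) {r n : ℕ}
    (w : Fin r → ℝ≥0 → Ω → ℝ) (A : Matrix (Fin n) (Fin n) ℝ)
    (C : Fin r → Matrix (Fin n) (Fin n) ℝ) : Prop :=
  ∀ x : Fin n → ℝ, ∃ X : ℝ≥0 → Ω → Fin n → ℝ, IsSDESolution P w A C x X ∧
    Tendsto (fun t => ∫ ω, X t ω ⬝ᵥ X t ω ∂P) atTop (𝓝 0)

/-- The observation system `[E₀, E_1, …, E_r; A, C_1, …, C_r]` is stochastically detectable. -/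
def IsStochasticallyDetectable {Ω : Type*} [MeasurableSpace Ω] (P : Measure Ω) {r n q : ℕ}
    (w : Fin r → ℝ≥0 → Ω → ℝ) (E₀ : Matrix (Fin q) (Fin n) ℝ)
    (E : Fin r → Matrix (Fin q) (Fin n) ℝ) (A : Matrix (Fin n) (Fin n) ℝ)
    (C : Fin r → Matrix (Fin n) (Fin n) ℝ) : Prop :=
  ∃ Θ : Matrix (Fin n) (Fin q) ℝ,
    IsMeanSquareStable P w (A + Θ * E₀) (fun l => C l + Θ * E l)

/-- The coefficients of the stochastic algebraic Riccati equation: state dimension `n`, control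
dimension `m`, noise dimension `r`. -/
structure RiccatiData (n m r : ℕ) where
  A : Matrix (Fin n) (Fin n) ℝ
  C : Fin r → Matrix (Fin n) (Fin n) ℝ
  B : Matrix (Fin n) (Fin m) ℝ
  D : Fin r → Matrix (Fin n) (Fin m) ℝ
  Q : Matrix (Fin n) (Fin n) ℝ
  R : Matrix (Fin m) (Fin m) ℝ

namespace RiccatiData

variable {n m r : ℕ}

/-- `P A + Aᵀ P + ∑ C_lᵀ P C_l + Q`. -/
def stateBlock (d : RiccatiData n m r) (P : Matrix (Fin n) (Fin n) ℝ) :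
    Matrix (Fin n) (Fin n) ℝ :=
  P * d.A + d.Aᵀ * P + ∑ l, (d.C l)ᵀ * P * d.C l + d.Q

/-- `Bᵀ P + ∑ D_lᵀ P C_l`. -/
def crossBlock (d : RiccatiData n m r) (P : Matrix (Fin n) (Fin n) ℝ) :
    Matrix (Fin m) (Fin n) ℝ :=
  d.Bᵀ * P + ∑ l, (d.D l)ᵀ * P * d.C l

/-- `R + ∑ D_lᵀ P D_l`. -/
def controlBlock (d : RiccatiData n m r) (P : Matrix (Fin n) (Fin n) ℝ) :
    Matrix (Fin m) (Fin m) ℝ :=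
  d.R + ∑ l, (d.D l)ᵀ * P * d.D l

/-- The block operator `Λ(P)`. -/
def Lam (d : RiccatiData n m r) (P : Matrix (Fin n) (Fin n) ℝ) :
    Matrix (Fin n ⊕ Fin m) (Fin n ⊕ Fin m) ℝ :=
  Matrix.fromBlocks (d.stateBlock P) (d.crossBlock P)ᵀ (d.crossBlock P) (d.controlBlock P)

/-- The set `Γ` of symmetric `P` with `Λ(P) ⪰ 0` and `R + ∑ D_lᵀ P D_l ≻ 0`. -/
def Gam (d : RiccatiData n m r) : Set (Matrix (Fin n) (Fin n) ℝ) :=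
  {P | P.IsSymm ∧ (d.Lam P).PosSemidef ∧ (d.controlBlock P).PosDef}

/-- `P` satisfies the algebraic Riccati equation; the inverse occurring in it has to exist. -/
def IsARESolution (d : RiccatiData n m r) (P : Matrix (Fin n) (Fin n) ℝ) : Prop :=
  IsUnit (d.controlBlock P) ∧
    d.stateBlock P - (d.crossBlock P)ᵀ * (d.controlBlock P)⁻¹ * d.crossBlock P = 0

/-- The feedback gain `K(P) = -(R + ∑ D_lᵀ P D_l)⁻¹ (Bᵀ P + ∑ D_lᵀ P C_l)`. -/
def gain (d : RiccatiData n m r) (P : Matrix (Fin n) (Fin n) ℝ) : Matrix (Fin m) (Fin n) ℝ :=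
  -((d.controlBlock P)⁻¹ * d.crossBlock P)

/-- `K` is a mean-square stabilizer: `(A + B K, C_1 + D_1 K, …, C_r + D_r K)` is mean-square
stable. -/
def IsStabilizer {Ω : Type*} [MeasurableSpace Ω] (d : RiccatiData n m r) (μ : Measure Ω)
    (w : Fin r → ℝ≥0 → Ω → ℝ) (K : Matrix (Fin m) (Fin n) ℝ) : Prop :=
  IsMeanSquareStable μ w (d.A + d.B * K) (fun l => d.C l + d.D l * K)

/-- The system `[A, C_1, …, C_r; B, D_1, …, D_r]` is mean-square stabilizable. -/
def IsStabilizable {Ω : Type*} [MeasurableSpace Ω] (d : RiccatiData n m r) (μ : Measure Ω)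
    (w : Fin r → ℝ≥0 → Ω → ℝ) : Prop :=
  ∃ K : Matrix (Fin m) (Fin n) ℝ, d.IsStabilizer μ w K

/-- `P` is a stabilizing solution: a symmetric solution of the algebraic Riccati equation whose
feedback gain is a mean-square stabilizer. -/
structure IsStabilizingSolution {Ω : Type*} [MeasurableSpace Ω] (d : RiccatiData n m r)
    (μ : Measure Ω) (w : Fin r → ℝ≥0 → Ω → ℝ) (P : Matrix (Fin n) (Fin n) ℝ) : Prop where
  isSymm : P.IsSymm
  isARESolution : d.IsARESolution P
  isStabilizer : d.IsStabilizer μ w (d.gain P)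

end RiccatiData

end

/-! Mean-square stability is first replaced by an algebraic condition, `IsLyapunovStable`: some H ≻
0 satisfies L(H) ≺ 0 for the Lyapunov operator L(P) = PA + AᵀP + ∑ C_lᵀPC_l. The equivalence is
`isMeanSquareStable_iff_isLyapunovStable`. The second-moment matrix U(t) = E[X(t)X(t)ᵀ] solves the
linear equation U' = L*(U), with L* the trace adjoint of L
(`IsSDESolution.exists_secondMoment_ode`). If L(H) ≺ 0, then tr(HU) decays exponentially.
Conversely, if all second moments tend to zero, then the flow G' = L(G), G(0) = 1 tends to zero by
duality, and H = ∫₀ᵀ G satisfies L(H) = G(T) - 1 ≺ 0 for large T. As stability includes the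
existence of a solution, the equivalence also needs `exists_isSDESolution`, proved by dyadic Euler
schemes.

The second-moment equation uses no Itô formula. In the Hilbert space L²(P), each coordinate of X is
a constant plus a differentiable curve plus a curve with martingale orthogonality, and
`inner_eq_add_integral_of_orthogonal` is the product rule for such curves. The Itô isometry and the
martingale property come from elementary integrands, once increments of w are known to be
independent of the augmented filtration.

The algebraic part rests on three facts. For a stable system, L(M) ⪯ 0 forces M ⪰ 0
(`IsLyapunovStable.posSemidef`), so the Lyapunov equation is uniquely solvable among symmetric
matrices. Completing the square (`closedLyap_add_costRate_eq`) gives L_K(P) + Q + KᵀRK = (K - K(P))ᵀ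
𝓡(P) (K - K(P)) + Ric(P), where L_K is the Lyapunov operator of the loop closed by K. Finally,
detectability makes every gain of finite cost stabilizing: L_K(P) + Q + KᵀRK ⪯ 0 with P ⪰ 0 suffices
(`IsLyapunovDetectable.isLyapunovStabilizer`).

Since 0 ∈ Γ gives R ≻ 0, and Q ⪰ 0 as a sum of squares, policy iteration can be run from any
stabilizer. The cost matrices of successive gains decrease and stay nonnegative. Their limit solves
the Riccati equation, and its gain is stabilizing by the third fact. For uniqueness, a stabilizing
solution is nonnegative, and completing the square at one solution with the gain of another orders
the two; exchanging their roles gives equality. -/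

/-! ### Independence of Brownian increments from the augmented filtration. -/

section Augmentation

variable {Ω : Type*} [mΩ : MeasurableSpace Ω] {P : Measure Ω} {r : ℕ} {w : Fin r → ℝ≥0 → Ω → ℝ}

lemma IsStandardBrownianMotion.measurable [P.IsComplete] (hw : IsStandardBrownianMotion P w) (l : Fin r) (t : ℝ≥0) :
    Measurable (w l t) :=
  ((hw.isBrownianReal l).aemeasurable t).nullMeasurable.measurable_of_complete

/-- The increments after time `s` are independent of the past up to time `s`. -/
lemma IsStandardBrownianMotion.indepFun_past [IsProbabilityMeasure P] [P.IsComplete] (hw : IsStandardBrownianMotion P w)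
    {s u : ℝ≥0} (hsu : s ≤ u) :
    IndepFun (fun ω l => w l u ω - w l s ω) (fun ω l (t : ℝ≥0) => w l (min t s) ω) P := by
  have hm := hw.measurable
  -- Each component is cut at time s: `true` labels the increments after s, `false` the path stopped
  -- at s. Independence across components and, within each one, across the two labels makes all 2r
  -- pieces independent, so they may be regrouped by label.
  let X : Fin r → Bool → Ω → (ℝ≥0 → ℝ) := fun l b ω =>
    if b then fun t => w l (s + t) ω - w l s ω else fun t => w l (min t s) ω
  have mX : ∀ l b, Measurable (X l b) := by
    intro l b
    cases b
    · exact measurable_pi_lambda _ fun t => hm l _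
    · exact measurable_pi_lambda _ fun t => (hm l _).sub (hm l _)
  have h1 : ProbabilityTheory.iIndepFun (fun l ω => (X l · ω)) P := by
    have := hw.iIndepFun.comp
      (fun (_ : Fin r) (f : ℝ≥0 → ℝ) (b : Bool) (t : ℝ≥0) =>
        if b then f (s + t) - f s else f (min t s)) (by
          intro l
          refine measurable_pi_lambda _ fun b => measurable_pi_lambda _ fun t => ?_
          cases b <;> simp <;> fun_prop)
    refine this.congr ?_
    intro l
    refine Eventually.of_forall fun ω => ?_
    funext b t
    cases b <;> simp [X]
  have h2 : ∀ l, ProbabilityTheory.iIndepFun (X l) P := by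
    intro l
    have h := (hw.isBrownianReal l).toIsPreBrownianReal.indepFun_shift s
    have h3 : IndepFun (X l true) (X l false) P := by
      have := h.comp (φ := id) (ψ := fun (f : Set.Iic s → ℝ) (t : ℝ≥0) =>
        f ⟨min t s, min_le_right t s⟩) measurable_id
        (measurable_pi_lambda _ fun t => measurable_pi_apply _)
      exact this
    rw [iIndepFun_iff_measure_inter_preimage_eq_mul]
    intro S sets hsets
    have hS : S = ∅ ∨ S = {true} ∨ S = {false} ∨ S = {true, false} := by
      clear hsets; revert S; decide
    rcases hS with rfl | rfl | rfl | rfl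
    · simp
    · simp
    · simp
    · have := h3.measure_inter_preimage_eq_mul (sets true) (sets false)
        (hsets true (by simp)) (hsets false (by simp))
      have e : ⋂ i ∈ ({true, false} : Finset Bool), X l i ⁻¹' sets i =
          X l true ⁻¹' sets true ∩ X l false ⁻¹' sets false := by ext; simp [and_comm]
      rw [e, this]; simp
  have h := iIndepFun_uncurry' mX h1 h2
  have hf := h.indepFun_finset (Finset.univ.filter fun p => p.2 = true)
    (Finset.univ.filter fun p => p.2 = false) (by
      rw [Finset.disjoint_filter]; simp) (fun p => mX p.1 p.2)
  have := hf.comp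
    (φ := fun (f : {p // p ∈ Finset.univ.filter fun p : Fin r × Bool => p.2 = true} → ℝ≥0 → ℝ)
      (l : Fin r) => f ⟨(l, true), by simp⟩ (u - s))
    (ψ := fun (f : {p // p ∈ Finset.univ.filter fun p : Fin r × Bool => p.2 = false} → ℝ≥0 → ℝ)
      (l : Fin r) => f ⟨(l, false), by simp⟩)
    (measurable_pi_lambda _ fun l => (measurable_pi_apply _).comp (measurable_pi_apply _))
    (measurable_pi_lambda _ fun l => measurable_pi_apply _)
  have e1 : (fun ω l => w l u ω - w l s ω) = fun ω l => X l true ω (u - s) := by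
    funext ω l
    simp [X, add_tsub_cancel_of_le hsu]
  rw [e1]
  exact this

/-- Every event of the completed filtration agrees up to a null set with an event of the path
stopped at s, and independence sees events only modulo null sets. -/
lemma IsStandardBrownianMotion.indep_completedNaturalFiltration [IsProbabilityMeasure P] [P.IsComplete]
    (hw : IsStandardBrownianMotion P w) {s u : ℝ≥0} (hsu : s ≤ u) :
    Indep (completedNaturalFiltration P w s)
      (MeasurableSpace.comap (fun ω l => w l u ω - w l s ω) inferInstance) P := by
  set past : Ω → Fin r → ℝ≥0 → ℝ := fun ω l t => w l (min t s) ω with hpast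
  have hle : (completedNaturalFiltration P w s : MeasurableSpace Ω) ≤
      @eventuallyMeasurableSpace Ω (MeasurableSpace.comap past inferInstance) (ae P) _ := by
    refine MeasurableSpace.generateFrom_le ?_
    intro A hA0
    obtain ⟨hA, h0⟩ := hA0
    rcases h0 with ⟨l, v, hv, b, hb, rfl⟩ | h
    · refine (@le_eventuallyMeasurableSpace Ω (MeasurableSpace.comap past inferInstance) (ae P) _) _ ?_
      refine ⟨(fun f => f l v) ⁻¹' b, (by fun_prop : Measurable
        (fun f : Fin r → ℝ≥0 → ℝ => f l v)) hb, ?_⟩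
      ext ω
      simp [hpast, min_eq_left hv]
    · refine ⟨∅, @MeasurableSet.empty _ (MeasurableSpace.comap past inferInstance), ?_⟩
      exact (ae_eq_empty.2 h)
  rw [Indep_iff]
  intro A B hA hB
  obtain ⟨A', hA', hAA'⟩ := hle _ hA
  have hi : Indep (MeasurableSpace.comap past inferInstance) (MeasurableSpace.comap (fun ω l => w l u ω - w l s ω) inferInstance) P :=
    (hw.indepFun_past hsu).symm
  have := (Indep_iff _ _ _).1 hi A' B hA' hB
  rw [measure_congr hAA', measure_congr (hAA'.inter (ae_eq_refl B)), this]

lemma augmentedFiltration_le {s t : ℝ≥0} (hst : s < t) :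
    (augmentedFiltration P w s : MeasurableSpace Ω) ≤ completedNaturalFiltration P w t := by
  rw [augmentedFiltration, Filtration.rightCont_eq]
  exact iInf₂_le t hst

lemma IsStandardBrownianMotion.measurable_augmentedFiltration [P.IsComplete] (hw : IsStandardBrownianMotion P w)
    (l : Fin r) {s t : ℝ≥0} (hst : s ≤ t) : Measurable[augmentedFiltration P w t] (w l s) := by
  intro b hb
  have h1 : MeasurableSet[completedNaturalFiltration P w t] (w l s ⁻¹' b) :=
    MeasurableSpace.measurableSet_generateFrom
      ⟨hw.measurable l s hb, Or.inl ⟨l, s, hst, b, hb, rfl⟩⟩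
  exact (completedNaturalFiltration P w).le_rightCont t _ h1

lemma measurableSet_augmentedFiltration_of_null {A : Set Ω} (hA : MeasurableSet A)
    (h : P A = 0) (t : ℝ≥0) : MeasurableSet[augmentedFiltration P w t] A := by
  have h1 : MeasurableSet[completedNaturalFiltration P w t] A :=
    MeasurableSpace.measurableSet_generateFrom ⟨hA, Or.inr h⟩
  exact (completedNaturalFiltration P w).le_rightCont t _ h1

/-- The increments after time `s` are independent of the right-continuous augmented filtration. -/
lemma IsStandardBrownianMotion.indep_augmentedFiltration [IsProbabilityMeasure P] [P.IsComplete]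
    (hw : IsStandardBrownianMotion P w) {s u : ℝ≥0} (hsu : s ≤ u) :
    Indep (augmentedFiltration P w s)
      (MeasurableSpace.comap (fun ω l => w l u ω - w l s ω) inferInstance) P := by
  have hm := hw.measurable
  rcases hsu.eq_or_lt with rfl | hsu
  · have : (fun ω l => w l s ω - w l s ω) = fun (_ : Ω) (_ : Fin r) => (0 : ℝ) := by
      funext ω l; simp
    rw [this, MeasurableSpace.comap_const]
    exact indep_bot_right _
  refine indep_comap_of_bcf ((augmentedFiltration P w).le s)
    (measurable_pi_lambda _ fun l => (hm l u).sub (hm l s)).aemeasurable ?_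
  intro A hA f
  have hA' : MeasurableSet A := (augmentedFiltration P w).le s _ hA
  have hc : ∀ᵐ ω ∂P, ∀ l, Continuous (w l · ω) := ae_all_iff.2 fun l => (hw.isBrownianReal l).cont
  -- Right-continuity is absorbed by a limit v ↓ s. For v > s the event `A` already belongs to the
  -- completed filtration at v, so the expectation factors. Path continuity and boundedness of `f`
  -- then pass the factorization to v = s.
  have hlim : ∀ B : Set Ω, Tendsto (fun v => ∫ ω in B, f (fun l => w l u ω - w l v ω) ∂P)
      (𝓝[>] s) (𝓝 (∫ ω in B, f (fun l => w l u ω - w l s ω) ∂P)) := by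
    intro B
    refine tendsto_integral_filter_of_dominated_convergence (fun _ => ‖f‖) ?_ ?_ ?_ ?_
    · refine Eventually.of_forall fun v => ?_
      exact (f.continuous.measurable.comp
        (measurable_pi_lambda _ fun l => (hm l u).sub (hm l v))).aestronglyMeasurable
    · exact Eventually.of_forall fun v => Eventually.of_forall fun ω => f.norm_coe_le_norm _
    · exact integrable_const _
    · refine ae_restrict_of_ae ?_
      filter_upwards [hc] with ω hω
      refine (f.continuous.tendsto _).comp ?_
      refine tendsto_pi_nhds.2 fun l => ?_
      exact tendsto_const_nhds.sub (((hω l).tendsto s).mono_left nhdsWithin_le_nhds)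
  have h1 := hlim A
  have h2 := hlim Set.univ
  simp only [Measure.restrict_univ] at h2
  refine tendsto_nhds_unique (h1.congr' ?_) (h2.const_mul (P.real A))
  have : Set.Ioc s u ∈ 𝓝[>] s := Ioc_mem_nhdsGT hsu
  filter_upwards [this] with v hv
  have hi := hw.indep_completedNaturalFiltration hv.2
  have hAv : MeasurableSet[completedNaturalFiltration P w v] A := augmentedFiltration_le hv.1 _ hA
  have hi' : IndepFun (A.indicator fun _ => (1 : ℝ)) (fun ω => f fun l => w l u ω - w l v ω) P := by
    refine indep_of_indep_of_le hi ?_ ?_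
    · exact Measurable.comap_le (@Measurable.indicator _ _ _ _ _ _ _
        (@measurable_const _ _ _ _ _) hAv)
    · refine Measurable.comap_le ?_
      exact f.continuous.measurable.comp (comap_measurable _)
  have h3 := hi'.integral_fun_mul_eq_mul_integral
    ((measurable_const.indicator hA').aestronglyMeasurable)
    (f.continuous.measurable.comp
        (measurable_pi_lambda _ fun l => (hm l u).sub (hm l v))).aestronglyMeasurable
  rw [integral_indicator_const _ hA'] at h3
  rw [← integral_indicator hA']
  simp only [smul_eq_mul, mul_one] at h3
  rw [← h3]
  congr 1
  funext ω
  by_cases hω : ω ∈ A <;> simp [hω]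

end Augmentation

lemma MeasureTheory.MemLp.integrable_fun_mul {α : Type*} [MeasurableSpace α] {μ : Measure α}
    {f g : α → ℝ} (hf : MemLp f 2 μ) (hg : MemLp g 2 μ) : Integrable (fun x => f x * g x) μ :=
  hf.integrable_mul hg

/-! ### Moments of increments multiplied by coefficients known earlier. -/

section Increments

variable {Ω : Type*} [mΩ : MeasurableSpace Ω] {P : Measure Ω} {r : ℕ} {w : Fin r → ℝ≥0 → Ω → ℝ}

lemma IsStandardBrownianMotion.memLp_increment (hw : IsStandardBrownianMotion P w) (l : Fin r)
    (s u : ℝ≥0) : MemLp (fun ω => w l u ω - w l s ω) 2 P :=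
  ((hw.isBrownianReal l).toIsPreBrownianReal.hasLaw_sub u s).hasGaussianLaw.memLp_two

lemma IsStandardBrownianMotion.integral_increment [IsProbabilityMeasure P]
    (hw : IsStandardBrownianMotion P w) (l : Fin r)
    (s u : ℝ≥0) : ∫ ω, (w l u ω - w l s ω) ∂P = 0 := by
  have h := (hw.isBrownianReal l).toIsPreBrownianReal
  rw [integral_sub (h.integrable_eval u) (h.integrable_eval s), h.integral_eval, h.integral_eval,
    sub_zero]

lemma IsStandardBrownianMotion.integral_increment_mul_increment [IsProbabilityMeasure P]
    (hw : IsStandardBrownianMotion P w) (l l' : Fin r) {s u : ℝ≥0} (hsu : s ≤ u) :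
    ∫ ω, (w l u ω - w l s ω) * (w l' u ω - w l' s ω) ∂P =
      if l = l' then (u : ℝ) - s else 0 := by
  split_ifs with h
  · subst h
    have h := (hw.isBrownianReal l).toIsPreBrownianReal
    have h1 := (h.hasLaw_sub u s).variance_eq
    rw [variance_id_gaussianReal, variance_of_integral_eq_zero (h.hasLaw_sub u s).aemeasurable
      (hw.integral_increment l s u)] at h1
    have h2 : ((nndist u.1 s.1 : ℝ≥0) : ℝ) = (u : ℝ) - s := by
      rw [coe_nndist, Real.dist_eq, abs_of_nonneg]
      · rfl
      · exact sub_nonneg.2 hsu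
    rw [h2] at h1
    rw [← h1]
    refine integral_congr_ae (Eventually.of_forall fun ω => ?_)
    simp [pow_two]
  · have hi : IndepFun (fun ω => w l u ω - w l s ω) (fun ω => w l' u ω - w l' s ω) P :=
      (hw.iIndepFun.indepFun h).comp (φ := fun f : ℝ≥0 → ℝ => f u - f s)
        (ψ := fun f : ℝ≥0 → ℝ => f u - f s) (by fun_prop) (by fun_prop)
    rw [hi.integral_fun_mul_eq_mul_integral (hw.memLp_increment l s u).1
      (hw.memLp_increment l' s u).1, hw.integral_increment, zero_mul]

lemma IsStandardBrownianMotion.measurable_mul_increment [P.IsComplete]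
    (hw : IsStandardBrownianMotion P w)
    {a s u v : ℝ≥0} (hsv : s ≤ v) (huv : u ≤ v) (hav : a ≤ v) {ξ : Ω → ℝ}
    (hξ : Measurable[augmentedFiltration P w a] ξ) (l : Fin r) :
    Measurable[augmentedFiltration P w v] (fun ω => ξ ω * (w l u ω - w l s ω)) :=
  (hξ.mono ((augmentedFiltration P w).mono hav) le_rfl).mul
    ((hw.measurable_augmentedFiltration l huv).sub (hw.measurable_augmentedFiltration l hsv))

variable [IsProbabilityMeasure P] [P.IsComplete]

lemma IsStandardBrownianMotion.indepFun_increment (hw : IsStandardBrownianMotion P w)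
    {s u : ℝ≥0} (hsu : s ≤ u) {ξ : Ω → ℝ} (hξ : Measurable[augmentedFiltration P w s] ξ)
    {g : (Fin r → ℝ) → ℝ} (hg : Measurable g) :
    IndepFun ξ (fun ω => g fun l => w l u ω - w l s ω) P := by
  refine indep_of_indep_of_le (hw.indep_augmentedFiltration hsu) hξ.comap_le ?_
  exact Measurable.comap_le (hg.comp (comap_measurable _))

lemma IsStandardBrownianMotion.integrable_mul_increment (hw : IsStandardBrownianMotion P w)
    {s u : ℝ≥0} (hsu : s ≤ u) {ξ : Ω → ℝ} (hξ : Measurable[augmentedFiltration P w s] ξ)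
    (hi : Integrable ξ P) (l : Fin r) : Integrable (fun ω => ξ ω * (w l u ω - w l s ω)) P :=
  (hw.indepFun_increment hsu hξ (g := fun f => f l) (by fun_prop)).integrable_mul hi
    ((hw.memLp_increment l s u).integrable one_le_two)

lemma IsStandardBrownianMotion.integral_mul_increment (hw : IsStandardBrownianMotion P w)
    {s u : ℝ≥0} (hsu : s ≤ u) {ξ : Ω → ℝ} (hξ : Measurable[augmentedFiltration P w s] ξ)
    (l : Fin r) : ∫ ω, ξ ω * (w l u ω - w l s ω) ∂P = 0 := by
  rw [(hw.indepFun_increment hsu hξ (g := fun f => f l)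
    (by fun_prop)).integral_fun_mul_eq_mul_integral
    (hξ.mono ((augmentedFiltration P w).le s) le_rfl).aestronglyMeasurable
    (hw.memLp_increment l s u).1, hw.integral_increment, mul_zero]

lemma IsStandardBrownianMotion.integrable_mul_increment_mul_increment
    (hw : IsStandardBrownianMotion P w)
    {s u : ℝ≥0} (hsu : s ≤ u) {ξ : Ω → ℝ} (hξ : Measurable[augmentedFiltration P w s] ξ)
    (hi : Integrable ξ P) (l l' : Fin r) :
    Integrable (fun ω => ξ ω * ((w l u ω - w l s ω) * (w l' u ω - w l' s ω))) P :=
  (hw.indepFun_increment hsu hξ (g := fun f => f l * f l') (by fun_prop)).integrable_mul hi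
    ((hw.memLp_increment l s u).integrable_fun_mul (hw.memLp_increment l' s u))

lemma IsStandardBrownianMotion.integral_mul_increment_mul_increment
    (hw : IsStandardBrownianMotion P w)
    {s u : ℝ≥0} (hsu : s ≤ u) {ξ : Ω → ℝ} (hξ : Measurable[augmentedFiltration P w s] ξ)
    (l l' : Fin r) :
    ∫ ω, ξ ω * ((w l u ω - w l s ω) * (w l' u ω - w l' s ω)) ∂P =
      if l = l' then (∫ ω, ξ ω ∂P) * ((u : ℝ) - s) else 0 := by
  rw [(hw.indepFun_increment hsu hξ (g := fun f => f l * f l')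
    (by fun_prop)).integral_fun_mul_eq_mul_integral
    (hξ.mono ((augmentedFiltration P w).le s) le_rfl).aestronglyMeasurable
    ((hw.memLp_increment l s u).integrable_fun_mul (hw.memLp_increment l' s u)).1,
    hw.integral_increment_mul_increment l l' hsu]
  split_ifs <;> simp

/-- Second moments of ξ are enough: ξ² is independent of the squared increment, so their product is
integrable. -/
lemma IsStandardBrownianMotion.memLp_mul_increment (hw : IsStandardBrownianMotion P w)
    {s u : ℝ≥0} (hsu : s ≤ u) {ξ : Ω → ℝ} (hξ : Measurable[augmentedFiltration P w s] ξ)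
    (hi : MemLp ξ 2 P) (l : Fin r) : MemLp (fun ω => ξ ω * (w l u ω - w l s ω)) 2 P := by
  refine (memLp_two_iff_integrable_sq (hi.1.mul (hw.memLp_increment l s u).1)).2 ?_
  have h := hw.integrable_mul_increment_mul_increment hsu
    (ξ := fun ω => ξ ω ^ 2) (hξ.pow_const 2) hi.integrable_sq l l
  refine h.congr (Eventually.of_forall fun ω => ?_)
  simp only [Pi.mul_apply]
  ring

section Pair

variable {a b c d : ℝ≥0} {ξ η : Ω → ℝ}

/-- All factors but the last increment are known at time c, so its vanishing mean kills the product.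
The separate time e allows η to be known before c, as happens when an interval is split. -/
lemma IsStandardBrownianMotion.integral_pair_of_le (hw : IsStandardBrownianMotion P w)
    (hab : a ≤ b) (hcd : c ≤ d) (hbc : b ≤ c)
    {e : ℝ≥0} (hec : e ≤ c)
    (hξ : Measurable[augmentedFiltration P w a] ξ)
    (hη : Measurable[augmentedFiltration P w e] η)
    (l l' : Fin r) :
    ∫ ω, (ξ ω * (w l b ω - w l a ω)) * (η ω * (w l' d ω - w l' c ω)) ∂P = 0 := by
  rw [← hw.integral_mul_increment hcd
    (ξ := fun ω => (ξ ω * (w l b ω - w l a ω)) * η ω) ?_ l']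
  · refine integral_congr_ae (Eventually.of_forall fun ω => ?_)
    simp only
    ring
  · exact (hw.measurable_mul_increment (hab.trans hbc) hbc (hab.trans hbc) hξ l).mul
      (hη.mono ((augmentedFiltration P w).mono hec) le_rfl)

lemma IsStandardBrownianMotion.integral_pair_of_eq (hw : IsStandardBrownianMotion P w)
    (hcb : c ≤ b) (hcd : c ≤ d)
    (hξ : Measurable[augmentedFiltration P w c] ξ) (hξi : MemLp ξ 2 P)
    (hη : Measurable[augmentedFiltration P w c] η) (hηi : MemLp η 2 P)
    (l l' : Fin r) :
    ∫ ω, (ξ ω * (w l b ω - w l c ω)) * (η ω * (w l' d ω - w l' c ω)) ∂P =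
      if l = l' then (∫ ω, ξ ω * η ω ∂P) * ((min b d - c : ℝ≥0) : ℝ) else 0 := by
  wlog hbd : b ≤ d generalizing b d ξ η l l'
  · have := this hcd hcb hη hηi hξ hξi l' l (le_of_not_ge hbd)
    simp only [mul_comm (η _ * _)] at this
    rw [this, min_comm]
    simp only [mul_comm (η _), eq_comm]
  -- The longer increment is split at b: the common part [c, b] carries the covariance and the rest
  -- is orthogonal.
  have e : ∀ ω, (ξ ω * (w l b ω - w l c ω)) * (η ω * (w l' d ω - w l' c ω)) =
      (ξ ω * η ω) * ((w l b ω - w l c ω) * (w l' b ω - w l' c ω)) +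
      (ξ ω * (w l b ω - w l c ω)) * (η ω * (w l' d ω - w l' b ω)) := fun ω => by ring
  simp_rw [e]
  have hm : Measurable[augmentedFiltration P w c] fun ω => ξ ω * η ω := hξ.mul hη
  have hηb : Measurable[augmentedFiltration P w b] η :=
    hη.mono ((augmentedFiltration P w).mono hcb) le_rfl
  rw [integral_add (hw.integrable_mul_increment_mul_increment hcb hm (hξi.integrable_fun_mul hηi) l l')
      ((hw.memLp_mul_increment hcb hξ hξi l).integrable_fun_mul
        (hw.memLp_mul_increment hbd hηb hηi l')),
    hw.integral_mul_increment_mul_increment hcb hm,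
    hw.integral_pair_of_le hcb hbd le_rfl hcb hξ hη, add_zero, min_eq_left hbd,
    NNReal.coe_sub hcb]

/-- Covariance of two stochastic integrals of one-step integrands. -/
lemma IsStandardBrownianMotion.integral_pair (hw : IsStandardBrownianMotion P w)
    (hab : a ≤ b) (hcd : c ≤ d)
    (hξ : Measurable[augmentedFiltration P w a] ξ) (hξi : MemLp ξ 2 P)
    (hη : Measurable[augmentedFiltration P w c] η) (hηi : MemLp η 2 P)
    (l l' : Fin r) :
    ∫ ω, (ξ ω * (w l b ω - w l a ω)) * (η ω * (w l' d ω - w l' c ω)) ∂P =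
      if l = l' then (∫ ω, ξ ω * η ω ∂P) * ((min b d - max a c : ℝ≥0) : ℝ) else 0 := by
  wlog hac : a ≤ c generalizing a b c d ξ η l l'
  · have := this hcd hab hη hηi hξ hξi l' l (le_of_not_ge hac)
    simp only [mul_comm (η _ * _)] at this
    rw [this, min_comm, max_comm]
    simp only [mul_comm (η _), eq_comm]
  -- For disjoint intervals, truncated subtraction in `ℝ≥0` makes the overlap length zero; otherwise
  -- [a, b] is split at c.
  rcases le_total b c with hbc | hcb
  · rw [hw.integral_pair_of_le hab hcd hbc le_rfl hξ hη, max_eq_right hac,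
      tsub_eq_zero_of_le ((min_le_left _ _).trans hbc)]
    simp
  have e : ∀ ω, (ξ ω * (w l b ω - w l a ω)) * (η ω * (w l' d ω - w l' c ω)) =
      (ξ ω * (w l c ω - w l a ω)) * (η ω * (w l' d ω - w l' c ω)) +
      (ξ ω * (w l b ω - w l c ω)) * (η ω * (w l' d ω - w l' c ω)) := fun ω => by ring
  simp_rw [e]
  have hξc : Measurable[augmentedFiltration P w c] ξ :=
    hξ.mono ((augmentedFiltration P w).mono hac) le_rfl
  rw [integral_add ((hw.memLp_mul_increment hac hξ hξi l).integrable_fun_mul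
        (hw.memLp_mul_increment hcd hη hηi l'))
      ((hw.memLp_mul_increment hcb hξc hξi l).integrable_fun_mul
        (hw.memLp_mul_increment hcd hη hηi l')),
    hw.integral_pair_of_le hac hcd le_rfl le_rfl hξ hη, zero_add,
    hw.integral_pair_of_eq hcb hcd hξc hξi hη hηi, max_eq_right hac]

end Pair

end Increments

/-! ### Elementary integrands: space-time norms, martingale property and isometry. -/

/-- The product of `P` with Lebesgue measure on `(0, t]`. -/
noncomputable def timeProd {Ω : Type*} [MeasurableSpace Ω] (P : Measure Ω) (t : ℝ≥0) :
    Measure (Ω × ℝ) :=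
  P.prod (volume.restrict (Set.Ioc (0 : ℝ) t))

/-- A process indexed by `ℝ≥0` as a function on `Ω × ℝ`. -/
def spaceTime {Ω β : Type*} (φ : ℝ≥0 → Ω → β) (z : Ω × ℝ) : β := φ z.2.toNNReal z.1

lemma MeasureTheory.MemLp.mul_prod_two {α β : Type*} [MeasurableSpace α] [MeasurableSpace β]
    {μ : Measure α} {ν : Measure β} [SFinite μ] [SFinite ν] {f : α → ℝ} {g : β → ℝ}
    (hf : MemLp f 2 μ) (hg : MemLp g 2 ν) : MemLp (fun z : α × β => f z.1 * g z.2) 2 (μ.prod ν) := by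
  refine (memLp_two_iff_integrable_sq (hf.1.comp_fst.mul hg.1.comp_snd)).2 ?_
  refine (hf.integrable_sq.mul_prod hg.integrable_sq).congr (Eventually.of_forall fun z => ?_)
  simp only [Pi.mul_apply, mul_pow]

section Elementary

variable {Ω : Type*} [mΩ : MeasurableSpace Ω] {P : Measure Ω} {r : ℕ} {w : Fin r → ℝ≥0 → Ω → ℝ}

lemma NNReal.indicator_Ioc_toNNReal (a b : ℝ≥0) (c : ℝ) (s : ℝ) :
    (Set.Ioc a b).indicator (fun _ => c) s.toNNReal =
      c * (Set.Ioc (a : ℝ) b).indicator (fun _ => (1 : ℝ)) s := by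
  have : s.toNNReal ∈ Set.Ioc a b ↔ s ∈ Set.Ioc (a : ℝ) b := by
    simp only [Set.mem_Ioc, Real.lt_toNNReal_iff_coe_lt, Real.toNNReal_le_iff_le_coe]
  by_cases h : s ∈ Set.Ioc (a : ℝ) b
  · rw [Set.indicator_of_mem (this.2 h), Set.indicator_of_mem h, mul_one]
  · rw [Set.indicator_of_notMem (mt this.1 h), Set.indicator_of_notMem h, mul_zero]

/-- The overlap length is written with truncated subtraction, in the shape that
`IsStandardBrownianMotion.integral_pair` produces after both intervals have been stopped at t. -/
lemma setIntegral_indicator_mul_indicator (a b c d t : ℝ≥0) :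
    ∫ s in Set.Ioc (0 : ℝ) t, (Set.Ioc (a : ℝ) b).indicator (fun _ => (1 : ℝ)) s *
      (Set.Ioc (c : ℝ) d).indicator (fun _ => (1 : ℝ)) s =
      ((min (min b t) (min d t) - max (min a t) (min c t) : ℝ≥0) : ℝ) := by
  have e : ∀ s, (Set.Ioc (a : ℝ) b).indicator (fun _ => (1 : ℝ)) s *
      (Set.Ioc (c : ℝ) d).indicator (fun _ => (1 : ℝ)) s =
      (Set.Ioc (max a c : ℝ) (min b d)).indicator 1 s := by
    intro s
    rw [← Set.Ioc_inter_Ioc, Set.inter_indicator_one]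
    rfl
  simp_rw [e]
  rw [integral_indicator_one measurableSet_Ioc, Measure.real,
    Measure.restrict_apply measurableSet_Ioc, Set.Ioc_inter_Ioc, Real.volume_Ioc,
    NNReal.coe_sub_def, ENNReal.toReal_ofReal']
  push_cast
  rw [max_eq_left (le_max_of_le_left a.coe_nonneg), ← inf_inf_distrib_right,
    ← inf_sup_right]
  rcases le_total (max (a : ℝ) c) t with h | h
  · rw [min_eq_left h]
  · rw [min_eq_right h, max_eq_right (sub_nonpos.2 ((min_le_right _ _).trans h)),
      max_eq_right (sub_nonpos.2 (min_le_right _ _))]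

namespace ElementaryProcess

variable {ℱ : Filtration ℝ≥0 mΩ}

lemma spaceTime_eval (V : ElementaryProcess P ℱ) (z : Ω × ℝ) : spaceTime V.eval z =
    ∑ k ∈ Finset.range V.N, V.coeff k z.1 *
      (Set.Ioc (V.time k : ℝ) (V.time (k + 1))).indicator (fun _ => (1 : ℝ)) z.2 := by
  simp only [spaceTime, eval, NNReal.indicator_Ioc_toNNReal]

lemma measurable_coeff (V : ElementaryProcess P ℱ) (k : ℕ) : Measurable (V.coeff k) :=
  (V.coeff_measurable k).mono (ℱ.le _) le_rfl

lemma measurable_spaceTime_eval (V : ElementaryProcess P ℱ) : Measurable (spaceTime V.eval) := by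
  have : spaceTime V.eval = fun z => ∑ k ∈ Finset.range V.N, V.coeff k z.1 *
      (Set.Ioc (V.time k : ℝ) (V.time (k + 1))).indicator (fun _ => (1 : ℝ)) z.2 :=
    funext V.spaceTime_eval
  rw [this]
  refine Finset.measurable_sum _ fun k _ => ?_
  exact ((V.measurable_coeff k).comp measurable_fst).mul
    ((measurable_const.indicator measurableSet_Ioc).comp measurable_snd)

lemma memLp_spaceTime_eval [IsProbabilityMeasure P] (V : ElementaryProcess P ℱ) (t : ℝ≥0) :
    MemLp (spaceTime V.eval) 2 (timeProd P t) := by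
  have : spaceTime V.eval = fun z => ∑ k ∈ Finset.range V.N, V.coeff k z.1 *
      (Set.Ioc (V.time k : ℝ) (V.time (k + 1))).indicator (fun _ => (1 : ℝ)) z.2 :=
    funext V.spaceTime_eval
  rw [this]
  refine memLp_finsetSum _ fun k _ => ?_
  exact (V.coeff_memLp k).mul_prod_two
    (g := (Set.Ioc (V.time k : ℝ) (V.time (k + 1))).indicator (fun _ => (1 : ℝ)))
    ((memLp_const 1).indicator measurableSet_Ioc)

variable [P.IsComplete]

lemma measurable_integral (hw : IsStandardBrownianMotion P w)
    (V : ElementaryProcess P (augmentedFiltration P w)) (l : Fin r) (t : ℝ≥0) :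
    Measurable[augmentedFiltration P w t] (V.integral (w l) t) := by
  refine Finset.measurable_sum _ fun k _ => ?_
  rcases le_total (V.time k) t with h | h
  · exact hw.measurable_mul_increment (min_le_right _ _) (min_le_right _ _) h
      (V.coeff_measurable k) l
  · have : (fun ω => V.coeff k ω * (w l (min (V.time (k + 1)) t) ω - w l (min (V.time k) t) ω)) =
        fun _ => 0 := by
      funext ω
      rw [min_eq_right h, min_eq_right (h.trans (V.time_mono k.le_succ)), sub_self, mul_zero]
    rw [this]
    exact measurable_const

variable [IsProbabilityMeasure P]

lemma memLp_term (hw : IsStandardBrownianMotion P w)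
    (V : ElementaryProcess P (augmentedFiltration P w)) (l : Fin r) (t : ℝ≥0) (k : ℕ) :
    MemLp (fun ω => V.coeff k ω *
      (w l (min (V.time (k + 1)) t) ω - w l (min (V.time k) t) ω)) 2 P := by
  rcases le_total (V.time k) t with h | h
  · rw [min_eq_left h]
    exact hw.memLp_mul_increment (le_min (V.time_mono k.le_succ) h) (V.coeff_measurable k)
      (V.coeff_memLp k) l
  · have : (fun ω => V.coeff k ω * (w l (min (V.time (k + 1)) t) ω - w l (min (V.time k) t) ω)) =
        fun _ => 0 := by
      funext ω
      rw [min_eq_right h, min_eq_right (h.trans (V.time_mono k.le_succ)), sub_self, mul_zero]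
    rw [this]
    exact memLp_const 0

lemma memLp_integral (hw : IsStandardBrownianMotion P w)
    (V : ElementaryProcess P (augmentedFiltration P w)) (l : Fin r) (t : ℝ≥0) :
    MemLp (V.integral (w l) t) 2 P :=
  memLp_finsetSum _ fun k _ => V.memLp_term hw l t k

/-- The martingale property of elementary stochastic integrals. -/
lemma integral_mul_integral_of_le (hw : IsStandardBrownianMotion P w)
    (V : ElementaryProcess P (augmentedFiltration P w)) (l : Fin r) {s t : ℝ≥0} (hst : s ≤ t)
    {Z : Ω → ℝ} (hZ : Measurable[augmentedFiltration P w s] Z) (hZi : MemLp Z 2 P) :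
    ∫ ω, Z ω * V.integral (w l) t ω ∂P = ∫ ω, Z ω * V.integral (w l) s ω ∂P := by
  simp only [integral, Finset.mul_sum]
  rw [integral_finsetSum _ fun k _ => hZi.integrable_fun_mul (V.memLp_term hw l t k),
    integral_finsetSum _ fun k _ => hZi.integrable_fun_mul (V.memLp_term hw l s k)]
  refine Finset.sum_congr rfl fun k _ => ?_
  rw [← sub_eq_zero, ← integral_sub (hZi.integrable_fun_mul (V.memLp_term hw l t k))
    (hZi.integrable_fun_mul (V.memLp_term hw l s k))]
  have htk := V.time_mono k.le_succ
  set a := V.time k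
  set b := V.time (k + 1)
  rcases le_total t a with hta | hat
  · have hsa := hst.trans hta
    simp [min_eq_right hta, min_eq_right hsa, min_eq_right (hta.trans htk),
      min_eq_right (hsa.trans htk)]
  -- The difference of the two terms is the increment over the part of (a, b] between s and t. It
  -- starts after both `Z` and the coefficient are known, hence has mean zero against them.
  · have h := hw.integral_mul_increment (s := max a s) (u := min (max b s) t)
      (ξ := fun ω => Z ω * V.coeff k ω)
      (le_min (max_le_max htk le_rfl) (max_le hat hst))
      ((hZ.mono ((augmentedFiltration P w).mono (le_max_right _ _)) le_rfl).mul
        ((V.coeff_measurable k).mono ((augmentedFiltration P w).mono (le_max_left _ _)) le_rfl)) l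
    rw [← h]
    refine integral_congr_ae (Eventually.of_forall fun ω => ?_)
    simp only
    rcases le_total s a with hsa | has
    · rw [max_eq_left hsa, max_eq_left (hsa.trans htk), min_eq_left hat, min_eq_right hsa,
        min_eq_right (hsa.trans htk)]
      ring
    · rw [max_eq_right has, min_eq_left hat, min_eq_left has]
      rcases le_total s b with hsb | hbs
      · rw [max_eq_left hsb, min_eq_right hsb]
        ring
      · rw [max_eq_right hbs, min_eq_left hbs, min_eq_left hst, min_eq_left (hbs.trans hst)]
        ring

/-- The Itô isometry, in polarized form, for elementary integrands. -/
lemma integral_integral_mul_integral (hw : IsStandardBrownianMotion P w)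
    (V W : ElementaryProcess P (augmentedFiltration P w)) (l l' : Fin r) (t : ℝ≥0) :
    ∫ ω, V.integral (w l) t ω * W.integral (w l') t ω ∂P =
      if l = l' then ∫ z, spaceTime V.eval z * spaceTime W.eval z ∂(timeProd P t) else 0 := by
  have hL : ∫ ω, V.integral (w l) t ω * W.integral (w l') t ω ∂P =
      ∑ k ∈ Finset.range V.N, ∑ j ∈ Finset.range W.N,
        if l = l' then (∫ ω, V.coeff k ω * W.coeff j ω ∂P) *
          ((min (min (V.time (k + 1)) t) (min (W.time (j + 1)) t) -
            max (min (V.time k) t) (min (W.time j) t) : ℝ≥0) : ℝ) else 0 := by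
    simp only [integral, Finset.sum_mul_sum]
    have hi : ∀ k j, Integrable (fun ω => (V.coeff k ω *
      (w l (min (V.time (k + 1)) t) ω - w l (min (V.time k) t) ω)) * (W.coeff j ω *
      (w l' (min (W.time (j + 1)) t) ω - w l' (min (W.time j) t) ω))) P := fun k j =>
      (V.memLp_term hw l t k).integrable_fun_mul (W.memLp_term hw l' t j)
    rw [integral_finsetSum _ fun k _ => integrable_finsetSum _ fun j _ => hi k j]
    refine Finset.sum_congr rfl fun k _ => ?_
    rw [integral_finsetSum _ fun j _ => hi k j]
    refine Finset.sum_congr rfl fun j _ => ?_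
    -- A coefficient of a cell starting after t need not be known at the stopped starting time, but
    -- the stopped increment is then zero, and so is the overlap.
    rcases le_total t (V.time k) with h1 | h1
    · have h2 := h1.trans (V.time_mono k.le_succ)
      rw [min_eq_right h1, min_eq_right h2,
        tsub_eq_zero_of_le ((min_le_left _ _).trans (le_max_left _ _))]
      simp
    rcases le_total t (W.time j) with h2 | h2
    · have h3 := h2.trans (W.time_mono j.le_succ)
      rw [min_eq_right h2, min_eq_right h3,
        tsub_eq_zero_of_le ((min_le_right _ _).trans (le_max_right _ _))]
      simp
    rw [min_eq_left h1, min_eq_left h2]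
    exact hw.integral_pair (le_min (V.time_mono k.le_succ) h1) (le_min (W.time_mono j.le_succ) h2)
      (V.coeff_measurable k) (V.coeff_memLp k) (W.coeff_measurable j) (W.coeff_memLp j) l l'
  rw [hL]
  split_ifs with h
  swap
  · simp
  simp only [spaceTime_eval, Finset.sum_mul_sum]
  have hm : ∀ (U : ElementaryProcess P (augmentedFiltration P w)) k,
      MemLp (fun z : Ω × ℝ => U.coeff k z.1 *
        (Set.Ioc (U.time k : ℝ) (U.time (k + 1))).indicator (fun _ => (1 : ℝ)) z.2) 2
        (timeProd P t) := fun U k => (U.coeff_memLp k).mul_prod_two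
    (g := (Set.Ioc (U.time k : ℝ) (U.time (k + 1))).indicator (fun _ => (1 : ℝ)))
    ((memLp_const 1).indicator measurableSet_Ioc)
  rw [integral_finsetSum _ fun k _ => integrable_finsetSum _ fun j _ =>
    (hm V k).integrable_fun_mul (hm W j)]
  refine Finset.sum_congr rfl fun k _ => ?_
  rw [integral_finsetSum _ fun j _ => (hm V k).integrable_fun_mul (hm W j)]
  refine Finset.sum_congr rfl fun j _ => ?_
  rw [← setIntegral_indicator_mul_indicator, timeProd, ← integral_prod_mul]
  refine integral_congr_ae (Eventually.of_forall fun z => ?_)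
  simp only
  ring

end ElementaryProcess

end Elementary

/-! ### Norms and inner products in L². -/

section LTwo

variable {α : Type*} [MeasurableSpace α] {μ : Measure α}

lemma eLpNorm_two_sq (f : α → ℝ) : eLpNorm f 2 μ ^ 2 = ∫⁻ x, ‖f x‖ₑ ^ 2 ∂μ := by
  have := eLpNorm_nnreal_pow_eq_lintegral (μ := μ) (f := f) (p := 2) (by norm_num)
  rw [show ((2 : ℝ≥0) : ℝ≥0∞) = 2 by norm_num] at this
  simp only [NNReal.coe_ofNat, ENNReal.rpow_ofNat] at this
  exact this

lemma tendsto_eLpNorm_two_iff {ι : Type*} {F : Filter ι} {f : ι → α → ℝ} :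
    Tendsto (fun k => eLpNorm (f k) 2 μ) F (𝓝 0) ↔
      Tendsto (fun k => ∫⁻ x, ‖f k x‖ₑ ^ 2 ∂μ) F (𝓝 0) := by
  simp_rw [← eLpNorm_two_sq]
  constructor
  · intro h
    have := h.ennrpow_const 2
    simpa using this
  · intro h
    have := h.ennrpow_const (1 / 2)
    simp only [← ENNReal.rpow_natCast, ← ENNReal.rpow_mul] at this
    simpa using this

lemma inner_toLp_two {f g : α → ℝ} (hf : MemLp f 2 μ) (hg : MemLp g 2 μ) :
    inner ℝ (hf.toLp f) (hg.toLp g) = ∫ x, f x * g x ∂μ := by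
  rw [L2.inner_def]
  refine integral_congr_ae ?_
  filter_upwards [hf.coeFn_toLp, hg.coeFn_toLp] with x h1 h2
  rw [h1, h2]
  simp [mul_comm]

lemma norm_toLp_two_sq {f : α → ℝ} (hf : MemLp f 2 μ) :
    ‖hf.toLp f‖ ^ 2 = ∫ x, f x * f x ∂μ := by
  rw [← inner_toLp_two hf hf, real_inner_self_eq_norm_sq]

/-- Continuity of the inner product of L². It carries the bilinear identities from elementary
integrals to Itô integrals. -/
lemma tendsto_integral_mul_of_tendsto_eLpNorm {ι : Type*} {F : Filter ι} {f g : ι → α → ℝ}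
    {f' g' : α → ℝ}
    (hf : ∀ k, MemLp (f k) 2 μ) (hg : ∀ k, MemLp (g k) 2 μ) (hf' : MemLp f' 2 μ)
    (hg' : MemLp g' 2 μ) (h1 : Tendsto (fun k => eLpNorm (f k - f') 2 μ) F (𝓝 0))
    (h2 : Tendsto (fun k => eLpNorm (g k - g') 2 μ) F (𝓝 0)) :
    Tendsto (fun k => ∫ x, f k x * g k x ∂μ) F (𝓝 (∫ x, f' x * g' x ∂μ)) := by
  have h1' := (Lp.tendsto_Lp_iff_tendsto_eLpNorm'' f hf f' hf').2 h1
  have h2' := (Lp.tendsto_Lp_iff_tendsto_eLpNorm'' g hg g' hg').2 h2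
  have := h1'.inner (𝕜 := ℝ) h2'
  simpa only [inner_toLp_two] using this

lemma tendsto_eLpNorm_of_tendsto_integral_sq {ι : Type*} {F : Filter ι} {f : ι → α → ℝ}
    (hf : ∀ k, MemLp (f k) 2 μ) (h : Tendsto (fun k => ∫ x, f k x * f k x ∂μ) F (𝓝 0)) :
    Tendsto (fun k => eLpNorm (f k) 2 μ) F (𝓝 0) := by
  rw [tendsto_eLpNorm_two_iff]
  have h3 := (ENNReal.continuous_ofReal.tendsto _).comp h
  rw [ENNReal.ofReal_zero] at h3
  refine h3.congr fun k => ?_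
  simp only [Function.comp]
  rw [ofReal_integral_eq_lintegral_ofReal ((hf k).integrable_fun_mul (hf k))
    (Eventually.of_forall fun x => mul_self_nonneg _)]
  refine lintegral_congr fun x => ?_
  rw [← pow_two, ← ofReal_norm, ← ENNReal.ofReal_pow (norm_nonneg _), Real.norm_eq_abs,
    sq_abs]

end LTwo

/-! ### Isometry and martingale property of the Itô integral. -/

section Ito

variable {Ω : Type*} [mΩ : MeasurableSpace Ω] {P : Measure Ω} {r : ℕ} {w : Fin r → ℝ≥0 → Ω → ℝ}

lemma timeProd_mono [IsProbabilityMeasure P] {s t : ℝ≥0} (hst : s ≤ t) :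
    timeProd P s ≤ timeProd P t := by
  have : timeProd P s = (timeProd P t).restrict (Set.univ ×ˢ Set.Ioc (0 : ℝ) s) := by
    rw [timeProd, timeProd, ← Measure.prod_restrict, Measure.restrict_univ,
      Measure.restrict_restrict measurableSet_Ioc, Set.Ioc_inter_Ioc, max_self,
      min_eq_left (NNReal.coe_le_coe.2 hst)]
  rw [this]
  exact Measure.restrict_le_self

lemma lintegral_timeProd [IsProbabilityMeasure P] {t : ℝ≥0} {f : Ω × ℝ → ℝ≥0∞}
    (hf : AEMeasurable f (timeProd P t)) :
    ∫⁻ z, f z ∂(timeProd P t) = ∫⁻ ω, (∫⁻ s in Set.Ioc (0 : ℝ) t, f (ω, s)) ∂P :=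
  lintegral_prod f hf

variable [IsProbabilityMeasure P] [P.IsComplete] {l l' : Fin r} {φ ψ : ℝ≥0 → Ω → ℝ} {t s : ℝ≥0}
  {I J : Ω → ℝ}

omit [P.IsComplete] in
/-- An approximating sequence of elementary processes, in terms of `eLpNorm`. -/
lemma IsItoIntegral.exists_seq (h : IsItoIntegral P (augmentedFiltration P w) (w l) φ t I)
    (hφ : AEMeasurable (spaceTime φ) (timeProd P t)) :
    ∃ V : ℕ → ElementaryProcess P (augmentedFiltration P w),
      Tendsto (fun k => eLpNorm (spaceTime (V k).eval - spaceTime φ) 2 (timeProd P t)) atTop (𝓝 0) ∧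
      Tendsto (fun k => eLpNorm ((V k).integral (w l) t - I) 2 P) atTop (𝓝 0) := by
  obtain ⟨-, V, h1, h2⟩ := h
  refine ⟨V, ?_, ?_⟩
  · rw [tendsto_eLpNorm_two_iff]
    refine h1.congr fun k => ?_
    rw [lintegral_timeProd]
    · rfl
    · exact (((V k).measurable_spaceTime_eval.aemeasurable.sub hφ).enorm).pow_const 2
  · rw [tendsto_eLpNorm_two_iff]
    exact h2

lemma IsItoIntegral.memLp (hw : IsStandardBrownianMotion P w)
    (h : IsItoIntegral P (augmentedFiltration P w) (w l) φ t I) : MemLp I 2 P := by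
  obtain ⟨hI, V, h1, h2⟩ := h
  have h3 : Tendsto (fun k => eLpNorm ((V k).integral (w l) t - I) 2 P) atTop (𝓝 0) := by
    rw [tendsto_eLpNorm_two_iff]
    exact h2
  exact Lp.memLp_of_cauchy_tendsto (by norm_num) (fun k => (V k).memLp_integral hw l t) I
    hI.aestronglyMeasurable h3

omit [P.IsComplete] in
lemma memLp_of_tendsto_spaceTime {V : ℕ → ElementaryProcess P (augmentedFiltration P w)}
    (hφ : AEMeasurable (spaceTime φ) (timeProd P t))
    (h : Tendsto (fun k => eLpNorm (spaceTime (V k).eval - spaceTime φ) 2 (timeProd P t))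
      atTop (𝓝 0)) : MemLp (spaceTime φ) 2 (timeProd P t) :=
  Lp.memLp_of_cauchy_tendsto (by norm_num) (fun k => (V k).memLp_spaceTime_eval t) _
    hφ.aestronglyMeasurable h

/-- The polarized Itô isometry. -/
lemma IsItoIntegral.integral_mul (hw : IsStandardBrownianMotion P w)
    (h : IsItoIntegral P (augmentedFiltration P w) (w l) φ t I)
    (h' : IsItoIntegral P (augmentedFiltration P w) (w l') ψ t J)
    (hφ : AEMeasurable (spaceTime φ) (timeProd P t))
    (hψ : AEMeasurable (spaceTime ψ) (timeProd P t)) :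
    ∫ ω, I ω * J ω ∂P =
      if l = l' then ∫ z, spaceTime φ z * spaceTime ψ z ∂(timeProd P t) else 0 := by
  have hI := h.memLp hw
  have hJ := h'.memLp hw
  obtain ⟨V, hV, hVI⟩ := h.exists_seq hφ
  obtain ⟨W, hW, hWJ⟩ := h'.exists_seq hψ
  have h1 := tendsto_integral_mul_of_tendsto_eLpNorm (fun k => (V k).memLp_integral hw l t)
    (fun k => (W k).memLp_integral hw l' t) hI hJ hVI hWJ
  have h2 := tendsto_integral_mul_of_tendsto_eLpNorm (fun k => (V k).memLp_spaceTime_eval t)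
    (fun k => (W k).memLp_spaceTime_eval t) (memLp_of_tendsto_spaceTime hφ hV)
    (memLp_of_tendsto_spaceTime hψ hW) hV hW
  refine tendsto_nhds_unique h1 ?_
  simp_rw [ElementaryProcess.integral_integral_mul_integral hw]
  split_ifs
  · exact h2
  · exact tendsto_const_nhds

/-- The elementary integrals up to an earlier time converge to the Itô integral at that time. -/
lemma IsItoIntegral.tendsto_of_le (hw : IsStandardBrownianMotion P w) (hst : s ≤ t)
    (hJ : IsItoIntegral P (augmentedFiltration P w) (w l) φ s J)
    (hφ : AEMeasurable (spaceTime φ) (timeProd P t))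
    {V : ℕ → ElementaryProcess P (augmentedFiltration P w)}
    (hV : Tendsto (fun k => eLpNorm (spaceTime (V k).eval - spaceTime φ) 2 (timeProd P t))
      atTop (𝓝 0)) :
    Tendsto (fun k => eLpNorm ((V k).integral (w l) s - J) 2 P) atTop (𝓝 0) := by
  have hφs : AEMeasurable (spaceTime φ) (timeProd P s) := hφ.mono_measure (timeProd_mono hst)
  obtain ⟨W, hW, hWJ⟩ := hJ.exists_seq hφs
  have hVs : Tendsto (fun k => eLpNorm (spaceTime (V k).eval - spaceTime φ) 2 (timeProd P s))
      atTop (𝓝 0) :=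
    tendsto_of_tendsto_of_tendsto_of_le_of_le tendsto_const_nhds hV (fun _ => zero_le)
      (fun k => eLpNorm_mono_measure _ (timeProd_mono hst))
  have hφm := memLp_of_tendsto_spaceTime hφs hVs
  have hVm := fun k => (V k).memLp_spaceTime_eval s
  have hWm := fun k => (W k).memLp_spaceTime_eval s
  -- The sequence W defining J need not be V. By the isometry, the squared distance of their
  -- integrals at s is the squared space-time distance of the integrands; its three inner products
  -- all tend to ‖φ‖², and 1 - 2 + 1 = 0.
  have e1 := tendsto_integral_mul_of_tendsto_eLpNorm hVm hVm hφm hφm hVs hVs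
  have e2 := tendsto_integral_mul_of_tendsto_eLpNorm hVm hWm hφm hφm hVs hW
  have e3 := tendsto_integral_mul_of_tendsto_eLpNorm hWm hWm hφm hφm hW hW
  have hVi := fun k => (V k).memLp_integral hw l s
  have hWi := fun k => (W k).memLp_integral hw l s
  have h1 : Tendsto (fun k => eLpNorm ((V k).integral (w l) s - (W k).integral (w l) s) 2 P)
      atTop (𝓝 0) := by
    refine tendsto_eLpNorm_of_tendsto_integral_sq (fun k => (hVi k).sub (hWi k)) ?_
    have := (e1.sub (e2.const_mul 2)).add e3
    convert this using 1
    · funext k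
      have hi : ∀ U U' : ElementaryProcess P (augmentedFiltration P w),
          ∫ z, spaceTime U.eval z * spaceTime U'.eval z ∂(timeProd P s) =
            ∫ ω, U.integral (w l) s ω * U'.integral (w l) s ω ∂P := fun U U' => by
        rw [ElementaryProcess.integral_integral_mul_integral hw, if_pos rfl]
      rw [hi, hi, hi, ← integral_const_mul, ← integral_sub, ← integral_add]
      · refine integral_congr_ae (Eventually.of_forall fun ω => ?_)
        simp only [Pi.sub_apply]
        ring
      · exact ((hVi k).integrable_fun_mul (hVi k)).sub
          (((hVi k).integrable_fun_mul (hWi k)).const_mul 2)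
      · exact (hWi k).integrable_fun_mul (hWi k)
      · exact (hVi k).integrable_fun_mul (hVi k)
      · exact ((hVi k).integrable_fun_mul (hWi k)).const_mul 2
    · congr 1; ring
  have h2 := h1.add hWJ
  rw [add_zero] at h2
  refine tendsto_of_tendsto_of_tendsto_of_le_of_le tendsto_const_nhds h2 (fun _ => zero_le)
    fun k => ?_
  have : (V k).integral (w l) s - J =
      ((V k).integral (w l) s - (W k).integral (w l) s) + ((W k).integral (w l) s - J) := by
    abel
  rw [this]
  exact eLpNorm_add_le ((hVi k).sub (hWi k)).1 ((hWi k).sub (hJ.memLp hw)).1 (by norm_num)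

/-- The martingale property of the Itô integral. -/
lemma IsItoIntegral.integral_mul_of_le (hw : IsStandardBrownianMotion P w) (hst : s ≤ t)
    (hI : IsItoIntegral P (augmentedFiltration P w) (w l) φ t I)
    (hJ : IsItoIntegral P (augmentedFiltration P w) (w l) φ s J)
    (hφ : AEMeasurable (spaceTime φ) (timeProd P t))
    {Z : Ω → ℝ} (hZ : Measurable[augmentedFiltration P w s] Z) (hZi : MemLp Z 2 P) :
    ∫ ω, Z ω * I ω ∂P = ∫ ω, Z ω * J ω ∂P := by
  obtain ⟨V, hV, hVI⟩ := hI.exists_seq hφ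
  have hVJ := hJ.tendsto_of_le hw hst hφ hV
  have hc : Tendsto (fun _ : ℕ => eLpNorm (Z - Z) 2 P) atTop (𝓝 0) := by simp
  have h1 := tendsto_integral_mul_of_tendsto_eLpNorm (fun _ => hZi)
    (fun k => (V k).memLp_integral hw l t) hZi (hI.memLp hw) hc hVI
  have h2 := tendsto_integral_mul_of_tendsto_eLpNorm (fun _ => hZi)
    (fun k => (V k).memLp_integral hw l s) hZi (hJ.memLp hw) hc hVJ
  refine tendsto_nhds_unique h1 (h2.congr fun k => ?_)
  rw [(V k).integral_mul_integral_of_le hw l hst hZ hZi]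

lemma IsItoIntegral.integral_eq_zero (hw : IsStandardBrownianMotion P w)
    (hI : IsItoIntegral P (augmentedFiltration P w) (w l) φ t I)
    (hφ : AEMeasurable (spaceTime φ) (timeProd P t)) : ∫ ω, I ω ∂P = 0 := by
  obtain ⟨V, hV, hVI⟩ := hI.exists_seq hφ
  have hc : Tendsto (fun _ : ℕ => eLpNorm ((fun _ : Ω => (1 : ℝ)) - fun _ => 1) 2 P) atTop (𝓝 0) := by
    simp
  have h1 := tendsto_integral_mul_of_tendsto_eLpNorm (fun _ => memLp_const (1 : ℝ))
    (fun k => (V k).memLp_integral hw l t) (memLp_const (1 : ℝ)) (hI.memLp hw) hc hVI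
  have h2 : ∀ k, ∫ ω, (1 : ℝ) * (V k).integral (w l) t ω ∂P = 0 := fun k => by
    -- The martingale property moves the expectation back to time 0, where every stopped increment
    -- vanishes.
    rw [(V k).integral_mul_integral_of_le hw l (zero_le (a := t)) (Z := fun _ => (1 : ℝ))
      (@measurable_const _ _ _ _ _) (memLp_const (1 : ℝ))]
    simp [ElementaryProcess.integral]
  simp only [h2] at h1
  simp only [one_mul] at h1
  exact (tendsto_nhds_unique h1 tendsto_const_nhds)

/-- Itô integrals at different times have the covariance of the earlier time. -/
lemma IsItoIntegral.integral_mul_of_le' (hw : IsStandardBrownianMotion P w) (hst : s ≤ t)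
    (hI : IsItoIntegral P (augmentedFiltration P w) (w l) φ t I)
    {I' : Ω → ℝ} (hI' : IsItoIntegral P (augmentedFiltration P w) (w l) φ s I')
    (hJ : IsItoIntegral P (augmentedFiltration P w) (w l') ψ s J)
    (hφ : AEMeasurable (spaceTime φ) (timeProd P t))
    (hψ : AEMeasurable (spaceTime ψ) (timeProd P s)) :
    ∫ ω, J ω * I ω ∂P = ∫ ω, J ω * I' ω ∂P := by
  -- `J` is only determined up to a null set and need not itself be measurable at time s. Its
  -- elementary approximations are, so the martingale property is applied to them.
  obtain ⟨W, hW, hWJ⟩ := hJ.exists_seq hψ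
  have hc : ∀ Z : Ω → ℝ, Tendsto (fun _ : ℕ => eLpNorm (Z - Z) 2 P) atTop (𝓝 0) := by simp
  have hWi := fun k => (W k).memLp_integral hw l' s
  have h1 := tendsto_integral_mul_of_tendsto_eLpNorm hWi
    (fun _ => hI.memLp hw) (hJ.memLp hw) (hI.memLp hw) hWJ (hc I)
  have h2 := tendsto_integral_mul_of_tendsto_eLpNorm hWi
    (fun _ => hI'.memLp hw) (hJ.memLp hw) (hI'.memLp hw) hWJ (hc I')
  refine tendsto_nhds_unique h1 (h2.congr fun k => ?_)
  rw [hI.integral_mul_of_le hw hst hI' hφ ((W k).measurable_integral hw l' s) (hWi k)]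

end Ito

/-! ### Time integrals of square integrable processes. -/

section TimeIntegral

variable {α β : Type*} [MeasurableSpace α] [MeasurableSpace β] {μ : Measure α} {ν : Measure β}

/-- Cauchy–Schwarz against the constant 1. -/
lemma sq_integral_le_measure_mul_integral_sq [IsFiniteMeasure ν] {g : β → ℝ} (hg : MemLp g 2 ν) :
    (∫ x, g x ∂ν) * (∫ x, g x ∂ν) ≤ ν.real Set.univ * ∫ x, g x * g x ∂ν := by
  have h := real_inner_mul_inner_self_le ((memLp_const (1 : ℝ)).toLp (fun _ : β => (1 : ℝ)) :
    Lp ℝ 2 ν) (hg.toLp g)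
  simp only [inner_toLp_two] at h
  simpa using h

lemma ae_memLp_slice [SFinite ν] [SFinite μ] {Φ : α × β → ℝ} (hΦ : MemLp Φ 2 (μ.prod ν)) :
    ∀ᵐ x ∂μ, MemLp (fun y => Φ (x, y)) 2 ν := by
  filter_upwards [hΦ.1.prodMk_left, hΦ.integrable_sq.prod_right_ae] with x h1 h2
  exact (memLp_two_iff_integrable_sq h1).2 h2

lemma ae_sq_integral_slice_le [SFinite μ] [IsFiniteMeasure ν] {Φ : α × β → ℝ}
    (hΦ : MemLp Φ 2 (μ.prod ν)) :
    ∀ᵐ x ∂μ, (∫ y, Φ (x, y) ∂ν) * (∫ y, Φ (x, y) ∂ν) ≤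
      ν.real Set.univ * ∫ y, Φ (x, y) * Φ (x, y) ∂ν := by
  filter_upwards [ae_memLp_slice hΦ] with x hx using sq_integral_le_measure_mul_integral_sq hx

lemma memLp_integral_slice [SFinite μ] [IsFiniteMeasure ν] {Φ : α × β → ℝ}
    (hΦ : MemLp Φ 2 (μ.prod ν)) : MemLp (fun x => ∫ y, Φ (x, y) ∂ν) 2 μ := by
  have hm := hΦ.1.integral_prod_right'
  refine (memLp_two_iff_integrable_sq hm).2 ?_
  refine ((hΦ.integrable_fun_mul hΦ).integral_prod_left.const_mul (ν.real Set.univ)).mono'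
    (hm.pow 2) ?_
  filter_upwards [ae_sq_integral_slice_le hΦ] with x hx
  rw [Real.norm_eq_abs, abs_of_nonneg (sq_nonneg _), pow_two]
  exact hx

lemma integral_sq_integral_slice_le [SFinite μ] [IsFiniteMeasure ν] {Φ : α × β → ℝ}
    (hΦ : MemLp Φ 2 (μ.prod ν)) :
    ∫ x, (∫ y, Φ (x, y) ∂ν) * (∫ y, Φ (x, y) ∂ν) ∂μ ≤
      ν.real Set.univ * ∫ z, Φ z * Φ z ∂(μ.prod ν) := by
  rw [integral_prod _ (hΦ.integrable_fun_mul hΦ), ← integral_const_mul]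
  exact integral_mono_ae ((memLp_integral_slice hΦ).integrable_fun_mul (memLp_integral_slice hΦ))
    ((hΦ.integrable_fun_mul hΦ).integral_prod_left.const_mul (ν.real Set.univ))
    (ae_sq_integral_slice_le hΦ)

lemma integral_mul_integral_slice [IsFiniteMeasure μ] [IsFiniteMeasure ν] {Φ : α × β → ℝ}
    (hΦ : MemLp Φ 2 (μ.prod ν)) {Z : α → ℝ} (hZ : MemLp Z 2 μ) :
    ∫ x, Z x * (∫ y, Φ (x, y) ∂ν) ∂μ = ∫ y, (∫ x, Z x * Φ (x, y) ∂μ) ∂ν := by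
  simp_rw [← integral_const_mul]
  refine integral_integral_swap (f := fun x y => Z x * Φ (x, y)) ?_
  have h1 := hZ.mul_prod_two (memLp_const (μ := ν) (1 : ℝ))
  simp only [mul_one] at h1
  exact h1.integrable_fun_mul hΦ

end TimeIntegral

/-! ### Product rule for curves in a Hilbert space. -/

section Hilbert

variable {H : Type*} [NormedAddCommGroup H] [InnerProductSpace ℝ H]

omit [InnerProductSpace ℝ H] in
lemma continuous_of_sq_norm_sub_le {T : Type*} [TopologicalSpace T] {u : T → H} {B : T → T → ℝ}
    (h : ∀ s t, ‖u t - u s‖ ^ 2 ≤ B s t) (hB : ∀ s, Tendsto (B s) (𝓝 s) (𝓝 0)) :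
    Continuous u := by
  refine continuous_iff_continuousAt.2 fun s => ?_
  refine tendsto_iff_norm_sub_tendsto_zero.2 ?_
  have h1 : Tendsto (fun t => ‖u t - u s‖ ^ 2) (𝓝 s) (𝓝 0) :=
    squeeze_zero (fun _ => by positivity) (fun t => h s t) (hB s)
  have h2 := (Real.continuous_sqrt.tendsto _).comp h1
  rw [Real.sqrt_zero] at h2
  exact h2.congr fun t => Real.sqrt_sq (norm_nonneg _)

/-- The product rule for the inner product of two curves that are sums of a differentiable curve
and a curve with martingale-like orthogonality. -/
lemma inner_eq_add_integral_of_orthogonal [CompleteSpace H] {ξ₁ ξ₂ F₁ F₂ M₁ M₂ : ℝ → H} {e₁ e₂ : H}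
    {q : ℝ → ℝ} (hF₁ : Continuous F₁) (hF₂ : Continuous F₂) (hξ₁c : Continuous ξ₁)
    (hξ₂c : Continuous ξ₂) (hq : Continuous q)
    (hξ₁ : ∀ t, 0 ≤ t → ξ₁ t = e₁ + (∫ s in (0 : ℝ)..t, F₁ s) + M₁ t)
    (hξ₂ : ∀ t, 0 ≤ t → ξ₂ t = e₂ + (∫ s in (0 : ℝ)..t, F₂ s) + M₂ t)
    (h₁₂ : ∀ s t, 0 ≤ s → s ≤ t → inner ℝ (F₁ s) (M₂ t) = inner ℝ (F₁ s) (M₂ s))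
    (h₂₁ : ∀ s t, 0 ≤ s → s ≤ t → inner ℝ (F₂ s) (M₁ t) = inner ℝ (F₂ s) (M₁ s))
    (he₁ : ∀ t, 0 ≤ t → inner ℝ e₁ (M₂ t) = 0) (he₂ : ∀ t, 0 ≤ t → inner ℝ e₂ (M₁ t) = 0)
    (hM : ∀ t, 0 ≤ t → inner ℝ (M₁ t) (M₂ t) = ∫ s in (0 : ℝ)..t, q s) {t : ℝ} (ht : 0 ≤ t) :
    inner ℝ (ξ₁ t) (ξ₂ t) = inner ℝ e₁ e₂ +
      ∫ s in (0 : ℝ)..t, (inner ℝ (F₁ s) (ξ₂ s) + inner ℝ (ξ₁ s) (F₂ s) + q s) := by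
  set u₁ : ℝ → H := fun t => e₁ + ∫ s in (0 : ℝ)..t, F₁ s with hu₁
  set u₂ : ℝ → H := fun t => e₂ + ∫ s in (0 : ℝ)..t, F₂ s with hu₂
  have hd₁ : ∀ t, HasDerivAt u₁ (F₁ t) t := fun t => (hF₁.integral_hasStrictDerivAt 0 t).hasDerivAt.const_add _
  have hd₂ : ∀ t, HasDerivAt u₂ (F₂ t) t := fun t => (hF₂.integral_hasStrictDerivAt 0 t).hasDerivAt.const_add _
  have hc₁ : Continuous u₁ := continuous_iff_continuousAt.2 fun t => (hd₁ t).continuousAt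
  have hc₂ : Continuous u₂ := continuous_iff_continuousAt.2 fun t => (hd₂ t).continuousAt
  have huu : inner ℝ (u₁ t) (u₂ t) = inner ℝ e₁ e₂ +
      ∫ s in (0 : ℝ)..t, (inner ℝ (u₁ s) (F₂ s) + inner ℝ (F₁ s) (u₂ s)) := by
    have := intervalIntegral.integral_eq_sub_of_hasDerivAt (a := 0) (b := t)
      (f := fun t => inner ℝ (u₁ t) (u₂ t))
      (f' := fun s => inner ℝ (u₁ s) (F₂ s) + inner ℝ (F₁ s) (u₂ s))
      (fun s _ => (hd₁ s).inner ℝ (hd₂ s))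
      (by exact Continuous.intervalIntegrable (by fun_prop) _ _)
    rw [this]
    simp [hu₁, hu₂]
  -- The pairing of the differentiable part with M(t) is ∫ ⟨F(s), M(t)⟩ ds. Orthogonality replaces
  -- M(t) by M(s), which the equation for ξ expresses as ξ(s) minus its differentiable part.
  have key : ∀ {F G ξ M : ℝ → H} {e e' : H}, Continuous F →
      (∀ t, 0 ≤ t → ξ t = e' + (∫ s in (0 : ℝ)..t, G s) + M t) →
      (∀ s t, 0 ≤ s → s ≤ t → inner ℝ (F s) (M t) = inner ℝ (F s) (M s)) →
      (∀ t, 0 ≤ t → inner ℝ e (M t) = 0) →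
      inner ℝ (e + ∫ s in (0 : ℝ)..t, F s) (M t) =
        ∫ s in (0 : ℝ)..t, inner ℝ (F s) (ξ s - (e' + ∫ s in (0 : ℝ)..s, G s)) := by
    intro F G ξ M e e' hF hξ h he
    have hi := integral_inner (𝕜 := ℝ) ((hF.intervalIntegrable (μ := volume) 0 t).1) (M t)
    rw [inner_add_left, he t ht, zero_add, real_inner_comm, intervalIntegral.integral_of_le ht,
      ← hi, intervalIntegral.integral_of_le ht]
    refine setIntegral_congr_fun measurableSet_Ioc fun s hs => ?_
    rw [real_inner_comm, h s t hs.1.le hs.2, hξ s hs.1.le, add_sub_cancel_left]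
  have k₁ := key hF₁ hξ₂ h₁₂ he₁
  have k₂ := key hF₂ hξ₁ h₂₁ he₂
  -- The smooth pairing differentiates by the ordinary product rule, the mixed pairings correct u to
  -- ξ in its integrand, and the martingale pairing contributes q, the density of the bracket.
  have e : inner ℝ (ξ₁ t) (ξ₂ t) = inner ℝ (u₁ t) (u₂ t) + inner ℝ (u₁ t) (M₂ t) +
      inner ℝ (u₂ t) (M₁ t) + inner ℝ (M₁ t) (M₂ t) := by
    rw [hξ₁ t ht, hξ₂ t ht]
    simp only [hu₁, hu₂, inner_add_left, inner_add_right]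
    rw [real_inner_comm (M₁ t) e₂, real_inner_comm (M₁ t) (∫ s in (0 : ℝ)..t, F₂ s)]
    ring
  rw [e, huu, hM t ht]
  change _ + inner ℝ (e₁ + ∫ s in (0 : ℝ)..t, F₁ s) (M₂ t) +
    inner ℝ (e₂ + ∫ s in (0 : ℝ)..t, F₂ s) (M₁ t) + _ = _
  rw [k₁, k₂]
  change _ + (∫ s in (0 : ℝ)..t, inner ℝ (F₁ s) (ξ₂ s - u₂ s)) +
    (∫ s in (0 : ℝ)..t, inner ℝ (F₂ s) (ξ₁ s - u₁ s)) + _ = _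
  rw [add_assoc, add_assoc, add_assoc]
  congr 1
  rw [← intervalIntegral.integral_add, ← intervalIntegral.integral_add,
    ← intervalIntegral.integral_add]
  · refine intervalIntegral.integral_congr fun s _ => ?_
    simp only [inner_sub_right]
    rw [real_inner_comm (ξ₁ s) (F₂ s), real_inner_comm (u₁ s) (F₂ s)]
    ring
  all_goals exact Continuous.intervalIntegrable (by fun_prop) _ _

end Hilbert

/-! ### Square integrability of solutions. -/

section SecondMoment

variable {Ω : Type*} [mΩ : MeasurableSpace Ω] {P : Measure Ω} {r n : ℕ} {w : Fin r → ℝ≥0 → Ω → ℝ}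
  {A : Matrix (Fin n) (Fin n) ℝ} {C : Fin r → Matrix (Fin n) (Fin n) ℝ} {x : Fin n → ℝ}
  {X : ℝ≥0 → Ω → Fin n → ℝ}

lemma IsSDESolution.measurable_apply (hX : IsSDESolution P w A C x X) (t : ℝ≥0) (i : Fin n) :
    Measurable[augmentedFiltration P w t] fun ω => X t ω i :=
  (measurable_pi_apply i).comp (hX.progressive.adapted t)

lemma IsSDESolution.measurable_mulVec (hX : IsSDESolution P w A C x X)
    (B : Matrix (Fin n) (Fin n) ℝ) (t : ℝ≥0) (i : Fin n) :
    Measurable[augmentedFiltration P w t] fun ω => (B *ᵥ X t ω) i := by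
  simp only [Matrix.mulVec, dotProduct]
  exact Finset.measurable_sum _ fun j _ => (hX.measurable_apply t j).const_mul _

variable [IsProbabilityMeasure P]

/-- Clamping the time variable at t turns the progressive process, measurable on [0, t] × Ω, into a
function measurable on all of Ω × ℝ. The two agree almost everywhere because `timeProd P t` is
carried by (0, t]. -/
lemma aemeasurable_spaceTime_of_isProgressive {β : Type*} [MeasurableSpace β]
    {ℱ : Filtration ℝ≥0 mΩ} {φ : ℝ≥0 → Ω → β} (hφ : IsProgressive ℱ φ) (t : ℝ≥0) :
    AEMeasurable (spaceTime φ) (timeProd P t) := by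
  have h1 : Measurable fun p : Set.Iic t × Ω => φ p.1 p.2 := by
    refine (hφ t).mono ?_ le_rfl
    exact sup_le_sup le_rfl (MeasurableSpace.comap_mono (ℱ.le t))
  have h2 : Measurable fun z : Ω × ℝ =>
      ((⟨min z.2.toNNReal t, min_le_right z.2.toNNReal t⟩ : Set.Iic t), z.1) :=
    ((measurable_snd.real_toNNReal.min measurable_const).subtype_mk).prodMk measurable_fst
  refine ⟨_, h1.comp h2, ?_⟩
  have h3 : ∀ᵐ z ∂(timeProd P t), z ∈ Set.univ ×ˢ Set.Ioc (0 : ℝ) t := by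
    have e : timeProd P t = (P.prod volume).restrict (Set.univ ×ˢ Set.Ioc (0 : ℝ) t) := by
      rw [timeProd, ← Measure.prod_restrict, Measure.restrict_univ]
    rw [e]
    exact ae_restrict_mem (MeasurableSet.univ.prod measurableSet_Ioc)
  filter_upwards [h3] with z hz
  have : z.2.toNNReal ≤ t := Real.toNNReal_le_iff_le_coe.2 hz.2.2
  simp only [Function.comp, spaceTime, min_eq_left this]

lemma IsSDESolution.memLp_spaceTime_apply (hX : IsSDESolution P w A C x X) (t : ℝ≥0) (i : Fin n) :
    MemLp (spaceTime fun s ω => X s ω i) 2 (timeProd P t) := by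
  have hm := aemeasurable_spaceTime_of_isProgressive (P := P) hX.progressive t
  have hmi : AEMeasurable (spaceTime fun s ω => X s ω i) (timeProd P t) :=
    (measurable_pi_apply i).comp_aemeasurable hm
  refine ⟨hmi.aestronglyMeasurable, ?_⟩
  have h1 : eLpNorm (spaceTime fun s ω => X s ω i) 2 (timeProd P t) ^ 2 < ∞ := by
    rw [eLpNorm_two_sq]
    refine lt_of_le_of_lt ?_ (hX.sq_integrable t)
    have h2 := lintegral_timeProd (P := P) (t := t) (f := fun z => ‖spaceTime X z‖ₑ ^ 2)
      (hm.enorm.pow_const 2)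
    refine le_trans ?_ h2.le
    refine lintegral_mono fun z => ?_
    gcongr
    simp only [enorm_le_iff_norm_le]
    exact norm_le_pi_norm (X z.2.toNNReal z.1) i
  by_contra h
  rw [not_lt, top_le_iff] at h
  simp [h] at h1

lemma IsSDESolution.memLp_spaceTime_mulVec (hX : IsSDESolution P w A C x X)
    (B : Matrix (Fin n) (Fin n) ℝ) (t : ℝ≥0) (i : Fin n) :
    MemLp (spaceTime fun s ω => (B *ᵥ X s ω) i) 2 (timeProd P t) := by
  have : (spaceTime fun s ω => (B *ᵥ X s ω) i) =
      fun z => ∑ j, B i j * spaceTime (fun s ω => X s ω j) z := rfl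
  rw [this]
  exact memLp_finsetSum _ fun j _ => (hX.memLp_spaceTime_apply t j).const_mul _

/-- The drift part of the solution. -/
noncomputable def driftPart (B : Matrix (Fin n) (Fin n) ℝ) (X : ℝ≥0 → Ω → Fin n → ℝ) (i : Fin n)
    (t : ℝ≥0) (ω : Ω) : ℝ :=
  ∫ s in Set.Ioc (0 : ℝ) t, spaceTime (fun s ω => (B *ᵥ X s ω) i) (ω, s)

lemma IsSDESolution.memLp_driftPart (hX : IsSDESolution P w A C x X)
    (B : Matrix (Fin n) (Fin n) ℝ) (t : ℝ≥0) (i : Fin n) :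
    MemLp (driftPart B X i t) 2 P :=
  memLp_integral_slice (hX.memLp_spaceTime_mulVec B t i)

omit [IsProbabilityMeasure P] in
/-- The stochastic integrals in the equation. -/
lemma IsSDESolution.exists_martingalePart (hX : IsSDESolution P w A C x X) :
    ∃ I : Fin r → Fin n → ℝ≥0 → Ω → ℝ,
      (∀ l i t, IsItoIntegral P (augmentedFiltration P w) (w l)
        (fun s ω => (C l *ᵥ X s ω) i) t (I l i t)) ∧
      ∀ i t, ∀ᵐ ω ∂P, X t ω i = x i + driftPart A X i t ω + ∑ l, I l i t ω := by
  choose I hI hI' using hX.equation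
  refine ⟨fun l i t => I t l i, fun l i t => hI t l i, fun i t => ?_⟩
  filter_upwards [hI' t] with ω hω
  rw [hω i, driftPart, intervalIntegral.integral_of_le t.coe_nonneg]
  rfl

variable [P.IsComplete]

/-- Square integrability over space-time says nothing about a fixed time. The equation does: it
writes X(t) almost surely as a sum of square integrable terms. -/
lemma IsSDESolution.memLp_apply (hw : IsStandardBrownianMotion P w)
    (hX : IsSDESolution P w A C x X) (t : ℝ≥0) (i : Fin n) : MemLp (fun ω => X t ω i) 2 P := by
  obtain ⟨I, hI, hI'⟩ := hX.exists_martingalePart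
  have h : MemLp (fun ω => x i + driftPart A X i t ω + ∑ l, I l i t ω) 2 P :=
    ((memLp_const (x i)).add (hX.memLp_driftPart A t i)).add
      (memLp_finsetSum _ fun l _ => (hI l i t).memLp hw)
  exact (memLp_congr_ae (hI' i t)).2 h

lemma IsSDESolution.memLp_mulVec (hw : IsStandardBrownianMotion P w)
    (hX : IsSDESolution P w A C x X)
    (B : Matrix (Fin n) (Fin n) ℝ) (t : ℝ≥0) (i : Fin n) :
    MemLp (fun ω => (B *ᵥ X t ω) i) 2 P := by
  simp only [Matrix.mulVec, dotProduct]
  exact memLp_finsetSum _ fun j _ => (hX.memLp_apply hw t j).const_mul _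

end SecondMoment

/-! ### Continuity of time integrals as curves in L². -/

section LTwoCurves

variable {Ω : Type*} [mΩ : MeasurableSpace Ω] {P : Measure Ω} [IsProbabilityMeasure P]

lemma integral_timeProd {g : Ω × ℝ → ℝ} {t : ℝ≥0} (hg : Integrable g (timeProd P t)) :
    ∫ z, g z ∂(timeProd P t) = ∫ s in Set.Ioc (0 : ℝ) t, (∫ ω, g (ω, s) ∂P) := by
  rw [timeProd, integral_prod_symm _ hg]

lemma continuous_integral_timeProd {g : Ω × ℝ → ℝ} (hg : ∀ t, Integrable g (timeProd P t)) :
    Continuous fun t : ℝ≥0 => ∫ z, g z ∂(timeProd P t) := by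
  refine continuous_iff_continuousAt.2 fun t => ?_
  have h1 : IntegrableOn (fun s => ∫ ω, g (ω, s) ∂P) (Set.Icc (0 : ℝ) (t + 1 : ℝ≥0)) :=
    (integrableOn_Icc_iff_integrableOn_Ioc (by simp)).2 (hg (t + 1)).integral_prod_right
  have h2 := intervalIntegral.continuousOn_primitive h1
  have h3 : ContinuousOn (fun s : ℝ≥0 => ∫ z, g z ∂(timeProd P s)) (Set.Iic (t + 1)) := by
    refine (h2.comp NNReal.continuous_coe.continuousOn fun s hs => ?_).congr fun s _ => ?_
    · exact ⟨s.coe_nonneg, NNReal.coe_le_coe.2 hs⟩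
    · exact integral_timeProd (hg s)
  exact h3.continuousAt (Iic_mem_nhds (by simp))

omit [IsProbabilityMeasure P] in
lemma norm_sub_toLp_two_sq {f g : Ω → ℝ} (hf : MemLp f 2 P) (hg : MemLp g 2 P) :
    ‖hf.toLp f - hg.toLp g‖ ^ 2 =
      ∫ ω, f ω * f ω ∂P - 2 * ∫ ω, f ω * g ω ∂P + ∫ ω, g ω * g ω ∂P := by
  rw [norm_sub_sq_real, norm_toLp_two_sq, norm_toLp_two_sq, inner_toLp_two]

/-- The time integral of a square integrable process is a continuous curve in `L²`. -/
lemma continuous_toLp_integral {Φ : Ω × ℝ → ℝ} (hΦ : ∀ t, MemLp Φ 2 (timeProd P t))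
    {D : ℝ≥0 → Ω → ℝ} (hD : ∀ t ω, D t ω = ∫ s in Set.Ioc (0 : ℝ) t, Φ (ω, s))
    (hDm : ∀ t, MemLp (D t) 2 P) : Continuous fun t => (hDm t).toLp (D t) := by
  have hK := continuous_integral_timeProd fun t => (hΦ t).integrable_fun_mul (hΦ t)
  set K : ℝ≥0 → ℝ := fun t => ∫ z, Φ z * Φ z ∂(timeProd P t)
  -- Cauchy–Schwarz on (s, t] bounds the squared distance by its length times the energy up to t.
  have key : ∀ s t : ℝ≥0, s ≤ t →
      ‖(hDm t).toLp (D t) - (hDm s).toLp (D s)‖ ^ 2 ≤ (t - s : ℝ) * K t := by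
    intro s t hst
    have hle : P.prod (volume.restrict (Set.Ioc (s : ℝ) t)) ≤ timeProd P t := by
      refine Measure.prod_mono le_rfl ?_
      exact Measure.restrict_mono_set _ (Set.Ioc_subset_Ioc_left s.coe_nonneg)
    have hΦ' : MemLp Φ 2 (P.prod (volume.restrict (Set.Ioc (s : ℝ) t))) :=
      (hΦ t).mono_measure hle
    rw [← MemLp.toLp_sub, norm_toLp_two_sq]
    have h1 := integral_sq_integral_slice_le hΦ'
    have h2 : ∫ z, Φ z * Φ z ∂(P.prod (volume.restrict (Set.Ioc (s : ℝ) t))) ≤ K t :=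
      integral_mono_measure hle (Eventually.of_forall fun z => mul_self_nonneg _)
        ((hΦ t).integrable_fun_mul (hΦ t))
    have h3 : (volume.restrict (Set.Ioc (s : ℝ) t)).real Set.univ = t - s := by
      rw [Measure.real, Measure.restrict_apply_univ, Real.volume_Ioc,
        ENNReal.toReal_ofReal (sub_nonneg.2 (NNReal.coe_le_coe.2 hst))]
    rw [h3] at h1
    refine le_trans (le_of_eq ?_) (h1.trans (mul_le_mul_of_nonneg_left h2
      (sub_nonneg.2 (NNReal.coe_le_coe.2 hst))))
    refine integral_congr_ae ?_
    filter_upwards [ae_memLp_slice (hΦ t)] with ω hω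
    have hi : IntegrableOn (fun y => Φ (ω, y)) (Set.Ioc (0 : ℝ) t) := hω.integrable one_le_two
    have e : D t ω - D s ω = ∫ y in Set.Ioc (s : ℝ) t, Φ (ω, y) := by
      rw [hD, hD, ← Set.Ioc_union_Ioc_eq_Ioc s.coe_nonneg (NNReal.coe_le_coe.2 hst),
        setIntegral_union (Set.Ioc_disjoint_Ioc_of_le le_rfl) measurableSet_Ioc]
      · ring
      · exact hi.mono_set (Set.Ioc_subset_Ioc_right (NNReal.coe_le_coe.2 hst))
      · exact hi.mono_set (Set.Ioc_subset_Ioc_left s.coe_nonneg)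
    simp only [Pi.sub_apply, e]
  refine continuous_of_sq_norm_sub_le (B := fun s t : ℝ≥0 => |(t : ℝ) - s| * K (max s t)) ?_ ?_
  · intro s t
    rcases le_total s t with h | h
    · rw [max_eq_right h, abs_of_nonneg (sub_nonneg.2 (NNReal.coe_le_coe.2 h))]
      exact key s t h
    · rw [max_eq_left h, abs_sub_comm, abs_of_nonneg (sub_nonneg.2 (NNReal.coe_le_coe.2 h)),
        norm_sub_rev]
      exact key t s h
  · intro s
    have : Continuous fun t : ℝ≥0 => |(t : ℝ) - s| * K (max s t) := by fun_prop
    have h := this.tendsto s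
    simpa using h

end LTwoCurves

/-! ### Integral equation for the second moments. -/

section SecondMoment

variable {Ω : Type*} [mΩ : MeasurableSpace Ω] {P : Measure Ω} [IsProbabilityMeasure P]
  [P.IsComplete] {r n : ℕ} {w : Fin r → ℝ≥0 → Ω → ℝ}
  {A : Matrix (Fin n) (Fin n) ℝ} {C : Fin r → Matrix (Fin n) (Fin n) ℝ} {x : Fin n → ℝ}
  {X : ℝ≥0 → Ω → Fin n → ℝ}

/-- This is the Itô product rule in expectation. Each coordinate is viewed as a curve in L²(P), and
`inner_eq_add_integral_of_orthogonal` is applied to its decomposition into initial value, drift and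
martingale part. -/
lemma IsSDESolution.exists_secondMoment_eq (hw : IsStandardBrownianMotion P w)
    (hX : IsSDESolution P w A C x X) (i j : Fin n) :
    (∀ a b, Continuous fun t : ℝ≥0 => ∫ ω, X t ω a * X t ω b ∂P) ∧
    ∀ t : ℝ≥0, ∫ ω, X t ω i * X t ω j ∂P = x i * x j +
      ∫ s in (0 : ℝ)..t, (∫ ω, (A *ᵥ X s.toNNReal ω) i * X s.toNNReal ω j ∂P +
        ∫ ω, X s.toNNReal ω i * (A *ᵥ X s.toNNReal ω) j ∂P +
        ∑ l, ∫ ω, (C l *ᵥ X s.toNNReal ω) i * (C l *ᵥ X s.toNNReal ω) j ∂P) := by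
  obtain ⟨I, hI, hXI⟩ := hX.exists_martingalePart
  have hXm := hX.memLp_apply hw
  have hBm := hX.memLp_mulVec hw
  have hφ : ∀ (l : Fin r) (i : Fin n) t,
      AEMeasurable (spaceTime fun s ω => (C l *ᵥ X s ω) i) (timeProd P t) := fun l i t =>
    (hX.memLp_spaceTime_mulVec (C l) t i).1.aemeasurable
  have hIm : ∀ l i t, MemLp (I l i t) 2 P := fun l i t => (hI l i t).memLp hw
  -- the martingale part
  set M : Fin n → ℝ≥0 → Ω → ℝ := fun i t ω => ∑ l, I l i t ω with hM
  have hMm : ∀ i t, MemLp (M i t) 2 P := fun i t => memLp_finsetSum _ fun l _ => hIm l i t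
  -- The martingale property brings the later time back to s. The isometry then leaves only the
  -- terms with equal noise index.
  have hMM : ∀ i j s t, s ≤ t → ∫ ω, M i s ω * M j t ω ∂P =
      ∑ l, ∫ z, spaceTime (fun s ω => (C l *ᵥ X s ω) i) z *
        spaceTime (fun s ω => (C l *ᵥ X s ω) j) z ∂(timeProd P s) := by
    intro i j s t hst
    simp only [hM, Finset.sum_mul_sum]
    rw [integral_finsetSum _ fun l _ => integrable_finsetSum _ fun l' _ =>
      (hIm l i s).integrable_fun_mul (hIm l' j t)]
    refine Finset.sum_congr rfl fun l _ => ?_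
    rw [integral_finsetSum _ fun l' _ => (hIm l i s).integrable_fun_mul (hIm l' j t)]
    rw [Finset.sum_eq_single l]
    · rw [(hI l j t).integral_mul_of_le' hw hst (hI l j s) (hI l i s) (hφ l j t) (hφ l i s),
        (hI l i s).integral_mul hw (hI l j s) (hφ l i s) (hφ l j s), if_pos rfl]
    · intro l' _ hl'
      rw [(hI l' j t).integral_mul_of_le' hw hst (hI l' j s) (hI l i s) (hφ l' j t) (hφ l i s),
        (hI l i s).integral_mul hw (hI l' j s) (hφ l i s) (hφ l' j s), if_neg hl'.symm]
    · simp
  have hMcont : ∀ i, Continuous fun t => (hMm i t).toLp (M i t) := by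
    intro i
    have hG : Continuous fun t : ℝ≥0 => ∑ l, ∫ z, spaceTime (fun s ω => (C l *ᵥ X s ω) i) z *
        spaceTime (fun s ω => (C l *ᵥ X s ω) i) z ∂(timeProd P t) :=
      continuous_finsetSum _ fun l _ => continuous_integral_timeProd fun t =>
        (hX.memLp_spaceTime_mulVec (C l) t i).integrable_fun_mul
          (hX.memLp_spaceTime_mulVec (C l) t i)
    set G : ℝ≥0 → ℝ := fun t => ∑ l, ∫ z, spaceTime (fun s ω => (C l *ᵥ X s ω) i) z *
        spaceTime (fun s ω => (C l *ᵥ X s ω) i) z ∂(timeProd P t)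
    -- Orthogonality of increments turns continuity of the martingale curve into continuity of its
    -- variance.
    have key : ∀ s t, s ≤ t → ‖(hMm i t).toLp (M i t) - (hMm i s).toLp (M i s)‖ ^ 2 = G t - G s := by
      intro s t hst
      have e : ∫ ω, M i t ω * M i s ω ∂P = ∫ ω, M i s ω * M i t ω ∂P := by
        simp only [mul_comm]
      rw [norm_sub_toLp_two_sq, e, hMM i i s t hst, hMM i i s s le_rfl, hMM i i t t le_rfl]
      ring
    refine continuous_of_sq_norm_sub_le (B := fun s t => |G t - G s|) ?_ ?_
    · intro s t
      rcases le_total s t with h | h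
      · rw [key s t h]; exact le_abs_self _
      · rw [norm_sub_rev, key t s h, abs_sub_comm]; exact le_abs_self _
    · intro s
      have : Continuous fun t => |G t - G s| := by fun_prop
      simpa using this.tendsto s
  -- the drift part
  have hDm := fun i t => hX.memLp_driftPart A t i
  have hDcont : ∀ i, Continuous fun t => (hDm i t).toLp (driftPart A X i t) := fun i =>
    continuous_toLp_integral (fun t => hX.memLp_spaceTime_mulVec A t i) (fun t ω => rfl) (hDm i)
  have hc : ∀ i, MemLp (fun _ : Ω => x i) 2 P := fun i => memLp_const _
  have hdec : ∀ i t, (hXm t i).toLp _ =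
      (hc i).toLp _ + (hDm i t).toLp _ + (hMm i t).toLp _ := by
    intro i t
    rw [← MemLp.toLp_add, ← MemLp.toLp_add]
    exact MemLp.toLp_congr _ _ (hXI i t)
  have hXcont : ∀ i, Continuous fun t => (hXm t i).toLp fun ω => X t ω i := by
    intro i
    simp only [hdec]
    exact (continuous_const.add (hDcont i)).add (hMcont i)
  have hsum : ∀ (B : Matrix (Fin n) (Fin n) ℝ) t i, (hBm B t i).toLp _ =
      ∑ j, B i j • (hXm t j).toLp fun ω => X t ω j := by
    intro B t i
    refine ext_inner_left ℝ fun v => ?_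
    rw [← Lp.toLp_coeFn v (Lp.memLp v), inner_sum, inner_toLp_two]
    simp only [inner_smul_right, inner_toLp_two, Matrix.mulVec, dotProduct, Finset.mul_sum]
    rw [integral_finsetSum]
    · refine Finset.sum_congr rfl fun j _ => ?_
      rw [← integral_const_mul]
      refine integral_congr_ae (Eventually.of_forall fun ω => ?_)
      simp only
      ring
    · intro j _
      exact (Lp.memLp v).integrable_fun_mul ((hXm t j).const_mul _)
  have hBcont : ∀ (B : Matrix (Fin n) (Fin n) ℝ) i,
      Continuous fun t => (hBm B t i).toLp fun ω => (B *ᵥ X t ω) i := by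
    intro B i
    simp only [hsum]
    exact continuous_finsetSum _ fun j _ => (continuous_const_smul (B i j)).comp (hXcont j)
  refine ⟨fun a b => ?_, fun t => ?_⟩
  · simp only [← inner_toLp_two (hXm _ a) (hXm _ b)]
    exact (hXcont a).inner (hXcont b)
  have hBc : ∀ (B : Matrix (Fin n) (Fin n) ℝ) i,
      Continuous fun s : ℝ => (hBm B s.toNNReal i).toLp fun ω => (B *ᵥ X s.toNNReal ω) i :=
    fun B i => (hBcont B i).comp continuous_real_toNNReal
  have hXc : ∀ i, Continuous fun s : ℝ => (hXm s.toNNReal i).toLp fun ω => X s.toNNReal ω i :=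
    fun i => (hXcont i).comp continuous_real_toNNReal
  -- The pathwise drift integral is identified with the Bochner integral of a curve in L² by pairing
  -- both with an arbitrary v; the pairing is an application of Fubini.
  have hDint : ∀ i (t : ℝ), 0 ≤ t → (hDm i t.toNNReal).toLp (driftPart A X i t.toNNReal) =
      ∫ s in (0 : ℝ)..t, (hBm A s.toNNReal i).toLp fun ω => (A *ᵥ X s.toNNReal ω) i := by
    intro i t ht
    refine ext_inner_left ℝ fun v => ?_
    rw [intervalIntegral.integral_of_le ht, ← integral_inner (𝕜 := ℝ)
      (((hBc A i).intervalIntegrable (μ := volume) 0 t).1) v,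
      ← Lp.toLp_coeFn v (Lp.memLp v)]
    simp only [inner_toLp_two]
    have := integral_mul_integral_slice (hX.memLp_spaceTime_mulVec A t.toNNReal i) (Lp.memLp v)
    rw [Real.coe_toNNReal _ ht] at this
    simp only [driftPart, Real.coe_toNNReal _ ht]
    exact this
  have hFM : ∀ i j (s t : ℝ), 0 ≤ s → s ≤ t →
      inner ℝ ((hBm A s.toNNReal i).toLp fun ω => (A *ᵥ X s.toNNReal ω) i)
        ((hMm j t.toNNReal).toLp (M j t.toNNReal)) =
      inner ℝ ((hBm A s.toNNReal i).toLp fun ω => (A *ᵥ X s.toNNReal ω) i)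
        ((hMm j s.toNNReal).toLp (M j s.toNNReal)) := by
    intro i j s t hs hst
    rw [inner_toLp_two, inner_toLp_two]
    simp only [hM, Finset.mul_sum]
    rw [integral_finsetSum _ fun l _ => (hBm A _ i).integrable_fun_mul (hIm l j _),
      integral_finsetSum _ fun l _ => (hBm A _ i).integrable_fun_mul (hIm l j _)]
    refine Finset.sum_congr rfl fun l _ => ?_
    exact (hI l j _).integral_mul_of_le hw (Real.toNNReal_mono hst) (hI l j _) (hφ l j _)
      (hX.measurable_mulVec A _ i) (hBm A _ i)
  have heM : ∀ i j (t : ℝ), 0 ≤ t →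
      inner ℝ ((hc i).toLp _) ((hMm j t.toNNReal).toLp (M j t.toNNReal)) = 0 := by
    intro i j t ht
    rw [inner_toLp_two, integral_const_mul, hM]
    simp only
    rw [integral_finsetSum _ fun l _ => (hIm l j _).integrable one_le_two]
    simp [fun l => (hI l j t.toNNReal).integral_eq_zero hw (hφ l j _)]
  have := inner_eq_add_integral_of_orthogonal (H := Lp ℝ 2 P)
    (q := fun s : ℝ => ∑ l, inner ℝ
      ((hBm (C l) s.toNNReal i).toLp fun ω => (C l *ᵥ X s.toNNReal ω) i)
      ((hBm (C l) s.toNNReal j).toLp fun ω => (C l *ᵥ X s.toNNReal ω) j))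
    (hBc A i) (hBc A j) (hXc i) (hXc j)
    (continuous_finsetSum _ fun l _ => (hBc (C l) i).inner (hBc (C l) j))
    (M₁ := fun t => (hMm i t.toNNReal).toLp (M i t.toNNReal))
    (M₂ := fun t => (hMm j t.toNNReal).toLp (M j t.toNNReal))
    (e₁ := (hc i).toLp _) (e₂ := (hc j).toLp _)
    (fun t ht => by rw [← hDint i t ht]; exact hdec i _)
    (fun t ht => by rw [← hDint j t ht]; exact hdec j _)
    (hFM i j) (hFM j i) (heM i j) (heM j i) ?_ (t := t) t.coe_nonneg
  · simpa only [inner_toLp_two, Real.toNNReal_coe, integral_const, probReal_univ, one_smul]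
      using this
  · intro t ht
    rw [inner_toLp_two, hMM i j _ _ le_rfl, intervalIntegral.integral_finsetSum]
    · refine Finset.sum_congr rfl fun l _ => ?_
      rw [integral_timeProd ((hX.memLp_spaceTime_mulVec (C l) _ i).integrable_fun_mul
          (hX.memLp_spaceTime_mulVec (C l) _ j)), Real.coe_toNNReal _ ht,
        intervalIntegral.integral_of_le ht]
      simp only [inner_toLp_two]
      rfl
    · intro l _
      exact ((hBc (C l) i).inner (hBc (C l) j)).intervalIntegrable _ _

end SecondMoment

/-! ### The Lyapunov operator and its adjoint. -/

section Lyapunov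

variable {r n : ℕ}

/-- The Lyapunov operator `P ↦ P A + Aᵀ P + ∑ C_lᵀ P C_l`. -/
def lyapOp (A : Matrix (Fin n) (Fin n) ℝ) (C : Fin r → Matrix (Fin n) (Fin n) ℝ)
    (P : Matrix (Fin n) (Fin n) ℝ) : Matrix (Fin n) (Fin n) ℝ :=
  P * A + Aᵀ * P + ∑ l, (C l)ᵀ * P * C l

/-- The adjoint Lyapunov operator `Y ↦ A Y + Y Aᵀ + ∑ C_l Y C_lᵀ`. -/
def lyapDual (A : Matrix (Fin n) (Fin n) ℝ) (C : Fin r → Matrix (Fin n) (Fin n) ℝ)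
    (Y : Matrix (Fin n) (Fin n) ℝ) : Matrix (Fin n) (Fin n) ℝ :=
  A * Y + Y * Aᵀ + ∑ l, C l * Y * (C l)ᵀ

/-- The Lyapunov inequality has a positive definite solution. -/
def IsLyapunovStable (A : Matrix (Fin n) (Fin n) ℝ) (C : Fin r → Matrix (Fin n) (Fin n) ℝ) :
    Prop :=
  ∃ H : Matrix (Fin n) (Fin n) ℝ, H.PosDef ∧ (-lyapOp A C H).PosDef

variable (A : Matrix (Fin n) (Fin n) ℝ) (C : Fin r → Matrix (Fin n) (Fin n) ℝ)

/-- Cyclicity of the trace. Through this duality the second-moment equation for U controls tr(HU) by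
L(H). -/
lemma trace_mul_lyapDual (P Y : Matrix (Fin n) (Fin n) ℝ) :
    (P * lyapDual A C Y).trace = (lyapOp A C P * Y).trace := by
  simp only [lyapDual, lyapOp, mul_add, add_mul, Finset.mul_sum, Finset.sum_mul, Matrix.trace_add,
    Matrix.trace_sum]
  congr 1
  · congr 1
    · rw [mul_assoc]
    · rw [← mul_assoc, Matrix.trace_mul_comm, ← mul_assoc]
  · refine Finset.sum_congr rfl fun l _ => ?_
    rw [← Matrix.mul_assoc, Matrix.trace_mul_comm]
    simp only [Matrix.mul_assoc]

lemma lyapOp_add (P Q : Matrix (Fin n) (Fin n) ℝ) :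
    lyapOp A C (P + Q) = lyapOp A C P + lyapOp A C Q := by
  simp only [lyapOp, mul_add, add_mul, Finset.sum_add_distrib]
  abel

lemma lyapOp_smul (c : ℝ) (P : Matrix (Fin n) (Fin n) ℝ) :
    lyapOp A C (c • P) = c • lyapOp A C P := by
  simp only [lyapOp, smul_add, Finset.smul_sum, Matrix.mul_smul, Matrix.smul_mul]

lemma lyapOp_neg (P : Matrix (Fin n) (Fin n) ℝ) : lyapOp A C (-P) = -lyapOp A C P := by
  rw [← neg_one_smul ℝ, lyapOp_smul, neg_one_smul]

lemma lyapOp_sub (P Q : Matrix (Fin n) (Fin n) ℝ) :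
    lyapOp A C (P - Q) = lyapOp A C P - lyapOp A C Q := by
  rw [sub_eq_add_neg, lyapOp_add, lyapOp_neg, sub_eq_add_neg]

lemma transpose_lyapOp (P : Matrix (Fin n) (Fin n) ℝ) :
    (lyapOp A C P)ᵀ = lyapOp A C Pᵀ := by
  simp only [lyapOp, Matrix.transpose_add, Matrix.transpose_mul, Matrix.transpose_sum,
    Matrix.transpose_transpose, mul_assoc]
  abel

/-- `lyapOp` as a linear map. -/
def lyapLinear : Matrix (Fin n) (Fin n) ℝ →ₗ[ℝ] Matrix (Fin n) (Fin n) ℝ where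
  toFun := lyapOp A C
  map_add' := lyapOp_add A C
  map_smul' := lyapOp_smul A C

end Lyapunov

/-! ### Quadratic forms on the Euclidean sphere. -/

section QuadForm

variable {n : ℕ}

lemma trace_mul_vecMulVec (M : Matrix (Fin n) (Fin n) ℝ) (x : Fin n → ℝ) :
    (M * Matrix.vecMulVec x x).trace = x ⬝ᵥ (M *ᵥ x) := by
  rw [Matrix.mul_vecMulVec, Matrix.trace_vecMulVec, dotProduct_comm]

lemma posDef_iff_real {M : Matrix (Fin n) (Fin n) ℝ} :
    M.PosDef ↔ M.IsSymm ∧ ∀ x : Fin n → ℝ, x ≠ 0 → 0 < x ⬝ᵥ (M *ᵥ x) := by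
  rw [Matrix.posDef_iff_dotProduct_mulVec]
  simp [Matrix.IsHermitian, Matrix.IsSymm, Matrix.conjTranspose_eq_transpose_of_trivial]

lemma posSemidef_iff_real {m : Type*} [Fintype m] {M : Matrix m m ℝ} :
    M.PosSemidef ↔ M.IsSymm ∧ ∀ x : m → ℝ, 0 ≤ x ⬝ᵥ (M *ᵥ x) := by
  rw [Matrix.posSemidef_iff_dotProduct_mulVec]
  simp [Matrix.IsHermitian, Matrix.IsSymm, Matrix.conjTranspose_eq_transpose_of_trivial]

/-- Each |x_i x_j| is at most x·x. The sum of the absolute entries serves as an explicit bound in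
place of an operator norm. -/
lemma abs_quadForm_le (M : Matrix (Fin n) (Fin n) ℝ) (x : Fin n → ℝ) :
    |x ⬝ᵥ (M *ᵥ x)| ≤ (∑ i, ∑ j, |M i j|) * (x ⬝ᵥ x) := by
  have hle : ∀ i, x i * x i ≤ x ⬝ᵥ x := fun i =>
    Finset.single_le_sum (f := fun i => x i * x i) (fun j _ => mul_self_nonneg _)
      (Finset.mem_univ i)
  have h1 : ∀ i j, |x i * (M i j * x j)| ≤ |M i j| * (x ⬝ᵥ x) := by
    intro i j
    rw [abs_mul, abs_mul, mul_left_comm]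
    refine mul_le_mul_of_nonneg_left ?_ (abs_nonneg _)
    have h2 := two_mul_le_add_sq |x i| |x j|
    rw [sq_abs, sq_abs, pow_two, pow_two] at h2
    linarith [hle i, hle j]
  calc |x ⬝ᵥ (M *ᵥ x)| = |∑ i, ∑ j, x i * (M i j * x j)| := by
        simp only [dotProduct, Matrix.mulVec, Finset.mul_sum]
    _ ≤ ∑ i, ∑ j, |x i * (M i j * x j)| :=
        (Finset.abs_sum_le_sum_abs _ _).trans
          (Finset.sum_le_sum fun i _ => Finset.abs_sum_le_sum_abs _ _)
    _ ≤ ∑ i, ∑ j, |M i j| * (x ⬝ᵥ x) :=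
        Finset.sum_le_sum fun i _ => Finset.sum_le_sum fun j _ => h1 i j
    _ = _ := by simp only [Finset.sum_mul]

lemma continuous_quadForm (M : Matrix (Fin n) (Fin n) ℝ) :
    Continuous fun x : Fin n → ℝ => x ⬝ᵥ (M *ᵥ x) := by
  simp only [dotProduct, Matrix.mulVec]
  fun_prop

lemma quadForm_smul (M : Matrix (Fin n) (Fin n) ℝ) (a : ℝ) (x : Fin n → ℝ) :
    (a • x) ⬝ᵥ (M *ᵥ (a • x)) = a ^ 2 * (x ⬝ᵥ (M *ᵥ x)) := by
  rw [Matrix.mulVec_smul, smul_dotProduct, dotProduct_smul, smul_eq_mul, smul_eq_mul]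
  ring

lemma isCompact_dotProduct_self_eq_one : IsCompact {x : Fin n → ℝ | x ⬝ᵥ x = 1} := by
  refine Metric.isCompact_of_isClosed_isBounded ?_ ?_
  · refine isClosed_eq ?_ continuous_const
    simp only [dotProduct]
    fun_prop
  · refine (Metric.isBounded_closedBall (x := (0 : Fin n → ℝ)) (r := 1)).subset fun x hx => ?_
    rw [mem_closedBall_zero_iff, pi_norm_le_iff_of_nonneg zero_le_one]
    intro i
    have : x i * x i ≤ x ⬝ᵥ x :=
      Finset.single_le_sum (f := fun i => x i * x i) (fun j _ => mul_self_nonneg _)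
        (Finset.mem_univ i)
    rw [Set.mem_ofPred_eq] at hx
    rw [Real.norm_eq_abs, abs_le_one_iff_mul_self_le_one]
    linarith

lemma dotProduct_self_nonneg_real (x : Fin n → ℝ) : 0 ≤ x ⬝ᵥ x :=
  Finset.sum_nonneg fun _ _ => mul_self_nonneg _

lemma dotProduct_self_pos_of_ne_zero {x : Fin n → ℝ} (hx : x ≠ 0) : 0 < x ⬝ᵥ x := by
  have := Matrix.dotProduct_star_self_pos_iff.2 hx
  simpa using this

/-- Comparison of quadratic forms on the unit sphere extends to the whole space. -/
lemma forall_mul_le_quadForm {M : Matrix (Fin n) (Fin n) ℝ} {c : ℝ}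
    (h : ∀ x : Fin n → ℝ, x ⬝ᵥ x = 1 → c ≤ x ⬝ᵥ (M *ᵥ x)) (x : Fin n → ℝ) :
    c * (x ⬝ᵥ x) ≤ x ⬝ᵥ (M *ᵥ x) := by
  rcases eq_or_ne x 0 with rfl | hx
  · simp
  have hp := dotProduct_self_pos_of_ne_zero hx
  set a := (Real.sqrt (x ⬝ᵥ x))⁻¹ with ha
  have ha2 : a ^ 2 * (x ⬝ᵥ x) = 1 := by
    rw [ha, inv_pow, Real.sq_sqrt hp.le, inv_mul_cancel₀ hp.ne']
  have h1 := h (a • x) (by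
    rw [smul_dotProduct, dotProduct_smul, smul_eq_mul, smul_eq_mul]; linarith)
  rw [quadForm_smul] at h1
  refine (mul_le_mul_of_nonneg_right h1 hp.le).trans_eq ?_
  linear_combination (x ⬝ᵥ (M *ᵥ x)) * ha2

lemma exists_pos_mul_le_quadForm {M : Matrix (Fin n) (Fin n) ℝ} (hM : M.PosDef) :
    ∃ c : ℝ, 0 < c ∧ ∀ x : Fin n → ℝ, c * (x ⬝ᵥ x) ≤ x ⬝ᵥ (M *ᵥ x) := by
  -- The sphere is empty when n = 0; any constant then works. Otherwise the minimum on the sphere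
  -- does.
  rcases Set.eq_empty_or_nonempty {x : Fin n → ℝ | x ⬝ᵥ x = 1} with h | h
  · refine ⟨1, one_pos, forall_mul_le_quadForm fun x hx => ?_⟩
    exact absurd (show x ∈ {x : Fin n → ℝ | x ⬝ᵥ x = 1} from hx) (by simp [h])
  · obtain ⟨v, hv, hmin⟩ := isCompact_dotProduct_self_eq_one.exists_isMinOn h
      (continuous_quadForm M).continuousOn
    refine ⟨v ⬝ᵥ (M *ᵥ v), (posDef_iff_real.1 hM).2 v ?_, forall_mul_le_quadForm fun x hx =>
      hmin hx⟩
    rintro rfl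
    simp at hv

end QuadForm

/-! ### The second-moment equation and decay under a Lyapunov inequality. -/

section SecondMomentODE

variable {Ω : Type*} [mΩ : MeasurableSpace Ω] {P : Measure Ω} [IsProbabilityMeasure P]
  [P.IsComplete] {r n : ℕ} {w : Fin r → ℝ≥0 → Ω → ℝ}
  {A : Matrix (Fin n) (Fin n) ℝ} {C : Fin r → Matrix (Fin n) (Fin n) ℝ} {x : Fin n → ℝ}
  {X : ℝ≥0 → Ω → Fin n → ℝ}

/-- The matrix of second moments of a solution solves the Lyapunov differential equation. -/
lemma IsSDESolution.exists_secondMoment_ode (hw : IsStandardBrownianMotion P w)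
    (hX : IsSDESolution P w A C x X) :
    ∃ U : ℝ → Matrix (Fin n) (Fin n) ℝ, U 0 = Matrix.vecMulVec x x ∧
      (∀ t : ℝ, 0 ≤ t → ∀ i j, HasDerivAt (fun t => U t i j) (lyapDual A C (U t) i j) t) ∧
      ∀ (t : ℝ≥0) (M : Matrix (Fin n) (Fin n) ℝ),
        (M * U t).trace = ∫ ω, X t ω ⬝ᵥ (M *ᵥ X t ω) ∂P := by
  have hXm := hX.memLp_apply hw
  set Y : ℝ → Matrix (Fin n) (Fin n) ℝ := fun t =>
    Matrix.of fun i j => ∫ ω, X t.toNNReal ω i * X t.toNNReal ω j ∂P with hY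
  have hYc : ∀ i j, Continuous fun t => Y t i j := fun i j =>
    ((hX.exists_secondMoment_eq hw i j).1 i j).comp continuous_real_toNNReal
  have hBX : ∀ (B B' : Matrix (Fin n) (Fin n) ℝ) (t : ℝ) (i j : Fin n),
      ∫ ω, (B *ᵥ X t.toNNReal ω) i * (B' *ᵥ X t.toNNReal ω) j ∂P = (B * Y t * B'ᵀ) i j := by
    intro B B' t i j
    simp only [Matrix.mulVec, dotProduct, Matrix.mul_apply, Finset.sum_mul, Finset.mul_sum,
      Matrix.transpose_apply, hY, Matrix.of_apply]
    rw [integral_finsetSum]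
    · refine Finset.sum_congr rfl fun k _ => ?_
      rw [integral_finsetSum]
      · refine Finset.sum_congr rfl fun k' _ => ?_
        rw [← integral_const_mul, ← integral_mul_const]
        refine integral_congr_ae (Eventually.of_forall fun ω => ?_)
        simp only
        ring
      · intro k' _
        exact ((hXm _ k').const_mul _).integrable_fun_mul ((hXm _ k).const_mul _)
    · intro k _
      refine integrable_finsetSum _ fun k' _ => ?_
      exact ((hXm _ k').const_mul _).integrable_fun_mul ((hXm _ k).const_mul _)
  have hYL : ∀ (s : ℝ) i j, ∫ ω, (A *ᵥ X s.toNNReal ω) i * X s.toNNReal ω j ∂P +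
        ∫ ω, X s.toNNReal ω i * (A *ᵥ X s.toNNReal ω) j ∂P +
        ∑ l, ∫ ω, (C l *ᵥ X s.toNNReal ω) i * (C l *ᵥ X s.toNNReal ω) j ∂P =
        lyapDual A C (Y s) i j := by
    intro s i j
    have h1 := hBX A 1 s i j
    have h2 := hBX 1 A s i j
    simp only [Matrix.one_mulVec, Matrix.transpose_one, mul_one, one_mul] at h1 h2
    simp only [h1, h2, hBX, lyapDual, Matrix.add_apply, Matrix.sum_apply]
  have hLc : ∀ i j, Continuous fun t => lyapDual A C (Y t) i j := by
    intro i j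
    simp only [lyapDual, Matrix.add_apply, Matrix.sum_apply, Matrix.mul_apply,
      Matrix.transpose_apply]
    fun_prop
  have hYeq : ∀ (t : ℝ≥0) i j, Y t i j = x i * x j + ∫ s in (0 : ℝ)..t, lyapDual A C (Y s) i j := by
    intro t i j
    have := (hX.exists_secondMoment_eq hw i j).2 t
    simp only [hYL] at this
    rw [← this]
    simp [hY]
  -- `Y` is frozen for negative times, so it need not be differentiable at 0. The right side of its
  -- integral equation is differentiable on all of ℝ and agrees with `Y` for t ≥ 0.
  refine ⟨fun t => Matrix.of fun i j => x i * x j + ∫ s in (0 : ℝ)..t, lyapDual A C (Y s) i j,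
    ?_, ?_, ?_⟩
  · ext i j
    simp [Matrix.vecMulVec_apply]
  · intro t ht i j
    have e : (Matrix.of fun i j => x i * x j + ∫ s in (0 : ℝ)..t, lyapDual A C (Y s) i j) = Y t := by
      ext i j
      have := hYeq t.toNNReal i j
      rw [Real.coe_toNNReal _ ht] at this
      exact this.symm
    change HasDerivAt (fun t => x i * x j + ∫ s in (0 : ℝ)..t, lyapDual A C (Y s) i j)
      (lyapDual A C (Matrix.of fun i j => x i * x j + ∫ s in (0 : ℝ)..t, lyapDual A C (Y s) i j)
        i j) t
    rw [e]
    exact ((hLc i j).integral_hasStrictDerivAt 0 t).hasDerivAt.const_add _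
  · intro t M
    have e : (Matrix.of fun i j => x i * x j + ∫ s in (0 : ℝ)..t, lyapDual A C (Y s) i j) = Y t := by
      ext i j
      exact (hYeq t i j).symm
    change (M * Matrix.of fun i j => x i * x j + ∫ s in (0 : ℝ)..t, lyapDual A C (Y s) i j).trace = _
    rw [e]
    simp only [Matrix.trace, Matrix.diag, Matrix.mul_apply, dotProduct, Matrix.mulVec, hY,
      Matrix.of_apply, Real.toNNReal_coe, Finset.mul_sum]
    rw [integral_finsetSum]
    · refine Finset.sum_congr rfl fun i _ => ?_
      rw [integral_finsetSum]
      · refine Finset.sum_congr rfl fun j _ => ?_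
        rw [← integral_const_mul]
        refine integral_congr_ae (Eventually.of_forall fun ω => ?_)
        simp only
        ring
      · intro j _
        exact (hXm t i).integrable_fun_mul ((hXm t j).const_mul _)
    · intro i _
      refine integrable_finsetSum _ fun j _ => ?_
      exact (hXm t i).integrable_fun_mul ((hXm t j).const_mul _)

lemma hasDerivAt_trace_mul {F U : ℝ → Matrix (Fin n) (Fin n) ℝ}
    {F' U' : Matrix (Fin n) (Fin n) ℝ} {t : ℝ}
    (hF : ∀ i j, HasDerivAt (fun t => F t i j) (F' i j) t)
    (hU : ∀ i j, HasDerivAt (fun t => U t i j) (U' i j) t) :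
    HasDerivAt (fun t => (F t * U t).trace) ((F' * U t).trace + (F t * U').trace) t := by
  simp only [Matrix.trace, Matrix.diag, Matrix.mul_apply]
  rw [← Finset.sum_add_distrib]
  simp only [← Finset.sum_add_distrib]
  exact HasDerivAt.fun_sum fun i _ => HasDerivAt.fun_sum fun j _ => (hF i j).mul (hU j i)

/-- Solutions of a Lyapunov stable system are mean-square convergent to zero. -/
lemma IsSDESolution.tendsto_of_isLyapunovStable (hw : IsStandardBrownianMotion P w)
    (hX : IsSDESolution P w A C x X) (hs : IsLyapunovStable A C) :
    Tendsto (fun t => ∫ ω, X t ω ⬝ᵥ X t ω ∂P) atTop (𝓝 0) := by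
  obtain ⟨H, hH, hN⟩ := hs
  obtain ⟨U, hU0, hU, hUX⟩ := hX.exists_secondMoment_ode hw
  obtain ⟨c, hc, hcH⟩ := exists_pos_mul_le_quadForm hH
  obtain ⟨ε', hε', hεN⟩ := exists_pos_mul_le_quadForm hN
  have hXm := hX.memLp_apply hw
  have hint : ∀ (M : Matrix (Fin n) (Fin n) ℝ) t,
      Integrable (fun ω => X t ω ⬝ᵥ (M *ᵥ X t ω)) P := by
    intro M t
    exact integrable_finsetSum _ fun i _ => (hXm t i).integrable_fun_mul (hX.memLp_mulVec hw M t i)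
  -- The added 1 keeps the upper bound for H positive even for n = 0. With H ⪯ d and -L(H) ⪰ ε', the
  -- rate ε = ε'/d below gives εH ⪯ -L(H).
  set d := (∑ i, ∑ j, |H i j|) + 1
  have hd : 0 < d := by positivity
  have hHd : ∀ y : Fin n → ℝ, y ⬝ᵥ (H *ᵥ y) ≤ d * (y ⬝ᵥ y) := fun y => by
    have h1 := (le_abs_self _).trans (abs_quadForm_le H y)
    have h2 : 0 ≤ y ⬝ᵥ y := dotProduct_self_nonneg_real y
    linarith
  set ε := ε' / d
  have hε : 0 < ε := by positivity
  have hle : ∀ y : Fin n → ℝ, ε * (y ⬝ᵥ (H *ᵥ y)) ≤ y ⬝ᵥ ((-lyapOp A C H) *ᵥ y) := fun y => by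
    refine le_trans ?_ (hεN y)
    have := mul_le_mul_of_nonneg_left (hHd y) hε.le
    refine this.trans_eq ?_
    simp only [ε]
    field_simp
  -- The derivative of V is exp(εt) tr((εH + L(H))U), which is nonpositive because traces against U
  -- are expectations of quadratic forms of X. Monotonicity of V gives exponential decay.
  set V : ℝ → ℝ := fun t => Real.exp (ε * t) * (H * U t).trace with hV
  have hder : ∀ t, 0 ≤ t → HasDerivAt V (ε * Real.exp (ε * t) * (H * U t).trace +
      Real.exp (ε * t) * (lyapOp A C H * U t).trace) t := by
    intro t ht
    have h1 := hasDerivAt_trace_mul (F := fun _ => H) (F' := 0)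
      (fun i j => hasDerivAt_const t (H i j)) (hU t ht)
    rw [zero_mul, Matrix.trace_zero, zero_add, trace_mul_lyapDual] at h1
    have h2 : HasDerivAt (fun t => Real.exp (ε * t)) (ε * Real.exp (ε * t)) t := by
      have := ((hasDerivAt_id t).const_mul ε).exp
      simpa [mul_comm] using this
    exact h2.mul h1
  have hVanti : AntitoneOn V (Set.Ici 0) := by
    refine antitoneOn_of_deriv_nonpos (convex_Ici 0)
      (fun t ht => (hder t ht).continuousAt.continuousWithinAt) ?_ ?_
    · intro t ht
      rw [interior_Ici] at ht
      exact (hder t ht.le).differentiableAt.differentiableWithinAt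
    · intro t ht
      rw [interior_Ici] at ht
      rw [(hder t ht.le).deriv]
      have h1 : ε * (H * U t).trace ≤ (-lyapOp A C H * U t).trace := by
        have e1 := hUX t.toNNReal H
        have e2 := hUX t.toNNReal (-lyapOp A C H)
        rw [Real.coe_toNNReal _ ht.le] at e1 e2
        rw [e1, e2, ← integral_const_mul]
        exact integral_mono ((hint H _).const_mul _) (hint _ _) fun ω => hle _
      rw [Matrix.neg_mul, Matrix.trace_neg] at h1
      have := Real.exp_pos (ε * t)
      nlinarith
  have hbound : ∀ t : ℝ≥0, ∫ ω, X t ω ⬝ᵥ X t ω ∂P ≤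
      (H * U 0).trace / c * Real.exp (-(ε * t)) := by
    intro t
    have h1 : V t ≤ V 0 := hVanti (Set.mem_Ici.2 le_rfl) (Set.mem_Ici.2 t.coe_nonneg) t.coe_nonneg
    simp only [hV, mul_zero, Real.exp_zero, one_mul] at h1
    have h2 : c * ∫ ω, X t ω ⬝ᵥ X t ω ∂P ≤ (H * U t).trace := by
      rw [hUX, ← integral_const_mul]
      refine integral_mono ?_ (hint H t) fun ω => hcH _
      have := hint 1 t
      simp only [Matrix.one_mulVec] at this
      exact this.const_mul _
    rw [Real.exp_neg, div_mul_eq_mul_div, le_div_iff₀ hc, ← div_eq_mul_inv,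
      le_div_iff₀ (Real.exp_pos _)]
    have := mul_le_mul_of_nonneg_left h2 (Real.exp_pos (ε * t)).le
    linarith
  refine squeeze_zero (fun t => ?_) hbound ?_
  · exact integral_nonneg fun ω => dotProduct_self_nonneg_real (X t ω)
  · have h1 : Tendsto (fun t : ℝ≥0 => ε * (t : ℝ)) atTop atTop :=
      (NNReal.tendsto_coe_atTop.2 tendsto_id).const_mul_atTop hε
    have h2 := (Real.tendsto_exp_neg_atTop_nhds_zero.comp h1).const_mul ((H * U 0).trace / c)
    rw [mul_zero] at h2
    exact h2

end SecondMomentODE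

/-- The linear differential equation `F' = L F` has a global solution. -/
lemma exists_linear_flow {E : Type*} [NormedAddCommGroup E] [NormedSpace ℝ E] [CompleteSpace E]
    (L : E →L[ℝ] E) (v : E) : ∃ F : ℝ → E, F 0 = v ∧ ∀ t, HasDerivAt F (L (F t)) t := by
  refine ⟨fun t => NormedSpace.exp (t • L) v, by simp, fun t => ?_⟩
  have h1 := hasDerivAt_exp_smul_const' (𝕂 := ℝ) L t
  have h2 := h1.clm_apply (hasDerivAt_const t v)
  simp only [map_zero, add_zero] at h2
  exact h2

/-! ### From mean-square stability to the Lyapunov inequality. -/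

section LyapunovFlow

variable {r n : ℕ}

attribute [local instance] Matrix.normedAddCommGroup Matrix.normedSpace

/-- A solution of the Lyapunov differential equation `G' = L(G)`, `G(0) = 1`. -/
lemma exists_lyapunov_flow (A : Matrix (Fin n) (Fin n) ℝ) (C : Fin r → Matrix (Fin n) (Fin n) ℝ) :
    ∃ G : ℝ → Matrix (Fin n) (Fin n) ℝ, G 0 = 1 ∧ (∀ t, (G t).IsSymm) ∧
      ∀ t, HasDerivAt G (lyapOp A C (G t)) t := by
  obtain ⟨F, hF0, hFd⟩ : ∃ F : ℝ → Matrix (Fin n) (Fin n) ℝ, F 0 = 1 ∧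
      ∀ t, HasDerivAt F (lyapOp A C (F t)) t :=
    exists_linear_flow (LinearMap.toContinuousLinearMap (lyapLinear A C)) 1
  set T : Matrix (Fin n) (Fin n) ℝ →L[ℝ] Matrix (Fin n) (Fin n) ℝ :=
    LinearMap.toContinuousLinearMap (Matrix.transposeLinearEquiv (Fin n) (Fin n) ℝ ℝ).toLinearMap
  -- The Lyapunov operator commutes with transposition, so the symmetric part of a solution is a
  -- solution; it has the same initial value 1.
  refine ⟨fun t => (1 / 2 : ℝ) • (F t + (F t)ᵀ), ?_, ?_, ?_⟩
  · change (1 / 2 : ℝ) • (F 0 + (F 0)ᵀ) = 1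
    rw [hF0, Matrix.transpose_one, ← two_smul ℝ, smul_smul]
    norm_num
  · intro t
    rw [Matrix.IsSymm, Matrix.transpose_smul, Matrix.transpose_add, Matrix.transpose_transpose,
      add_comm]
  · intro t
    have h1 : HasDerivAt (fun t => (F t)ᵀ) ((lyapOp A C (F t))ᵀ) t := T.hasFDerivAt.comp_hasDerivAt t (hFd t)
    rw [lyapOp_smul, lyapOp_add, ← transpose_lyapOp]
    exact ((hFd t).fun_add h1).fun_const_smul _

/-- The operator commutes with the integral, and the integrand becomes G'. This computes L on the
candidate Lyapunov matrix ∫₀ᵀ G. -/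
lemma lyapOp_integral (A : Matrix (Fin n) (Fin n) ℝ) (C : Fin r → Matrix (Fin n) (Fin n) ℝ)
    {G : ℝ → Matrix (Fin n) (Fin n) ℝ} (hG : ∀ t, HasDerivAt G (lyapOp A C (G t)) t) (T : ℝ) :
    lyapOp A C (∫ t in (0 : ℝ)..T, G t) = G T - G 0 := by
  have hc : Continuous G := continuous_iff_continuousAt.2 fun t => (hG t).continuousAt
  set L : Matrix (Fin n) (Fin n) ℝ →L[ℝ] Matrix (Fin n) (Fin n) ℝ :=
    LinearMap.toContinuousLinearMap (lyapLinear A C) with hL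
  have h1 := L.intervalIntegral_comp_comm (hc.intervalIntegrable (μ := volume) 0 T)
  have hLc : Continuous fun t => lyapOp A C (G t) := L.continuous.comp hc
  have h2 := intervalIntegral.integral_eq_sub_of_hasDerivAt (a := 0) (b := T)
    (fun t _ => hG t) (hLc.intervalIntegrable 0 T)
  rw [← h2]
  exact h1.symm

/-- The quadratic form as a continuous linear functional of the matrix. -/
lemma quadForm_integral {G : ℝ → Matrix (Fin n) (Fin n) ℝ} (hc : Continuous G) (x : Fin n → ℝ)
    (T : ℝ) : x ⬝ᵥ ((∫ t in (0 : ℝ)..T, G t) *ᵥ x) = ∫ t in (0 : ℝ)..T, x ⬝ᵥ (G t *ᵥ x) := by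
  let q : Matrix (Fin n) (Fin n) ℝ →ₗ[ℝ] ℝ :=
    { toFun := fun M => x ⬝ᵥ (M *ᵥ x)
      map_add' := fun M N => by rw [Matrix.add_mulVec, dotProduct_add]
      map_smul' := fun c M => by rw [Matrix.smul_mulVec, dotProduct_smul]; rfl }
  have h1 := (LinearMap.toContinuousLinearMap q).intervalIntegral_comp_comm
    (hc.intervalIntegrable (μ := volume) 0 T)
  exact h1.symm

lemma transpose_integral {G : ℝ → Matrix (Fin n) (Fin n) ℝ} (hc : Continuous G)
    (hs : ∀ t, (G t).IsSymm) (T : ℝ) : (∫ t in (0 : ℝ)..T, G t).IsSymm := by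
  have h1 := (LinearMap.toContinuousLinearMap
    (Matrix.transposeLinearEquiv (Fin n) (Fin n) ℝ ℝ).toLinearMap).intervalIntegral_comp_comm
    (hc.intervalIntegrable (μ := volume) 0 T)
  refine h1.symm.trans ?_
  exact intervalIntegral.integral_congr fun t _ => hs t

lemma HasDerivAt.matrix_apply {G : ℝ → Matrix (Fin n) (Fin n) ℝ} {G' : Matrix (Fin n) (Fin n) ℝ}
    {t : ℝ} (h : HasDerivAt G G' t) (i j : Fin n) : HasDerivAt (fun t => G t i j) (G' i j) t :=
  hasDerivAt_pi.1 (hasDerivAt_pi.1 h i) j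

/-- A symmetric matrix valued curve tends to zero if its quadratic forms do. -/
lemma tendsto_zero_of_quadForm {ι : Type*} {l : Filter ι} {G : ι → Matrix (Fin n) (Fin n) ℝ}
    (hs : ∀ t, (G t).IsSymm)
    (h : ∀ x : Fin n → ℝ, Tendsto (fun t => x ⬝ᵥ (G t *ᵥ x)) l (𝓝 0)) (i j : Fin n) :
    Tendsto (fun t => G t i j) l (𝓝 0) := by
  -- Polarization: the entry (i, j) of a symmetric matrix is recovered from three values of its
  -- quadratic form.
  have h1 := (((h (Pi.single i 1 + Pi.single j 1)).sub (h (Pi.single i 1))).sub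
    (h (Pi.single j 1))).const_mul (1 / 2)
  simp only [sub_zero, mul_zero] at h1
  refine h1.congr fun t => ?_
  simp only [Matrix.mulVec_add, add_dotProduct, dotProduct_add, Matrix.mulVec_single_one,
    single_one_dotProduct, Matrix.col_apply]
  have := (hs t).apply i j
  rw [this]
  ring

variable {Ω : Type*} [mΩ : MeasurableSpace Ω] {P : Measure Ω} [IsProbabilityMeasure P]
  [P.IsComplete] {w : Fin r → ℝ≥0 → Ω → ℝ}
  {A : Matrix (Fin n) (Fin n) ℝ} {C : Fin r → Matrix (Fin n) (Fin n) ℝ}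

/-- Mean-square stability implies the solvability of the Lyapunov inequality. -/
theorem IsMeanSquareStable.isLyapunovStable (hw : IsStandardBrownianMotion P w)
    (h : IsMeanSquareStable P w A C) : IsLyapunovStable A C := by
  obtain ⟨G, hG0, hGs, hG⟩ := exists_lyapunov_flow A C
  have hGc : Continuous G := continuous_iff_continuousAt.2 fun t => (hG t).continuousAt
  choose X hX hX0 using h
  -- By duality tr(G(t - s)U(s)) is constant in s. Its values at s = 0 and s = t are the two sides.
  have hq : ∀ (x : Fin n → ℝ) (t : ℝ≥0),
      x ⬝ᵥ (G t *ᵥ x) = ∫ ω, X x t ω ⬝ᵥ X x t ω ∂P := by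
    intro x t
    obtain ⟨U, hU0, hU, hUX⟩ := (hX x).exists_secondMoment_ode hw
    have hd : ∀ s ∈ Set.Icc (0 : ℝ) t,
        HasDerivAt (fun s => (G (t - s) * U s).trace) 0 s := by
      intro s hs
      have h1 : ∀ i j, HasDerivAt (fun s => G (t - s) i j) ((-lyapOp A C (G (t - s))) i j) s := by
        intro i j
        have h2 := ((hG (t - s)).matrix_apply i j)
        have h3 := h2.comp s ((hasDerivAt_id s).const_sub (t : ℝ))
        rw [mul_neg_one] at h3
        exact h3
      have := hasDerivAt_trace_mul h1 (hU s hs.1)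
      rwa [trace_mul_lyapDual, Matrix.neg_mul, Matrix.trace_neg, neg_add_cancel] at this
    have hconst := constant_of_has_deriv_right_zero (f := fun s => (G (t - s) * U s).trace)
      (a := 0) (b := t) (fun s hs => (hd s hs).continuousAt.continuousWithinAt)
      (fun s hs => (hd s ⟨hs.1, hs.2.le⟩).hasDerivWithinAt) t ⟨t.coe_nonneg, le_rfl⟩
    simp only [sub_self, sub_zero, hG0, hU0, trace_mul_vecMulVec] at hconst
    rw [← hconst, hUX]
    simp only [Matrix.one_mulVec]
  have hlim : ∀ x : Fin n → ℝ, Tendsto (fun t : ℝ≥0 => x ⬝ᵥ (G t *ᵥ x)) atTop (𝓝 0) := by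
    intro x
    simp only [hq]
    exact hX0 x
  have hent := tendsto_zero_of_quadForm (fun t : ℝ≥0 => hGs t) hlim
  have hsum : Tendsto (fun t : ℝ≥0 => ∑ i, ∑ j, |G t i j|) atTop (𝓝 0) := by
    have := tendsto_finsetSum (Finset.univ : Finset (Fin n)) fun i _ =>
      tendsto_finsetSum (Finset.univ : Finset (Fin n)) fun j _ => (hent i j).abs
    simpa using this
  -- T is taken so large that the entries of G(T) have absolute sum below 1, whence 1 - G(T) ≻ 0. A
  -- finite horizon suffices, so no convergence of the integral over [0, ∞) is needed.
  obtain ⟨T, hT1, hT0⟩ := ((hsum.eventually (gt_mem_nhds (show (0 : ℝ) < 1 by norm_num))).and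
    (eventually_gt_atTop (0 : ℝ≥0))).exists
  have hTr : (0 : ℝ) < T := NNReal.coe_pos.2 hT0
  refine ⟨∫ t in (0 : ℝ)..T, G t, ?_, ?_⟩
  · rw [posDef_iff_real]
    refine ⟨transpose_integral hGc hGs T, fun x hx => ?_⟩
    rw [quadForm_integral hGc]
    have hcx : Continuous fun t => x ⬝ᵥ (G t *ᵥ x) := by
      have : ∀ i j, Continuous fun t => G t i j := fun i j =>
        continuous_iff_continuousAt.2 fun t => ((hG t).matrix_apply i j).continuousAt
      simp only [dotProduct, Matrix.mulVec]
      fun_prop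
    -- The integrand is a second moment, hence nonnegative; it is strictly positive at time 0
    -- because G(0) = 1.
    refine intervalIntegral.integral_pos hTr hcx.continuousOn (fun t ht => ?_)
      ⟨0, ⟨le_rfl, hTr.le⟩, ?_⟩
    · have := hq x t.toNNReal
      rw [Real.coe_toNNReal _ ht.1.le] at this
      rw [this]
      exact integral_nonneg fun ω => dotProduct_self_nonneg_real _
    · rw [hG0, Matrix.one_mulVec]
      exact dotProduct_self_pos_of_ne_zero hx
  · rw [lyapOp_integral A C hG, hG0, neg_sub, posDef_iff_real]
    refine ⟨Matrix.isSymm_one.sub (hGs T), fun x hx => ?_⟩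
    rw [Matrix.sub_mulVec, dotProduct_sub, Matrix.one_mulVec]
    have h1 := (le_abs_self _).trans (abs_quadForm_le (G T) x)
    have h2 := dotProduct_self_pos_of_ne_zero hx
    nlinarith

end LyapunovFlow

/-! ### One-step estimates for the Euler scheme. -/

section Euler

variable {Ω : Type*} [mΩ : MeasurableSpace Ω] {r n : ℕ}

/-- The increment over `[a, b]` of the Euler scheme started in `v`. -/
def eulerIncr (w : Fin r → ℝ≥0 → Ω → ℝ) (A : Matrix (Fin n) (Fin n) ℝ)
    (C : Fin r → Matrix (Fin n) (Fin n) ℝ) (a b : ℝ≥0) (ω : Ω) (v : Fin n → ℝ) : Fin n → ℝ :=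
  ((b : ℝ) - a) • (A *ᵥ v) + ∑ l, (w l b ω - w l a ω) • (C l *ᵥ v)

/-- The random vector `Z` is square integrable and known at time `a`. -/
def SqIntegrableAt (P : Measure Ω) (w : Fin r → ℝ≥0 → Ω → ℝ) (a : ℝ≥0) (Z : Ω → Fin n → ℝ) : Prop :=
  ∀ i, Measurable[augmentedFiltration P w a] (fun ω => Z ω i) ∧ MemLp (fun ω => Z ω i) 2 P

variable {P : Measure Ω} {w : Fin r → ℝ≥0 → Ω → ℝ} {A : Matrix (Fin n) (Fin n) ℝ}
  {C : Fin r → Matrix (Fin n) (Fin n) ℝ} {a b c : ℝ≥0} {ω : Ω} {u v : Fin n → ℝ}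
  {Z U : Ω → Fin n → ℝ}

omit mΩ in
lemma eulerIncr_apply (i : Fin n) : eulerIncr w A C a b ω v i =
    ((b : ℝ) - a) * (A *ᵥ v) i + ∑ l, (C l *ᵥ v) i * (w l b ω - w l a ω) := by
  simp [eulerIncr, Finset.sum_apply, mul_comm]

omit mΩ in
lemma eulerIncr_add_eulerIncr :
    eulerIncr w A C a b ω v + eulerIncr w A C b c ω v = eulerIncr w A C a c ω v := by
  ext i
  simp only [Pi.add_apply, eulerIncr_apply]
  rw [add_add_add_comm, ← Finset.sum_add_distrib]
  congr 1
  · ring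
  · exact Finset.sum_congr rfl fun l _ => by ring

omit mΩ in
lemma eulerIncr_sub :
    eulerIncr w A C a b ω (u - v) = eulerIncr w A C a b ω u - eulerIncr w A C a b ω v := by
  ext i
  simp only [Pi.sub_apply, eulerIncr_apply, Matrix.mulVec_sub]
  rw [add_sub_add_comm, ← Finset.sum_sub_distrib]
  congr 1
  · ring
  · exact Finset.sum_congr rfl fun l _ => by ring

namespace SqIntegrableAt

lemma mono (h : SqIntegrableAt P w a Z) (hab : a ≤ b) : SqIntegrableAt P w b Z := fun i =>
  ⟨(h i).1.mono ((augmentedFiltration P w).mono hab) le_rfl, (h i).2⟩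

lemma add (hZ : SqIntegrableAt P w a Z) (hU : SqIntegrableAt P w a U) :
    SqIntegrableAt P w a (fun ω => Z ω + U ω) := fun i =>
  ⟨(hZ i).1.add (hU i).1, (hZ i).2.add (hU i).2⟩

lemma sub (hZ : SqIntegrableAt P w a Z) (hU : SqIntegrableAt P w a U) :
    SqIntegrableAt P w a (fun ω => Z ω - U ω) := fun i =>
  ⟨(hZ i).1.sub (hU i).1, (hZ i).2.sub (hU i).2⟩

lemma mulVec (hZ : SqIntegrableAt P w a Z) (B : Matrix (Fin n) (Fin n) ℝ) :
    SqIntegrableAt P w a (fun ω => B *ᵥ Z ω) := fun i => by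
  simp only [Matrix.mulVec, dotProduct]
  exact ⟨Finset.measurable_sum _ fun j _ => (hZ j).1.const_mul _,
    memLp_finsetSum _ fun j _ => (hZ j).2.const_mul _⟩

lemma integrable (hZ : SqIntegrableAt P w a Z) : Integrable (fun ω => Z ω ⬝ᵥ Z ω) P :=
  integrable_finsetSum _ fun i _ => (hZ i).2.integrable_fun_mul (hZ i).2

variable [IsProbabilityMeasure P] [P.IsComplete]

lemma eulerIncr (hw : IsStandardBrownianMotion P w) (hab : a ≤ b) (hZ : SqIntegrableAt P w a Z) :
    SqIntegrableAt P w b (fun ω => eulerIncr w A C a b ω (Z ω)) := fun i => by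
  simp only [eulerIncr_apply]
  refine ⟨?_, ?_⟩
  · exact (((hZ.mulVec A).mono hab i).1.const_mul _).add (Finset.measurable_sum _ fun l _ =>
      hw.measurable_mul_increment hab le_rfl hab (hZ.mulVec (C l) i).1 l)
  · exact ((hZ.mulVec A i).2.const_mul _).add (memLp_finsetSum _ fun l _ =>
      hw.memLp_mul_increment hab (hZ.mulVec (C l) i).1 (hZ.mulVec (C l) i).2 l)

end SqIntegrableAt

lemma integral_add_dotProduct_le (hZ : SqIntegrableAt P w a Z) (hU : SqIntegrableAt P w a U) :
    ∫ ω, (Z ω + U ω) ⬝ᵥ (Z ω + U ω) ∂P ≤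
      2 * ∫ ω, Z ω ⬝ᵥ Z ω ∂P + 2 * ∫ ω, U ω ⬝ᵥ U ω ∂P := by
  rw [← integral_const_mul, ← integral_const_mul, ← integral_add (hZ.integrable.const_mul _)
    (hU.integrable.const_mul _)]
  refine integral_mono (hZ.add hU).integrable
    ((hZ.integrable.const_mul _).add (hU.integrable.const_mul _)) fun ω => ?_
  have := dotProduct_self_nonneg_real (Z ω - U ω)
  simp only [add_dotProduct, dotProduct_add, sub_dotProduct, dotProduct_sub] at this ⊢
  linarith

variable [IsProbabilityMeasure P] [P.IsComplete]

/-- Discrete isometry: products of ζ with an increment have mean zero, products of distinct noises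
vanish, and each squared noise contributes the step length. -/
lemma integral_sq_add_sum_mul_increment (hw : IsStandardBrownianMotion P w) (hab : a ≤ b)
    {ζ : Ω → ℝ} {ξ : Fin r → Ω → ℝ} (hζ : Measurable[augmentedFiltration P w a] ζ)
    (hζi : MemLp ζ 2 P) (hξ : ∀ l, Measurable[augmentedFiltration P w a] (ξ l))
    (hξi : ∀ l, MemLp (ξ l) 2 P) :
    ∫ ω, (ζ ω + ∑ l, ξ l ω * (w l b ω - w l a ω)) * (ζ ω + ∑ l, ξ l ω * (w l b ω - w l a ω)) ∂P =
      ∫ ω, ζ ω * ζ ω ∂P + ∑ l, ((b : ℝ) - a) * ∫ ω, ξ l ω * ξ l ω ∂P := by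
  have hm : ∀ l, MemLp (fun ω => ξ l ω * (w l b ω - w l a ω)) 2 P := fun l =>
    hw.memLp_mul_increment hab (hξ l) (hξi l) l
  have e : ∀ ω, (ζ ω + ∑ l, ξ l ω * (w l b ω - w l a ω)) *
      (ζ ω + ∑ l, ξ l ω * (w l b ω - w l a ω)) =
      ζ ω * ζ ω + ((∑ l, 2 * (ζ ω * ξ l ω * (w l b ω - w l a ω))) +
        ∑ l, ∑ l', (ξ l ω * (w l b ω - w l a ω)) * (ξ l' ω * (w l' b ω - w l' a ω))) := by
    intro ω
    rw [← Finset.sum_mul_sum, ← Finset.mul_sum]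
    have : ∑ l, ζ ω * ξ l ω * (w l b ω - w l a ω) = ζ ω * ∑ l, ξ l ω * (w l b ω - w l a ω) := by
      rw [Finset.mul_sum]
      exact Finset.sum_congr rfl fun l _ => by ring
    rw [this]
    ring
  have i2 : ∀ l, Integrable (fun ω => 2 * (ζ ω * ξ l ω * (w l b ω - w l a ω))) P := fun l =>
    (hw.integrable_mul_increment hab (hζ.mul (hξ l)) (hζi.integrable_mul (hξi l)) l).const_mul 2
  have i3 : ∀ l l', Integrable (fun ω => (ξ l ω * (w l b ω - w l a ω)) *
      (ξ l' ω * (w l' b ω - w l' a ω))) P := fun l l' => (hm l).integrable_fun_mul (hm l')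
  have i23 : Integrable (fun ω => (∑ l, 2 * (ζ ω * ξ l ω * (w l b ω - w l a ω))) +
      ∑ l, ∑ l', (ξ l ω * (w l b ω - w l a ω)) * (ξ l' ω * (w l' b ω - w l' a ω))) P :=
    (integrable_finsetSum _ fun l _ => i2 l).add
      (integrable_finsetSum _ fun l _ => integrable_finsetSum _ fun l' _ => i3 l l')
  simp_rw [e]
  rw [integral_add (hζi.integrable_fun_mul hζi) i23, integral_add (integrable_finsetSum _ fun l _ => i2 l)
    (integrable_finsetSum _ fun l _ => integrable_finsetSum _ fun l' _ => i3 l l'),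
    integral_finsetSum _ fun l _ => i2 l,
    integral_finsetSum _ fun l _ => integrable_finsetSum _ fun l' _ => i3 l l']
  congr 1
  rw [Finset.sum_eq_zero, zero_add]
  · refine Finset.sum_congr rfl fun l _ => ?_
    rw [integral_finsetSum _ fun l' _ => i3 l l', Finset.sum_eq_single l]
    · rw [hw.integral_pair_of_eq hab hab (hξ l) (hξi l) (hξ l) (hξi l), if_pos rfl, min_self,
        NNReal.coe_sub hab, mul_comm]
    · intro l' _ h
      rw [hw.integral_pair_of_eq hab hab (hξ l) (hξi l) (hξ l') (hξi l'), if_neg h.symm]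
    · simp
  · intro l _
    have h0 := hw.integral_mul_increment hab (ξ := fun ω => ζ ω * ξ l ω) (hζ.mul (hξ l)) l
    rw [integral_const_mul, h0, mul_zero]

/-- The constant of the one-step estimate. -/
def eulerConst (A : Matrix (Fin n) (Fin n) ℝ) (C : Fin r → Matrix (Fin n) (Fin n) ℝ) : ℝ :=
  3 * ∑ i, ∑ j, |(Aᵀ * A) i j| + ∑ l, ∑ i, ∑ j, |((C l)ᵀ * C l) i j|

omit [MeasurableSpace Ω] in
lemma mulVec_dotProduct_self_le (B : Matrix (Fin n) (Fin n) ℝ) (v : Fin n → ℝ) :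
    (B *ᵥ v) ⬝ᵥ (B *ᵥ v) ≤ (∑ i, ∑ j, |(Bᵀ * B) i j|) * (v ⬝ᵥ v) := by
  have h := (le_abs_self _).trans (abs_quadForm_le (Bᵀ * B) v)
  rwa [← Matrix.mulVec_mulVec, Matrix.dotProduct_mulVec, Matrix.vecMul_transpose] at h

lemma eulerConst_nonneg : 0 ≤ eulerConst A C := by
  unfold eulerConst; positivity

/-- The one-step mean-square estimate of the Euler scheme. -/
lemma integral_add_eulerIncr_le (hw : IsStandardBrownianMotion P w) (hab : a ≤ b)
    (hδ : (b : ℝ) - a ≤ 1) (hZ : SqIntegrableAt P w a Z) (hU : SqIntegrableAt P w a U) :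
    ∫ ω, (Z ω + eulerIncr w A C a b ω (U ω)) ⬝ᵥ (Z ω + eulerIncr w A C a b ω (U ω)) ∂P ≤
      (1 + ((b : ℝ) - a)) * ∫ ω, Z ω ⬝ᵥ Z ω ∂P +
        eulerConst A C * ((b : ℝ) - a) * ∫ ω, U ω ⬝ᵥ U ω ∂P := by
  set δ : ℝ := (b : ℝ) - a with hδdef
  have hδ0 : 0 ≤ δ := sub_nonneg.2 (NNReal.coe_le_coe.2 hab)
  have hAU := hU.mulVec A
  have hZA : SqIntegrableAt P w a (fun ω => Z ω + δ • (A *ᵥ U ω)) := fun i =>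
    ⟨(hZ i).1.add ((hAU i).1.const_mul δ), (hZ i).2.add ((hAU i).2.const_mul δ)⟩
  have h1 : ∫ ω, (Z ω + eulerIncr w A C a b ω (U ω)) ⬝ᵥ (Z ω + eulerIncr w A C a b ω (U ω)) ∂P =
      ∫ ω, (Z ω + δ • (A *ᵥ U ω)) ⬝ᵥ (Z ω + δ • (A *ᵥ U ω)) ∂P +
        δ * ∑ l, ∫ ω, (C l *ᵥ U ω) ⬝ᵥ (C l *ᵥ U ω) ∂P := by
    have hsum : ∀ (Y : Ω → Fin n → ℝ), SqIntegrableAt P w b Y →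
        ∫ ω, Y ω ⬝ᵥ Y ω ∂P = ∑ i, ∫ ω, Y ω i * Y ω i ∂P := fun Y hY =>
      integral_finsetSum _ fun i _ => (hY i).2.integrable_fun_mul (hY i).2
    rw [hsum _ ((hZ.mono hab).add (hU.eulerIncr hw hab)), hsum _ (hZA.mono hab)]
    have e : ∀ l, ∫ ω, (C l *ᵥ U ω) ⬝ᵥ (C l *ᵥ U ω) ∂P =
        ∑ i, ∫ ω, (C l *ᵥ U ω) i * (C l *ᵥ U ω) i ∂P := fun l =>
      hsum _ ((hU.mulVec (C l)).mono hab)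
    simp only [e]
    rw [Finset.sum_comm, Finset.mul_sum, ← Finset.sum_add_distrib]
    refine Finset.sum_congr rfl fun i _ => ?_
    rw [Finset.mul_sum]
    have := integral_sq_add_sum_mul_increment hw hab (hZA i).1 (hZA i).2
      (fun l => (hU.mulVec (C l) i).1) (fun l => (hU.mulVec (C l) i).2)
    refine Eq.trans ?_ this
    refine integral_congr_ae (Eventually.of_forall fun ω => ?_)
    simp only [Pi.add_apply, Pi.smul_apply, smul_eq_mul, eulerIncr_apply, ← hδdef]
    ring
  have hUi := hU.integrable
  have hUn : 0 ≤ ∫ ω, U ω ⬝ᵥ U ω ∂P := integral_nonneg fun ω => dotProduct_self_nonneg_real _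
  have h2 : ∀ l, ∫ ω, (C l *ᵥ U ω) ⬝ᵥ (C l *ᵥ U ω) ∂P ≤
      (∑ i, ∑ j, |((C l)ᵀ * C l) i j|) * ∫ ω, U ω ⬝ᵥ U ω ∂P := fun l => by
    rw [← integral_const_mul]
    exact integral_mono (hU.mulVec (C l)).integrable (hUi.const_mul _) fun ω =>
      mulVec_dotProduct_self_le _ _
  -- The cross term is split by 2z·Au ≤ |z|² + |Au|², and δ²|Au|² ≤ δ|Au|² since δ ≤ 1. This
  -- accounts for two of the three units in `eulerConst`; the third is slack.
  have h3 : ∫ ω, (Z ω + δ • (A *ᵥ U ω)) ⬝ᵥ (Z ω + δ • (A *ᵥ U ω)) ∂P ≤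
      (1 + δ) * ∫ ω, Z ω ⬝ᵥ Z ω ∂P +
        2 * δ * ((∑ i, ∑ j, |(Aᵀ * A) i j|) * ∫ ω, U ω ⬝ᵥ U ω ∂P) := by
    rw [← integral_const_mul, ← integral_const_mul, ← integral_const_mul,
      ← integral_add (hZ.integrable.const_mul _) ((hUi.const_mul _).const_mul _)]
    refine integral_mono hZA.integrable
      ((hZ.integrable.const_mul _).add ((hUi.const_mul _).const_mul _)) fun ω => ?_
    have e1 := dotProduct_self_nonneg_real (Z ω - A *ᵥ U ω)
    have e2 := mulVec_dotProduct_self_le A (U ω)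
    have e3 := dotProduct_self_nonneg_real (A *ᵥ U ω)
    simp only [add_dotProduct, dotProduct_add, sub_dotProduct, dotProduct_sub, smul_dotProduct,
      dotProduct_smul, smul_eq_mul] at e1 ⊢
    rw [dotProduct_comm (A *ᵥ U ω) (Z ω)] at e1 ⊢
    generalize hp : Z ω ⬝ᵥ Z ω = p at *
    generalize hq : Z ω ⬝ᵥ A *ᵥ U ω = q at *
    generalize hs : A *ᵥ U ω ⬝ᵥ A *ᵥ U ω = s at *
    generalize (∑ i, ∑ j, |(Aᵀ * A) i j|) * U ω ⬝ᵥ U ω = k at *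
    have f1 : δ * (2 * q) ≤ δ * (p + s) := mul_le_mul_of_nonneg_left (by linarith) hδ0
    have f2 : δ * (δ * s) ≤ 1 * (δ * s) := mul_le_mul_of_nonneg_right hδ (by positivity)
    have f3 : δ * s ≤ δ * k := mul_le_mul_of_nonneg_left e2 hδ0
    linarith
  have h4 : ∑ l, ∫ ω, (C l *ᵥ U ω) ⬝ᵥ (C l *ᵥ U ω) ∂P ≤
      (∑ l, ∑ i, ∑ j, |((C l)ᵀ * C l) i j|) * ∫ ω, U ω ⬝ᵥ U ω ∂P := by
    rw [Finset.sum_mul]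
    exact Finset.sum_le_sum fun l _ => h2 l
  rw [h1, eulerConst]
  have h5 := mul_le_mul_of_nonneg_left h4 hδ0
  have h6 : 0 ≤ δ * ((∑ i, ∑ j, |(Aᵀ * A) i j|) * ∫ ω, U ω ⬝ᵥ U ω ∂P) := by positivity
  linarith

end Euler

/-! ### Maximal inequalities for square integrable martingales. -/

section Maximal

variable {Ω : Type*} [mΩ : MeasurableSpace Ω] {P : Measure Ω} [IsProbabilityMeasure P]

/-- Kolmogorov's inequality for square integrable martingales in discrete time. -/
lemma measure_exists_le_abs_le {𝒢 : Filtration ℕ mΩ} {M : ℕ → Ω → ℝ}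
    (hM : ∀ k, Measurable[𝒢 k] (M k)) (hMi : ∀ k, MemLp (M k) 2 P)
    (hmart : ∀ k (Z : Ω → ℝ), Measurable[𝒢 k] Z → MemLp Z 2 P →
      ∫ ω, Z ω * M (k + 1) ω ∂P = ∫ ω, Z ω * M k ω ∂P) {ε : ℝ} (hε : 0 < ε) (n : ℕ) :
    P {ω | ∃ k ≤ n, ε ≤ |M k ω|} ≤ ENNReal.ofReal ((∫ ω, M n ω * M n ω ∂P) / ε ^ 2) := by
  have hint : ∀ k, Integrable (fun ω => M k ω * M k ω) P := fun k =>
    (hMi k).integrable_fun_mul (hMi k)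
  have hsub : Submartingale (fun k ω => M k ω * M k ω) 𝒢 P := by
    refine submartingale_of_setIntegral_le_succ
      (fun k => ((hM k).mul (hM k)).stronglyMeasurable) hint fun k s hs => ?_
    have hs' := 𝒢.le k s hs
    -- Testing with 1_s M_k gives ∫_s M_k M_{k+1} = ∫_s M_k². Together with (M_{k+1} - M_k)² ≥ 0
    -- this is the submartingale inequality for M².
    have hZ := hmart k (s.indicator (M k)) ((hM k).indicator hs) ((hMi k).indicator hs')
    have e : ∀ f : Ω → ℝ, ∫ ω, s.indicator (M k) ω * f ω ∂P = ∫ ω in s, M k ω * f ω ∂P := by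
      intro f
      rw [← integral_indicator hs']
      refine integral_congr_ae (Eventually.of_forall fun ω => ?_)
      by_cases h : ω ∈ s <;> simp [h]
    rw [e, e] at hZ
    have i1 : Integrable (fun ω => 2 * (M k ω * M (k + 1) ω)) (P.restrict s) :=
      (((hMi k).integrable_fun_mul (hMi (k + 1))).const_mul 2).integrableOn
    have h2 : ∫ ω in s, (2 * (M k ω * M (k + 1) ω) - M k ω * M k ω) ∂P ≤
        ∫ ω in s, M (k + 1) ω * M (k + 1) ω ∂P := by
      refine integral_mono (i1.sub (hint k).integrableOn) (hint (k + 1)).integrableOn fun ω => ?_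
      simp only
      nlinarith [sq_nonneg (M (k + 1) ω - M k ω)]
    rw [integral_sub i1 (hint k).integrableOn, integral_const_mul, hZ] at h2
    linarith
  have hmax := maximal_ineq hsub (fun k ω => mul_self_nonneg _) (ε := (ε ^ 2).toNNReal) n
  have hε2 : ((ε ^ 2).toNNReal : ℝ) = ε ^ 2 := Real.coe_toNNReal _ (by positivity)
  have hset : {ω | ∃ k ≤ n, ε ≤ |M k ω|} = {ω | (((ε ^ 2).toNNReal : ℝ≥0) : ℝ) ≤
      (Finset.range (n + 1)).sup' Finset.nonempty_range_add_one fun k => M k ω * M k ω} := by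
    ext ω
    simp only [Set.mem_ofPred_eq, Finset.le_sup'_iff, Finset.mem_range, Nat.lt_succ_iff, hε2]
    refine exists_congr fun k => and_congr_right fun _ => ?_
    rw [← pow_two (M k ω), ← sq_abs (M k ω), sq_le_sq₀ hε.le (abs_nonneg _)]
  rw [hset, ENNReal.ofReal_div_of_pos (by positivity), ENNReal.le_div_iff_mul_le
    (Or.inl (by simpa using hε.ne')) (Or.inl ENNReal.ofReal_ne_top), mul_comm]
  refine hmax.trans (ENNReal.ofReal_le_ofReal ?_)
  exact setIntegral_le_integral (hint n) (Eventually.of_forall fun ω => mul_self_nonneg _)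

/-- Kolmogorov's inequality for square integrable martingales with continuous paths. -/
lemma measure_exists_lt_abs_le {ℱ : Filtration ℝ≥0 mΩ} {M : ℝ≥0 → Ω → ℝ}
    (hM : ∀ t, Measurable[ℱ t] (M t)) (hMi : ∀ t, MemLp (M t) 2 P)
    (hmart : ∀ s t, s ≤ t → ∀ Z : Ω → ℝ, Measurable[ℱ s] Z → MemLp Z 2 P →
      ∫ ω, Z ω * M t ω ∂P = ∫ ω, Z ω * M s ω ∂P)
    (hc : ∀ᵐ ω ∂P, Continuous fun t => M t ω) {ε : ℝ} (hε : 0 < ε) (T : ℝ≥0) :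
    P {ω | ∃ t ≤ T, ε < |M t ω|} ≤ ENNReal.ofReal ((∫ ω, M T ω * M T ω ∂P) / ε ^ 2) := by
  -- The dyadic grids are stopped at T. Each has finitely many distinct times and they are nested,
  -- so the discrete bound passes to their union by monotonicity.
  let τ : ℕ → ℕ → ℝ≥0 := fun p k => min (k / 2 ^ p) T
  let S : ℕ → Set Ω := fun p => {ω | ∃ k, ε ≤ |M (τ p k) ω|}
  have hτmono : ∀ p, Monotone (τ p) := fun p i j hij => min_le_min_right _ (by gcongr)
  have hτT : ∀ p k, ⌈T⌉₊ * 2 ^ p ≤ k → τ p k = T := by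
    intro p k hk
    refine min_eq_right ?_
    rw [le_div_iff₀ (by positivity)]
    calc T * 2 ^ p ≤ (⌈T⌉₊ : ℝ≥0) * 2 ^ p := by gcongr; exact Nat.le_ceil T
      _ ≤ k := by exact_mod_cast hk
  have hS : ∀ p, P (S p) ≤ ENNReal.ofReal ((∫ ω, M T ω * M T ω ∂P) / ε ^ 2) := by
    intro p
    let 𝒢 : Filtration ℕ mΩ :=
      { seq := fun k => ℱ (τ p k)
        mono' := fun i j hij => ℱ.mono (hτmono p hij)
        le' := fun k => ℱ.le _ }
    have h := measure_exists_le_abs_le (P := P) (𝒢 := 𝒢) (M := fun k => M (τ p k))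
      (fun k => hM _) (fun k => hMi _)
      (fun k Z hZ hZi => hmart _ _ (hτmono p k.le_succ) Z hZ hZi) hε (⌈T⌉₊ * 2 ^ p)
    rw [hτT p _ le_rfl] at h
    refine (measure_mono ?_).trans h
    rintro ω ⟨k, hk⟩
    rcases le_total k (⌈T⌉₊ * 2 ^ p) with hkn | hkn
    · exact ⟨k, hkn, hk⟩
    · refine ⟨_, le_rfl, ?_⟩
      rwa [hτT p k hkn, ← hτT p _ le_rfl] at hk
  have hSmono : Monotone S := by
    refine monotone_nat_of_le_succ fun p => ?_
    rintro ω ⟨k, hk⟩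
    refine ⟨2 * k, ?_⟩
    have : τ (p + 1) (2 * k) = τ p k := by
      simp only [τ]
      congr 1
      push_cast
      rw [pow_succ', mul_div_mul_left _ _ two_ne_zero]
    rwa [this]
  have hU : P (⋃ p, S p) ≤ ENNReal.ofReal ((∫ ω, M T ω * M T ω ∂P) / ε ^ 2) := by
    rw [hSmono.measure_iUnion]
    exact iSup_le hS
  refine (measure_mono_ae ?_).trans hU
  filter_upwards [hc] with ω hω
  rintro ⟨t, htT, ht⟩
  by_contra hn
  have hle : ∀ p k, |M (τ p k) ω| < ε := by
    intro p k
    by_contra h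
    exact hn (Set.mem_iUnion.2 ⟨p, k, not_lt.1 h⟩)
  -- Grid points converge to t, so if |M| < ε on all grids, continuity gives |M(t)| ≤ ε. This
  -- contradicts the strict inequality in the event.
  have hlim : Tendsto (fun p : ℕ => τ p ⌊t * 2 ^ p⌋₊) atTop (𝓝 t) := by
    have h1 : Tendsto (fun p : ℕ => ((⌊t * 2 ^ p⌋₊ : ℝ≥0) / 2 ^ p : ℝ≥0)) atTop (𝓝 t) := by
      rw [← NNReal.tendsto_coe]
      have h0 := (tendsto_nat_floor_mul_div_atTop (R := ℝ) t.coe_nonneg).comp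
        (tendsto_pow_atTop_atTop_of_one_lt (one_lt_two (α := ℝ)))
      refine h0.congr fun p => ?_
      simp only [Function.comp]
      push_cast
      congr 2
    have h2 := h1.min (tendsto_const_nhds (x := T))
    rwa [min_eq_left htT] at h2
  have h3 : Tendsto (fun p : ℕ => |M (τ p ⌊t * 2 ^ p⌋₊) ω|) atTop (𝓝 |M t ω|) :=
    (hω.abs.tendsto t).comp hlim
  exact absurd (le_of_tendsto h3 (Eventually.of_forall fun p => (hle p _).le)) (not_le.2 ht)

end Maximal

/-! ### Uniform estimates for elementary stochastic integrals. -/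

section ElementaryMaximal

variable {Ω : Type*} [mΩ : MeasurableSpace Ω] {P : Measure Ω} [IsProbabilityMeasure P]
  {r : ℕ} {w : Fin r → ℝ≥0 → Ω → ℝ}

omit [IsProbabilityMeasure P] in
lemma IsStandardBrownianMotion.ae_continuous (hw : IsStandardBrownianMotion P w) :
    ∀ᵐ ω ∂P, ∀ l, Continuous fun t => w l t ω :=
  ae_all_iff.2 fun l => (hw.isBrownianReal l).cont

namespace ElementaryProcess

omit [IsProbabilityMeasure P] in
lemma continuous_integral {ℱ : Filtration ℝ≥0 mΩ} (V : ElementaryProcess P ℱ) {β : ℝ≥0 → Ω → ℝ}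
    {ω : Ω} (h : Continuous fun t => β t ω) : Continuous fun t => V.integral β t ω := by
  refine continuous_finsetSum _ fun k _ => continuous_const.mul (Continuous.sub ?_ ?_)
  · exact h.comp (continuous_const.min continuous_id)
  · exact h.comp (continuous_const.min continuous_id)

variable [P.IsComplete]

/-- The two processes may live on different grids, so their difference is not directly an
`ElementaryProcess`. Both squares are expanded and the polarized isometry is applied to each term.
-/
lemma integral_sub_mul_sub (hw : IsStandardBrownianMotion P w)
    (V W : ElementaryProcess P (augmentedFiltration P w)) (l : Fin r) (T : ℝ≥0) :
    ∫ ω, (V.integral (w l) T ω - W.integral (w l) T ω) *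
        (V.integral (w l) T ω - W.integral (w l) T ω) ∂P =
      ∫ z, (spaceTime V.eval z - spaceTime W.eval z) *
        (spaceTime V.eval z - spaceTime W.eval z) ∂(timeProd P T) := by
  have expand : ∀ {α : Type _} [MeasurableSpace α] (ν : Measure α) (f g : α → ℝ),
      MemLp f 2 ν → MemLp g 2 ν → ∫ x, (f x - g x) * (f x - g x) ∂ν =
        ∫ x, f x * f x ∂ν - 2 * ∫ x, f x * g x ∂ν + ∫ x, g x * g x ∂ν := by
    intro α _ ν f g hf hg
    have i1 : Integrable (fun x => f x * f x - 2 * (f x * g x)) ν :=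
      (hf.integrable_fun_mul hf).sub ((hf.integrable_fun_mul hg).const_mul 2)
    have e : ∀ x, (f x - g x) * (f x - g x) = (f x * f x - 2 * (f x * g x)) + g x * g x :=
      fun x => by ring
    simp_rw [e]
    rw [integral_add i1 (hg.integrable_fun_mul hg), integral_sub (hf.integrable_fun_mul hf)
      ((hf.integrable_fun_mul hg).const_mul 2), integral_const_mul]
  rw [expand P _ _ (V.memLp_integral hw l T) (W.memLp_integral hw l T), expand (timeProd P T) _ _
    (V.memLp_spaceTime_eval T) (W.memLp_spaceTime_eval T), integral_integral_mul_integral hw,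
    integral_integral_mul_integral hw, integral_integral_mul_integral hw, if_pos rfl, if_pos rfl,
    if_pos rfl]

lemma measure_exists_lt_abs_integral_sub_le (hw : IsStandardBrownianMotion P w)
    (V W : ElementaryProcess P (augmentedFiltration P w)) (l : Fin r) {ε : ℝ} (hε : 0 < ε)
    (T : ℝ≥0) :
    P {ω | ∃ t ≤ T, ε < |V.integral (w l) t ω - W.integral (w l) t ω|} ≤
      ENNReal.ofReal ((∫ z, (spaceTime V.eval z - spaceTime W.eval z) *
        (spaceTime V.eval z - spaceTime W.eval z) ∂(timeProd P T)) / ε ^ 2) := by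
  have hV := fun t => V.memLp_integral hw l t
  have hW := fun t => W.memLp_integral hw l t
  refine (measure_exists_lt_abs_le (ℱ := augmentedFiltration P w)
    (M := fun t ω => V.integral (w l) t ω - W.integral (w l) t ω)
    (fun t => (V.measurable_integral hw l t).sub (W.measurable_integral hw l t))
    (fun t => (hV t).sub (hW t)) ?_ ?_ hε T).trans (le_of_eq ?_)
  · intro s t hst Z hZ hZi
    simp only [mul_sub]
    rw [integral_sub (hZi.integrable_fun_mul (hV t)) (hZi.integrable_fun_mul (hW t)),
      integral_sub (hZi.integrable_fun_mul (hV s)) (hZi.integrable_fun_mul (hW s)),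
      V.integral_mul_integral_of_le hw l hst hZ hZi, W.integral_mul_integral_of_le hw l hst hZ hZi]
  · filter_upwards [hw.ae_continuous] with ω hω
    exact (V.continuous_integral (hω l)).sub (W.continuous_integral (hω l))
  · congr 2
    exact integral_sub_mul_sub hw V W l T

end ElementaryProcess

end ElementaryMaximal

/-! ### Dyadic Euler schemes and their mean-square convergence rate. -/

section EulerScheme

variable {Ω : Type*} [mΩ : MeasurableSpace Ω] {r n : ℕ}

/-- The dyadic times `k / 2 ^ N`. -/
noncomputable def dyadic (N k : ℕ) : ℝ≥0 := k / 2 ^ N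

lemma dyadic_mono (N : ℕ) : Monotone (dyadic N) := fun i j hij => by
  unfold dyadic; gcongr

lemma coe_dyadic (N k : ℕ) : (dyadic N k : ℝ) = k / 2 ^ N := by simp [dyadic]

lemma dyadic_succ_sub (N k : ℕ) : (dyadic N (k + 1) : ℝ) - dyadic N k = (1 / 2) ^ N := by
  rw [coe_dyadic, coe_dyadic, ← sub_div]
  simp

lemma dyadic_succ_two_mul (N k : ℕ) : dyadic (N + 1) (2 * k) = dyadic N k := by
  simp only [dyadic]
  push_cast
  rw [pow_succ', mul_div_mul_left _ _ two_ne_zero]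

/-- The values of the Euler scheme of step `2⁻ᴺ`. -/
noncomputable def eulerVal (w : Fin r → ℝ≥0 → Ω → ℝ) (A : Matrix (Fin n) (Fin n) ℝ)
    (C : Fin r → Matrix (Fin n) (Fin n) ℝ) (x : Fin n → ℝ) (N : ℕ) : ℕ → Ω → Fin n → ℝ
  | 0 => fun _ => x
  | k + 1 => fun ω => eulerVal w A C x N k ω +
      eulerIncr w A C (dyadic N k) (dyadic N (k + 1)) ω (eulerVal w A C x N k ω)

variable {P : Measure Ω} {w : Fin r → ℝ≥0 → Ω → ℝ} {A : Matrix (Fin n) (Fin n) ℝ}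
  {C : Fin r → Matrix (Fin n) (Fin n) ℝ} {x : Fin n → ℝ}

variable [IsProbabilityMeasure P] [P.IsComplete]

omit [P.IsComplete] in
lemma sqIntegrableAt_const (x : Fin n → ℝ) (a : ℝ≥0) : SqIntegrableAt P w a (fun _ => x) :=
  fun _ => ⟨measurable_const, memLp_const _⟩

lemma sqIntegrableAt_eulerVal (hw : IsStandardBrownianMotion P w) (N k : ℕ) :
    SqIntegrableAt P w (dyadic N k) (eulerVal w A C x N k) := by
  induction k with
  | zero => exact sqIntegrableAt_const x _
  | succ k ih =>
    exact (ih.mono (dyadic_mono N k.le_succ)).add (ih.eulerIncr hw (dyadic_mono N k.le_succ))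

/-- Discrete Gronwall: one step multiplies the second moment by at most 1 + ch ≤ exp(ch). -/
lemma integral_eulerVal_le (hw : IsStandardBrownianMotion P w) (N k : ℕ) :
    ∫ ω, eulerVal w A C x N k ω ⬝ᵥ eulerVal w A C x N k ω ∂P ≤
      Real.exp ((1 + eulerConst A C) * dyadic N k) * (x ⬝ᵥ x) := by
  induction k with
  | zero => simp [eulerVal, dyadic]
  | succ k ih =>
    have hs := sqIntegrableAt_eulerVal (A := A) (C := C) (x := x) hw N k
    have hδ := dyadic_succ_sub N k
    have h := integral_add_eulerIncr_le (A := A) (C := C) hw (dyadic_mono N k.le_succ)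
      (hδ.le.trans (pow_le_one₀ (by norm_num) (by norm_num))) hs hs
    rw [hδ] at h
    have hc := eulerConst_nonneg (A := A) (C := C)
    refine h.trans ?_
    have e1 : (1 + eulerConst A C) * (dyadic N (k + 1) : ℝ) =
        (1 + eulerConst A C) * (1 / 2) ^ N + (1 + eulerConst A C) * dyadic N k := by
      rw [← hδ]; ring
    rw [e1, Real.exp_add, mul_assoc (Real.exp _)]
    have h1 := Real.add_one_le_exp ((1 + eulerConst A C) * (1 / 2) ^ N)
    have h0 : 0 ≤ ∫ ω, eulerVal w A C x N k ω ⬝ᵥ eulerVal w A C x N k ω ∂P :=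
      integral_nonneg fun ω => dotProduct_self_nonneg_real _
    calc _ = ((1 + eulerConst A C) * (1 / 2) ^ N + 1) *
          ∫ ω, eulerVal w A C x N k ω ⬝ᵥ eulerVal w A C x N k ω ∂P := by ring
      _ ≤ _ := mul_le_mul h1 ih h0 (Real.exp_nonneg _)

/-- One coarse Euler step against two fine ones. -/
lemma integral_euler_two_step_le (hw : IsStandardBrownianMotion P w) {a b c : ℝ≥0} {h m d : ℝ}
    (hab : (b : ℝ) - a = h) (hbc : (c : ℝ) - b = h) (h0 : 0 ≤ h) (h1 : h ≤ 1)
    {Y Z : Ω → Fin n → ℝ} (hY : SqIntegrableAt P w a Y) (hZ : SqIntegrableAt P w a Z)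
    (hm : ∫ ω, Y ω ⬝ᵥ Y ω ∂P ≤ m) (hd : ∫ ω, (Z ω - Y ω) ⬝ᵥ (Z ω - Y ω) ∂P ≤ d) :
    ∫ ω, ((Z ω + eulerIncr w A C a b ω (Z ω)) - Y ω) ⬝ᵥ
        ((Z ω + eulerIncr w A C a b ω (Z ω)) - Y ω) ∂P ≤
      2 * Real.exp ((1 + 2 * eulerConst A C) * h) * d + 2 * eulerConst A C * h * m ∧
    ∫ ω, ((Z ω + eulerIncr w A C a b ω (Z ω) + eulerIncr w A C b c ω
          (Z ω + eulerIncr w A C a b ω (Z ω))) - (Y ω + eulerIncr w A C a c ω (Y ω))) ⬝ᵥ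
        ((Z ω + eulerIncr w A C a b ω (Z ω) + eulerIncr w A C b c ω
          (Z ω + eulerIncr w A C a b ω (Z ω))) - (Y ω + eulerIncr w A C a c ω (Y ω))) ∂P ≤
      Real.exp ((1 + 2 * eulerConst A C) * h) ^ 2 * d + 2 * eulerConst A C ^ 2 * h ^ 2 * m := by
  have hab' : a ≤ b := by rw [← NNReal.coe_le_coe]; linarith
  have hbc' : b ≤ c := by rw [← NNReal.coe_le_coe]; linarith
  set κ := eulerConst A C with hκ
  have hκ0 : 0 ≤ κ := eulerConst_nonneg
  have hD := hZ.sub hY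
  have hdn : 0 ≤ ∫ ω, (Z ω - Y ω) ⬝ᵥ (Z ω - Y ω) ∂P :=
    integral_nonneg fun ω => dotProduct_self_nonneg_real _
  have hd0 : 0 ≤ d := hdn.trans hd
  have hm0 : 0 ≤ m := (integral_nonneg fun ω => dotProduct_self_nonneg_real _).trans hm
  have hE := Real.add_one_le_exp ((1 + 2 * κ) * h)
  have hE0 := Real.exp_pos ((1 + 2 * κ) * h)
  -- the difference after one fine step, the coarse solution being moved along
  have hmid := integral_add_eulerIncr_le (A := A) (C := C) hw hab' (hab.le.trans h1) hD hD
  rw [hab, ← hκ] at hmid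
  set dm := ∫ ω, ((Z ω - Y ω) + eulerIncr w A C a b ω (Z ω - Y ω)) ⬝ᵥ
    ((Z ω - Y ω) + eulerIncr w A C a b ω (Z ω - Y ω)) ∂P with hdm
  have hdm1 : dm ≤ Real.exp ((1 + 2 * κ) * h) * d := by
    have e1 : (1 + h) * d + κ * h * d ≤ ((1 + 2 * κ) * h + 1) * d := by
      have : 0 ≤ κ * h * d := by positivity
      linarith
    have e2 := mul_le_mul_of_nonneg_right hE hd0
    have e3 := mul_le_mul_of_nonneg_left hd (by positivity : 0 ≤ 1 + h)
    have e4 := mul_le_mul_of_nonneg_left hd (by positivity : 0 ≤ κ * h)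
    linarith
  have hincr : ∫ ω, eulerIncr w A C a b ω (Y ω) ⬝ᵥ eulerIncr w A C a b ω (Y ω) ∂P ≤ κ * h * m := by
    have := integral_add_eulerIncr_le (A := A) (C := C) hw hab' (hab.le.trans h1)
      (sqIntegrableAt_const 0 a) hY
    simp only [zero_add, dotProduct_zero, integral_zero, mul_zero, hab, ← hκ] at this
    exact this.trans (mul_le_mul_of_nonneg_left hm (by positivity))
  have hdiff := (hD.mono hab').add (hD.eulerIncr (A := A) (C := C) hw hab')
  have hU : ∫ ω, ((Z ω + eulerIncr w A C a b ω (Z ω)) - Y ω) ⬝ᵥ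
        ((Z ω + eulerIncr w A C a b ω (Z ω)) - Y ω) ∂P ≤ 2 * dm + 2 * (κ * h * m) := by
    have := integral_add_dotProduct_le hdiff (hY.eulerIncr (A := A) (C := C) hw hab')
    refine (le_of_eq ?_).trans (this.trans (by linarith))
    congr 1
    funext ω
    have : Z ω + eulerIncr w A C a b ω (Z ω) - Y ω = Z ω - Y ω +
        eulerIncr w A C a b ω (Z ω - Y ω) + eulerIncr w A C a b ω (Y ω) := by
      rw [eulerIncr_sub]; abel
    rw [this]
  refine ⟨by linarith, ?_⟩
  -- The coarse increment is split at b. On [b, c] only the difference of frozen values drives the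
  -- error; its part due to freezing Y has squared size of order h, and the one-step estimate
  -- contributes another h. The local error is thus of order h².
  have hfin := integral_add_eulerIncr_le (A := A) (C := C) hw hbc' (hbc.le.trans h1) hdiff
    (((hZ.mono hab').add (hZ.eulerIncr (A := A) (C := C) hw hab')).sub (hY.mono hab'))
  rw [hbc, ← hκ, ← hdm] at hfin
  have hdm0 : 0 ≤ dm := integral_nonneg fun ω => dotProduct_self_nonneg_real _
  have e0 : (1 + h) * dm + κ * h * (2 * dm + 2 * (κ * h * m)) ≤
      Real.exp ((1 + 2 * κ) * h) ^ 2 * d + 2 * κ ^ 2 * h ^ 2 * m := by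
    have f1 := mul_le_mul_of_nonneg_right hE hdm0
    have f2 := mul_le_mul_of_nonneg_left hdm1 hE0.le
    nlinarith
  refine (le_of_eq ?_).trans (hfin.trans ((add_le_add_right
    (mul_le_mul_of_nonneg_left hU (by positivity)) _).trans e0))
  congr 1
  funext ω
  have : Z ω + eulerIncr w A C a b ω (Z ω) + eulerIncr w A C b c ω
      (Z ω + eulerIncr w A C a b ω (Z ω)) - (Y ω + eulerIncr w A C a c ω (Y ω)) =
      Z ω - Y ω + eulerIncr w A C a b ω (Z ω - Y ω) +
        eulerIncr w A C b c ω (Z ω + eulerIncr w A C a b ω (Z ω) - Y ω) := by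
    rw [← eulerIncr_add_eulerIncr (a := a) (b := b) (c := c) (v := Y ω), eulerIncr_sub, eulerIncr_sub]
    abel
  rw [this]

/-- Consecutive Euler schemes are mean-square close. -/
lemma exists_integral_eulerVal_sub_le (hw : IsStandardBrownianMotion P w) (T : ℝ≥0) :
    ∃ K, 0 ≤ K ∧ ∀ N j, dyadic (N + 1) j ≤ T →
      ∫ ω, (eulerVal w A C x (N + 1) j ω - eulerVal w A C x N (j / 2) ω) ⬝ᵥ
        (eulerVal w A C x (N + 1) j ω - eulerVal w A C x N (j / 2) ω) ∂P ≤ K * (1 / 2) ^ N := by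
  set κ := eulerConst A C with hκ
  have hκ0 : 0 ≤ κ := eulerConst_nonneg
  set α := 1 + 2 * κ with hα
  set ρ := x ⬝ᵥ x with hρ
  have hρ0 : 0 ≤ ρ := dotProduct_self_nonneg_real x
  set Y := fun N => eulerVal w A C x N with hYdef
  have hsq : ∀ N k, SqIntegrableAt P w (dyadic N k) (Y N k) := fun N k =>
    sqIntegrableAt_eulerVal hw N k
  have hmom : ∀ N k, ∫ ω, Y N k ω ⬝ᵥ Y N k ω ∂P ≤ Real.exp (α * dyadic N k) * ρ := fun N k => by
    refine (integral_eulerVal_le hw N k).trans (mul_le_mul_of_nonneg_right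
      (Real.exp_le_exp.2 (mul_le_mul_of_nonneg_right ?_ (dyadic N k).coe_nonneg)) hρ0)
    rw [hα]; linarith
  have hstep := fun N i => dyadic_succ_sub (N + 1) i
  have hZsq : ∀ N i, SqIntegrableAt P w (dyadic (N + 1) (2 * i)) (Y N i) := fun N i => by
    rw [dyadic_succ_two_mul]; exact hsq N i
  have hcoarse : ∀ N i ω, Y N (i + 1) ω = Y N i ω + eulerIncr w A C (dyadic (N + 1) (2 * i))
      (dyadic (N + 1) (2 * i + 1 + 1)) ω (Y N i ω) := fun N i ω => by
    rw [show 2 * i + 1 + 1 = 2 * (i + 1) by ring, dyadic_succ_two_mul, dyadic_succ_two_mul]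
    rfl
  have hh1 : ∀ N : ℕ, ((1 : ℝ) / 2) ^ N ≤ 1 := fun N => pow_le_one₀ (by norm_num) (by norm_num)
  -- At common grid points the local errors of order h² accumulate linearly in i, up to the
  -- exponential factor. Since ih stays bounded on [0, T], the total is of order h.
  have heven : ∀ N i, ∫ ω, (Y (N + 1) (2 * i) ω - Y N i ω) ⬝ᵥ (Y (N + 1) (2 * i) ω - Y N i ω) ∂P ≤
      i * ((1 / 2) ^ (N + 1)) ^ 2 * (2 * κ ^ 2 * ρ) * Real.exp (α * dyadic N i) := by
    intro N i
    induction i with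
    | zero => simp [hYdef, eulerVal]
    | succ i ih =>
      have h2 := (integral_euler_two_step_le (A := A) (C := C) hw (hstep N (2 * i))
        (hstep N (2 * i + 1)) (by positivity) (hh1 _) (hZsq N i) (hsq (N + 1) (2 * i))
        (hmom N i) ih).2
      have e : ∀ ω, Y (N + 1) (2 * (i + 1)) ω - Y N (i + 1) ω = _ := fun ω =>
        congrArg₂ (· - ·) (rfl : Y (N + 1) (2 * (i + 1)) ω = _) (hcoarse N i ω)
      simp only [e]
      refine h2.trans ?_
      set h : ℝ := (1 / 2) ^ (N + 1) with hh
      have e2 : (dyadic N (i + 1) : ℝ) = dyadic N i + 2 * h := by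
        rw [← sub_eq_iff_eq_add', dyadic_succ_sub, hh, pow_succ]; ring
      have e3 : Real.exp (α * dyadic N (i + 1)) =
          Real.exp (α * h) ^ 2 * Real.exp (α * dyadic N i) := by
        rw [e2, pow_two, ← Real.exp_add, ← Real.exp_add]; congr 1; ring
      rw [e3, ← hκ, ← hα]
      have h1 : 1 ≤ Real.exp (α * h) ^ 2 := one_le_pow₀ (Real.one_le_exp (by positivity))
      have h3 : 0 ≤ h ^ 2 * (2 * κ ^ 2 * ρ) * Real.exp (α * dyadic N i) := by positivity
      push_cast
      nlinarith [mul_le_mul_of_nonneg_right h1 h3]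
  -- The first summand bounds the error at common grid points, enlarged for one further step. The
  -- second is the cost of that extra fine step at odd j, where the coarse value is still frozen at
  -- index j / 2.
  refine ⟨2 * Real.exp α * (T * (2 * κ ^ 2 * ρ) * Real.exp (α * T)) +
    2 * κ * (Real.exp (α * T) * ρ), by positivity, fun N j hj => ?_⟩
  obtain ⟨i, hi | hi⟩ := Nat.even_or_odd' j
  all_goals
    have hiT : (dyadic N i : ℝ) ≤ T := by
      rw [← dyadic_succ_two_mul]
      exact NNReal.coe_le_coe.2 ((dyadic_mono _ (by omega)).trans hj)
    have hexp : Real.exp (α * dyadic N i) ≤ Real.exp (α * T) :=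
      Real.exp_le_exp.2 (mul_le_mul_of_nonneg_left hiT (by positivity))
    have hE1 : 1 ≤ Real.exp α := Real.one_le_exp (by positivity)
    have hev : i * ((1 / 2 : ℝ) ^ (N + 1)) ^ 2 * (2 * κ ^ 2 * ρ) * Real.exp (α * dyadic N i) ≤
        T * (2 * κ ^ 2 * ρ) * Real.exp (α * T) * (1 / 2) ^ N := by
      have e : (i : ℝ) * ((1 / 2 : ℝ) ^ (N + 1)) ^ 2 = dyadic N i * ((1 / 4) * (1 / 2) ^ N) := by
        rw [coe_dyadic, div_eq_mul_one_div (i : ℝ), ← one_div_pow, pow_succ]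
        ring
      rw [e]
      have e1 : (dyadic N i : ℝ) * (1 / 4 * (1 / 2) ^ N) ≤ T * (1 / 2) ^ N := by
        refine mul_le_mul hiT ?_ (by positivity) T.coe_nonneg
        have : (0 : ℝ) ≤ (1 / 2) ^ N := by positivity
        linarith
      calc _ ≤ (T * (1 / 2) ^ N) * (2 * κ ^ 2 * ρ) * Real.exp (α * T) := by gcongr
        _ = _ := by ring
    have hev0 : 0 ≤ T * (2 * κ ^ 2 * ρ) * Real.exp (α * T) * (1 / 2) ^ N := by positivity
    have hlast : 0 ≤ 2 * κ * (Real.exp (α * T) * ρ) * (1 / 2) ^ N := by positivity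
  · rw [hi, Nat.mul_div_cancel_left _ two_pos]
    refine (heven N i).trans (hev.trans ?_)
    have := mul_le_mul_of_nonneg_right hE1 hev0
    nlinarith
  · have h2 := (integral_euler_two_step_le (A := A) (C := C) hw (hstep N (2 * i))
        (hstep N (2 * i + 1)) (by positivity) (hh1 _) (hZsq N i) (hsq (N + 1) (2 * i))
        (hmom N i) ((heven N i).trans hev)).1
    have e : j / 2 = i := by omega
    rw [e, hi]
    refine h2.trans ?_
    rw [← hκ, ← hα]
    have hp : ((1 : ℝ) / 2) ^ (N + 1) ≤ (1 / 2) ^ N := by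
      rw [pow_succ]; have : (0 : ℝ) ≤ (1 / 2) ^ N := by positivity
      linarith
    have g1 : Real.exp (α * (1 / 2) ^ (N + 1)) ≤ Real.exp α :=
      Real.exp_le_exp.2 (mul_le_of_le_one_right (by positivity) (hh1 _))
    calc _ ≤ 2 * Real.exp α * (T * (2 * κ ^ 2 * ρ) * Real.exp (α * T) * (1 / 2) ^ N) +
        2 * κ * (1 / 2) ^ N * (Real.exp (α * T) * ρ) := by gcongr
      _ = _ := by ring

end EulerScheme

/-! ### Dyadic cells. -/

section DyadicCells

variable {N k j : ℕ} {s : ℝ≥0}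

lemma exists_mem_dyadic_cell (N : ℕ) (hs : 0 < s) :
    ∃ k, s ∈ Set.Ioc (dyadic N k) (dyadic N (k + 1)) := by
  obtain ⟨k, hk⟩ : ∃ k, ⌈s * 2 ^ N⌉₊ = k + 1 :=
    Nat.exists_eq_succ_of_ne_zero (Nat.ceil_pos.2 (by positivity)).ne'
  refine ⟨k, ?_, ?_⟩
  · rw [dyadic, div_lt_iff₀ (by positivity)]
    exact Nat.lt_ceil.1 (by omega)
  · rw [dyadic, le_div_iff₀ (by positivity), ← hk]
    exact Nat.le_ceil _

lemma mem_dyadic_cell_half (h : s ∈ Set.Ioc (dyadic (N + 1) j) (dyadic (N + 1) (j + 1))) :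
    s ∈ Set.Ioc (dyadic N (j / 2)) (dyadic N (j / 2 + 1)) := by
  rw [← dyadic_succ_two_mul N (j / 2), ← dyadic_succ_two_mul N (j / 2 + 1)]
  exact ⟨(dyadic_mono _ (by omega)).trans_lt h.1, h.2.trans (dyadic_mono _ (by omega))⟩

/-- The first 4 ^ N cells of length 2⁻ᴺ fill (0, 2 ^ N]; this is the number of cells kept in
`eulerProc`. -/
lemma lt_of_mem_dyadic_cell (h : s ∈ Set.Ioc (dyadic N k) (dyadic N (k + 1))) (hs : s ≤ 2 ^ N) :
    k < 4 ^ N := by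
  have := h.1.trans_le hs
  rw [dyadic, div_lt_iff₀ (by positivity), ← mul_pow] at this
  norm_num at this
  exact_mod_cast this

end DyadicCells

/-! ### Values and time integrals of elementary processes. -/

namespace ElementaryProcess

variable {Ω : Type*} [mΩ : MeasurableSpace Ω] {P : Measure Ω} {ℱ : Filtration ℝ≥0 mΩ}
  (V : ElementaryProcess P ℱ)

lemma eval_of_mem {k : ℕ} {s : ℝ≥0} (hk : k < V.N)
    (hs : s ∈ Set.Ioc (V.time k) (V.time (k + 1))) (ω : Ω) : V.eval s ω = V.coeff k ω := by
  rw [eval, Finset.sum_eq_single k, Set.indicator_of_mem hs]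
  · intro j _ hj
    refine Set.indicator_of_notMem (fun h => ?_) _
    rcases lt_or_gt_of_ne hj with h' | h'
    · exact absurd (hs.1.trans_le (h.2.trans (V.time_mono h'))) (lt_irrefl _)
    · exact absurd (h.1.trans_le (hs.2.trans (V.time_mono h'))) (lt_irrefl _)
  · exact fun h => absurd (Finset.mem_range.2 hk) h

lemma integral_time_succ {k : ℕ} (hk : k < V.N) (β : ℝ≥0 → Ω → ℝ) (ω : Ω) :
    V.integral β (V.time (k + 1)) ω = V.integral β (V.time k) ω +
      V.coeff k ω * (β (V.time (k + 1)) ω - β (V.time k) ω) := by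
  rw [← sub_eq_iff_eq_add', integral, integral, ← Finset.sum_sub_distrib,
    Finset.sum_eq_single k]
  · rw [min_self, min_eq_left (V.time_mono k.le_succ), min_eq_right (V.time_mono k.le_succ),
      min_self]
    ring
  · intro j _ hj
    rcases lt_or_gt_of_ne hj with h' | h'
    · rw [min_eq_left (V.time_mono h'), min_eq_left (V.time_mono h'.le),
        min_eq_left (V.time_mono (by omega)), min_eq_left (V.time_mono (by omega)), sub_self]
    · rw [min_eq_right (V.time_mono (by omega)), min_eq_right (V.time_mono (by omega)),
        min_eq_right (V.time_mono (by omega)), min_eq_right (V.time_mono (by omega))]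
      ring
  · exact fun h => absurd (Finset.mem_range.2 hk) h

/-- The integral against time is a stochastic integral against the deterministic process `t`. -/
lemma setIntegral_eval (t : ℝ≥0) (ω : Ω) :
    ∫ s in Set.Ioc (0 : ℝ) t, V.eval s.toNNReal ω = V.integral (fun t _ => (t : ℝ)) t ω := by
  have e : ∀ s : ℝ, V.eval s.toNNReal ω = ∑ k ∈ Finset.range V.N, V.coeff k ω *
      (Set.Ioc (V.time k : ℝ) (V.time (k + 1))).indicator (fun _ => (1 : ℝ)) s := fun s =>
    V.spaceTime_eval (ω, s)
  simp_rw [e]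
  rw [integral_finsetSum _ fun k _ => ((integrable_const (1 : ℝ)).indicator
    measurableSet_Ioc).const_mul _, integral]
  refine Finset.sum_congr rfl fun k _ => ?_
  rw [integral_const_mul]
  congr 1
  have := integral_indicator_one (μ := volume.restrict (Set.Ioc (0 : ℝ) t))
    (measurableSet_Ioc (a := (V.time k : ℝ)) (b := V.time (k + 1)))
  refine Eq.trans this ?_
  rw [Measure.real, Measure.restrict_apply measurableSet_Ioc, Set.Ioc_inter_Ioc, Real.volume_Ioc,
    ENNReal.toReal_ofReal', sup_of_le_left (V.time k).coe_nonneg]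
  have hk : (V.time k : ℝ) ≤ V.time (k + 1) := V.time_mono k.le_succ
  push_cast
  rcases le_total (V.time k : ℝ) t with h | h
  · rw [min_eq_left h, max_eq_left (sub_nonneg.2 (le_min hk h))]
  · rw [min_eq_right h, min_eq_right (h.trans hk), sub_self, max_eq_right (sub_nonpos.2 h)]

lemma measurable_integral_time (t : ℝ≥0) :
    Measurable[ℱ t] (V.integral (fun t _ => (t : ℝ)) t) := by
  refine Finset.measurable_sum _ fun k _ => ?_
  rcases le_total (V.time k) t with h | h
  · exact ((V.coeff_measurable k).mono (ℱ.mono h) le_rfl).mul_const _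
  · have : (fun ω => V.coeff k ω * (((min (V.time (k + 1)) t : ℝ≥0) : ℝ) -
        ((min (V.time k) t : ℝ≥0) : ℝ))) = fun _ => 0 := by
      funext ω
      rw [min_eq_right h, min_eq_right (h.trans (V.time_mono k.le_succ)), sub_self, mul_zero]
    rw [this]
    exact measurable_const

variable [IsProbabilityMeasure P]

omit [IsProbabilityMeasure P] in
lemma memLp_integral_time (t : ℝ≥0) : MemLp (V.integral (fun t _ => (t : ℝ)) t) 2 P :=
  memLp_finsetSum _ fun k _ => (V.coeff_memLp k).mul_const _

variable {V} (W : ElementaryProcess P ℱ)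

lemma ae_abs_integral_time_sub_le (T : ℝ≥0) :
    ∀ᵐ ω ∂P, ∀ t ≤ T, |V.integral (fun t _ => (t : ℝ)) t ω - W.integral (fun t _ => (t : ℝ)) t ω| ≤
      ∫ s in Set.Ioc (0 : ℝ) T, |V.eval s.toNNReal ω - W.eval s.toNNReal ω| := by
  have hi : ∀ U : ElementaryProcess P ℱ, ∀ᵐ ω ∂P,
      MemLp (fun s : ℝ => U.eval s.toNNReal ω) 2 (volume.restrict (Set.Ioc (0 : ℝ) T)) :=
    fun U => ae_memLp_slice (U.memLp_spaceTime_eval T)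
  filter_upwards [hi V, hi W] with ω h1 h2 t ht
  have i1 := h1.integrable (by norm_num)
  have i2 := h2.integrable (by norm_num)
  have hsub : Set.Ioc (0 : ℝ) t ⊆ Set.Ioc 0 T :=
    Set.Ioc_subset_Ioc_right (NNReal.coe_le_coe.2 ht)
  have hsub' := Measure.restrict_mono hsub (le_refl (volume : Measure ℝ))
  rw [← setIntegral_eval, ← setIntegral_eval, ← integral_sub (i1.mono_measure hsub')
    (i2.mono_measure hsub')]
  refine (abs_integral_le_integral_abs).trans ?_
  exact integral_mono_measure hsub' (Eventually.of_forall fun s => abs_nonneg _) (i1.sub i2).abs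

/-- For the drift no martingale argument is needed: the supremum is at most ∫ |V - W| over (0, T].
Cauchy–Schwarz in time and the Markov inequality finish. -/
lemma measure_exists_lt_abs_integral_time_sub_le {ε : ℝ} (hε : 0 < ε) (T : ℝ≥0) :
    P {ω | ∃ t ≤ T, ε < |V.integral (fun t _ => (t : ℝ)) t ω -
        W.integral (fun t _ => (t : ℝ)) t ω|} ≤
      ENNReal.ofReal ((T * ∫ z, (spaceTime V.eval z - spaceTime W.eval z) *
        (spaceTime V.eval z - spaceTime W.eval z) ∂(timeProd P T)) / ε ^ 2) := by
  have hΦ : MemLp (fun z => |spaceTime V.eval z - spaceTime W.eval z|) 2 (timeProd P T) :=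
    ((V.memLp_spaceTime_eval T).sub (W.memLp_spaceTime_eval T)).abs
  have hsl := integral_sq_integral_slice_le hΦ
  have hm := memLp_integral_slice hΦ
  have hvol : (volume.restrict (Set.Ioc (0 : ℝ) T)).real Set.univ = T := by
    simp [Measure.real]
  simp only [abs_mul_abs_self, hvol] at hsl
  refine (measure_mono_ae (t := {ω | ε ^ 2 ≤
    (∫ s, |spaceTime V.eval (ω, s) - spaceTime W.eval (ω, s)| ∂(volume.restrict (Set.Ioc (0 : ℝ) T)))
    * (∫ s, |spaceTime V.eval (ω, s) - spaceTime W.eval (ω, s)|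
      ∂(volume.restrict (Set.Ioc (0 : ℝ) T)))}) ?_).trans ?_
  · filter_upwards [ae_abs_integral_time_sub_le (V := V) W T] with ω hω
    rintro ⟨t, ht, h⟩
    have := h.le.trans (hω t ht)
    change ε ^ 2 ≤ _
    rw [pow_two]
    exact mul_self_le_mul_self hε.le this
  · have := mul_meas_ge_le_integral_of_nonneg (μ := P)
      (Eventually.of_forall fun ω => mul_self_nonneg _) (hm.integrable_fun_mul hm) (ε ^ 2)
    rw [ENNReal.le_ofReal_iff_toReal_le (measure_ne_top _ _) (div_nonneg
      (mul_nonneg T.coe_nonneg (integral_nonneg fun z => mul_self_nonneg _)) (sq_nonneg ε)),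
      le_div_iff₀ (by positivity), mul_comm]
    exact this.trans hsl

end ElementaryProcess

/-! ### The Euler scheme as a process in continuous time. -/

section EulerProcess

variable {Ω : Type*} [mΩ : MeasurableSpace Ω] {r n : ℕ} {P : Measure Ω} [IsProbabilityMeasure P]
  [P.IsComplete] {w : Fin r → ℝ≥0 → Ω → ℝ}

/-- The `i`-th coordinate of `B Y`, where `Y` is the Euler scheme of step `2⁻ᴺ`, frozen between the
points of the grid, as an elementary process. -/
noncomputable def eulerProc (hw : IsStandardBrownianMotion P w) (A : Matrix (Fin n) (Fin n) ℝ)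
    (C : Fin r → Matrix (Fin n) (Fin n) ℝ) (x : Fin n → ℝ) (B : Matrix (Fin n) (Fin n) ℝ)
    (i : Fin n) (N : ℕ) : ElementaryProcess P (augmentedFiltration P w) where
  N := 4 ^ N
  time := dyadic N
  time_mono := dyadic_mono N
  coeff k ω := (B *ᵥ eulerVal w A C x N k ω) i
  coeff_measurable k := ((sqIntegrableAt_eulerVal hw N k).mulVec B i).1
  coeff_memLp k := ((sqIntegrableAt_eulerVal hw N k).mulVec B i).2

/-- The Euler scheme of step `2⁻ᴺ` in continuous time. -/
noncomputable def eulerPath (hw : IsStandardBrownianMotion P w) (A : Matrix (Fin n) (Fin n) ℝ)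
    (C : Fin r → Matrix (Fin n) (Fin n) ℝ) (x : Fin n → ℝ) (N : ℕ) (t : ℝ≥0) (ω : Ω) (i : Fin n) :
    ℝ :=
  x i + (eulerProc hw A C x A i N).integral (fun t _ => (t : ℝ)) t ω +
    ∑ l, (eulerProc hw A C x (C l) i N).integral (w l) t ω

variable (hw : IsStandardBrownianMotion P w) (A : Matrix (Fin n) (Fin n) ℝ)
  (C : Fin r → Matrix (Fin n) (Fin n) ℝ) (x : Fin n → ℝ)

/-- The stochastic integrals of the frozen coefficients satisfy the Euler recursion cell by cell.
The restriction on k reflects that the frozen processes vanish after time 2 ^ N. -/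
lemma eulerPath_dyadic {N k : ℕ} (hk : k ≤ 4 ^ N) (ω : Ω) :
    eulerPath hw A C x N (dyadic N k) ω = eulerVal w A C x N k ω := by
  induction k with
  | zero =>
    ext i
    have h0 : dyadic N 0 = 0 := by simp [dyadic]
    simp [eulerPath, eulerVal, ElementaryProcess.integral, h0]
  | succ k ih =>
    have ih := congrFun (ih (by omega))
    ext i
    have h1 := (eulerProc hw A C x A i N).integral_time_succ (k := k) hk (fun t _ => (t : ℝ)) ω
    have h2 := fun l => (eulerProc hw A C x (C l) i N).integral_time_succ (k := k) hk (w l) ω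
    simp only [eulerProc] at h1 h2
    have ihi := ih i
    simp only [eulerPath, eulerProc] at ihi ⊢
    rw [h1, Finset.sum_congr rfl fun l _ => h2 l, Finset.sum_add_distrib]
    simp only [eulerVal, Pi.add_apply, eulerIncr_apply]
    rw [← ihi]
    ring

lemma measurable_eulerPath (N : ℕ) (t : ℝ≥0) :
    Measurable[augmentedFiltration P w t] (eulerPath hw A C x N t) := by
  refine @measurable_pi_lambda _ _ _ (_) _ _ fun i => ?_
  exact (measurable_const.add (ElementaryProcess.measurable_integral_time _ t)).add
    (Finset.measurable_sum _ fun l _ => ElementaryProcess.measurable_integral hw _ l t)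

lemma continuous_eulerPath (N : ℕ) {ω : Ω} (hω : ∀ l, Continuous fun t => w l t ω) :
    Continuous fun t => eulerPath hw A C x N t ω := by
  refine continuous_pi fun i => ?_
  exact (continuous_const.add (ElementaryProcess.continuous_integral _ NNReal.continuous_coe)).add
    (continuous_finsetSum _ fun l _ => ElementaryProcess.continuous_integral _ (hω l))

/-- Consecutive Euler schemes are close in the mean square over space-time. -/
lemma exists_integral_eulerProc_sub_le (B : Matrix (Fin n) (Fin n) ℝ) (i : Fin n) (T : ℝ≥0) :
    ∃ K, 0 ≤ K ∧ ∀ N, T ≤ 2 ^ N → ∫ z,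
      (spaceTime (eulerProc hw A C x B i (N + 1)).eval z -
        spaceTime (eulerProc hw A C x B i N).eval z) *
      (spaceTime (eulerProc hw A C x B i (N + 1)).eval z -
        spaceTime (eulerProc hw A C x B i N).eval z) ∂(timeProd P T) ≤ K * (1 / 2) ^ N := by
  obtain ⟨K, hK0, hK⟩ := exists_integral_eulerVal_sub_le (A := A) (C := C) (x := x) hw T
  refine ⟨T * ((∑ i, ∑ j, |(Bᵀ * B) i j|) * K), by positivity, fun N hN => ?_⟩
  set V := eulerProc hw A C x B i
  have hmem : MemLp (fun z => spaceTime (V (N + 1)).eval z - spaceTime (V N).eval z) 2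
      (timeProd P T) := ((V (N + 1)).memLp_spaceTime_eval T).sub ((V N).memLp_spaceTime_eval T)
  have hint := hmem.integrable_fun_mul hmem
  rw [integral_timeProd hint]
  have hbound : ∀ s ∈ Set.Ioc (0 : ℝ) T, ∫ ω,
      (spaceTime (V (N + 1)).eval (ω, s) - spaceTime (V N).eval (ω, s)) *
      (spaceTime (V (N + 1)).eval (ω, s) - spaceTime (V N).eval (ω, s)) ∂P ≤
      (∑ i, ∑ j, |(Bᵀ * B) i j|) * K * (1 / 2) ^ N := by
    intro s hs
    have hs0 : 0 < s.toNNReal := Real.toNNReal_pos.2 hs.1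
    have hsT : s.toNNReal ≤ T := Real.toNNReal_le_iff_le_coe.2 hs.2
    -- A time in the fine cell j lies in the coarse cell j / 2, so both processes are frozen at
    -- values already compared in `exists_integral_eulerVal_sub_le`.
    obtain ⟨j, hj⟩ := exists_mem_dyadic_cell (N + 1) hs0
    have hj4 := lt_of_mem_dyadic_cell hj ((hsT.trans hN).trans
      (pow_le_pow_right₀ one_le_two N.le_succ))
    have hh := mem_dyadic_cell_half hj
    have hh4 := lt_of_mem_dyadic_cell hh (hsT.trans hN)
    simp only [spaceTime, (V (N + 1)).eval_of_mem hj4 hj, (V N).eval_of_mem hh4 hh]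
    have hD := (sqIntegrableAt_eulerVal (A := A) (C := C) (x := x) hw (N + 1) j).sub
      ((sqIntegrableAt_eulerVal (A := A) (C := C) (x := x) hw N (j / 2)).mono
        (by rw [← dyadic_succ_two_mul]; exact dyadic_mono _ (by omega)))
    have hBD := hD.mulVec B
    calc _ ≤ ∫ ω, (∑ i, ∑ j, |(Bᵀ * B) i j|) *
          ((eulerVal w A C x (N + 1) j ω - eulerVal w A C x N (j / 2) ω) ⬝ᵥ
          (eulerVal w A C x (N + 1) j ω - eulerVal w A C x N (j / 2) ω)) ∂P := by
          refine integral_mono_of_nonneg (Eventually.of_forall fun ω => mul_self_nonneg _)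
            (hD.integrable.const_mul _) (Eventually.of_forall fun ω => ?_)
          refine le_trans ?_ (mulVec_dotProduct_self_le _ _)
          simp only [V, eulerProc]
          rw [← Pi.sub_apply, ← Matrix.mulVec_sub]
          exact Finset.single_le_sum (f := fun i =>
            (B *ᵥ (eulerVal w A C x (N + 1) j ω - eulerVal w A C x N (j / 2) ω)) i *
            (B *ᵥ (eulerVal w A C x (N + 1) j ω - eulerVal w A C x N (j / 2) ω)) i)
            (fun i _ => mul_self_nonneg _) (Finset.mem_univ i)
      _ ≤ (∑ i, ∑ j, |(Bᵀ * B) i j|) * (K * (1 / 2) ^ N) := by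
          rw [integral_const_mul]
          exact mul_le_mul_of_nonneg_left (hK N j (hj.1.le.trans hsT)) (by positivity)
      _ = _ := by ring
  calc _ ≤ ∫ s in Set.Ioc (0 : ℝ) T, (∑ i, ∑ j, |(Bᵀ * B) i j|) * K * (1 / 2) ^ N :=
        setIntegral_mono_on hint.integral_prod_right (integrable_const _) measurableSet_Ioc hbound
    _ = _ := by
        rw [setIntegral_const, Measure.real, Real.volume_Ioc, sub_zero,
          ENNReal.toReal_ofReal T.coe_nonneg, smul_eq_mul]
        ring

end EulerProcess

/-! ### Limits under geometric rates. -/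

section Limits

lemma cauchySeq_of_eventually_le_geometric {E : Type*} [PseudoMetricSpace E] {f : ℕ → E}
    {c ρ : ℝ} (hρ : ρ < 1) (h : ∀ᶠ N in atTop, dist (f N) (f (N + 1)) ≤ c * ρ ^ N) :
    CauchySeq f := by
  obtain ⟨N₀, hN₀⟩ := eventually_atTop.1 h
  rw [← cauchySeq_shift N₀]
  refine cauchySeq_of_le_geometric ρ (c * ρ ^ N₀) hρ fun N => ?_
  have := hN₀ (N + N₀) (by omega)
  rw [pow_add] at this
  rw [show N + 1 + N₀ = N + N₀ + 1 by ring]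
  linarith

/-- The geometric bound may start at an index depending on T. Pointwise limits do not depend on T,
and the geometric tail makes the convergence uniform on each [0, T]. -/
lemma exists_tendstoUniformlyOn_of_le_geometric {E : Type*} [MetricSpace E] [CompleteSpace E]
    {f : ℕ → ℝ≥0 → E} {c ρ : ℝ} (hρ0 : 0 ≤ ρ) (hρ : ρ < 1)
    (h : ∀ T : ℕ, ∀ᶠ N in atTop, ∀ t ≤ (T : ℝ≥0), dist (f N t) (f (N + 1) t) ≤ c * ρ ^ N) :
    ∃ g : ℝ≥0 → E, ∀ T : ℝ≥0, TendstoUniformlyOn f g atTop (Set.Iic T) := by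
  have hc : ∀ t, ∃ a, Tendsto (fun N => f N t) atTop (𝓝 a) := by
    intro t
    refine cauchySeq_tendsto_of_complete (cauchySeq_of_eventually_le_geometric (c := c) hρ ?_)
    filter_upwards [h ⌈t⌉₊] with N hN using hN t (Nat.le_ceil t)
  choose g hg using hc
  refine ⟨g, fun T => Metric.tendstoUniformlyOn_iff.2 fun ε hε => ?_⟩
  obtain ⟨N₀, hN₀⟩ := eventually_atTop.1 (h ⌈T⌉₊)
  have hlim : Tendsto (fun N : ℕ => c * ρ ^ N / (1 - ρ)) atTop (𝓝 0) := by
    have := ((tendsto_pow_atTop_nhds_zero_of_lt_one hρ0 hρ).const_mul c).div_const (1 - ρ)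
    simpa using this
  filter_upwards [hlim.eventually_lt_const hε, eventually_ge_atTop N₀] with N hN1 hN2 t ht
  have := dist_le_of_le_geometric_of_tendsto₀ (f := fun k => f (N + k) t) ρ (c * ρ ^ N) hρ
    (fun k => (hN₀ (N + k) (by omega) t (le_trans ht (Nat.le_ceil T))).trans
      (by rw [pow_add, mul_assoc])) ((hg t).comp (tendsto_add_atTop_nat N |>.congr fun k => by
        rw [add_comm]))
  rw [dist_comm]
  exact this.trans_lt hN1

lemma continuous_of_forall_tendstoUniformlyOn_Iic {E : Type*} [UniformSpace E]
    {f : ℕ → ℝ≥0 → E} {g : ℝ≥0 → E} (h : ∀ T : ℝ≥0, TendstoUniformlyOn f g atTop (Set.Iic T))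
    (hf : ∀ N, Continuous (f N)) : Continuous g := by
  refine TendstoLocallyUniformly.continuous (F := f) (p := atTop) (fun u hu t => ?_)
    (Eventually.of_forall hf).frequently
  exact ⟨Set.Iic (t + 1), Iic_mem_nhds (by simp), h (t + 1) u hu⟩

variable {Ω : Type*} [MeasurableSpace Ω] {P : Measure Ω}

/-- Borel–Cantelli. A squared error of order 2⁻ᴺ against the threshold (3/4)ᴺ leaves the ratio
(1/2)/(9/16) = 8/9, which is summable. -/
lemma ae_eventually_notMem_of_le {S : ℕ → Set Ω} {K : ℝ}
    (h : ∀ᶠ N in atTop, P (S N) ≤ ENNReal.ofReal (K * (1 / 2) ^ N / ((3 / 4) ^ N) ^ 2)) :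
    ∀ᵐ ω ∂P, ∀ᶠ N in atTop, ω ∉ S N := by
  obtain ⟨N₀, hN₀⟩ := eventually_atTop.1 h
  have hs : Summable fun N : ℕ => K * (8 / 9 : ℝ) ^ N :=
    (summable_geometric_of_lt_one (by norm_num) (by norm_num)).mul_left K
  have h1 : ∀ᵐ ω ∂P, ∀ᶠ N in atTop, ω ∉ S (N + N₀) := by
    refine ae_eventually_notMem (ne_top_of_le_ne_top
      (((summable_nat_add_iff N₀).2 hs).tsum_ofReal_ne_top) (ENNReal.tsum_le_tsum fun N => ?_))
    refine (hN₀ (N + N₀) (by omega)).trans (ENNReal.ofReal_le_ofReal (le_of_eq ?_))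
    rw [← pow_mul, mul_comm (N + N₀) 2, pow_mul, mul_div_assoc, ← div_pow]
    norm_num
  filter_upwards [h1] with ω hω
  obtain ⟨N₁, hN₁⟩ := eventually_atTop.1 hω
  refine eventually_atTop.2 ⟨N₁ + N₀, fun N hN => ?_⟩
  have := hN₁ (N - N₀) (by omega)
  rwa [Nat.sub_add_cancel (by omega)] at this

end Limits

/-! ### Almost sure convergence of the Euler schemes. -/

section EulerLimit

variable {Ω : Type*} [mΩ : MeasurableSpace Ω] {r n : ℕ} {P : Measure Ω} [IsProbabilityMeasure P]
  [P.IsComplete] {w : Fin r → ℝ≥0 → Ω → ℝ}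

variable (hw : IsStandardBrownianMotion P w) (A : Matrix (Fin n) (Fin n) ℝ)
  (C : Fin r → Matrix (Fin n) (Fin n) ℝ) (x : Fin n → ℝ)

lemma eventually_le_two_pow (T : ℝ≥0) : ∀ᶠ N : ℕ in atTop, T ≤ 2 ^ N :=
  (tendsto_pow_atTop_atTop_of_one_lt (one_lt_two (α := ℝ≥0))).eventually_ge_atTop T

/-- The factor r + 1 counts the drift and the r stochastic integrals, each eventually moving by at
most (3/4)ᴺ. -/
lemma ae_eventually_dist_eulerPath_le : ∀ᵐ ω ∂P, ∀ T : ℕ, ∀ᶠ N in atTop, ∀ t ≤ (T : ℝ≥0),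
    dist (eulerPath hw A C x N t ω) (eulerPath hw A C x (N + 1) t ω) ≤ (r + 1) * (3 / 4) ^ N := by
  have h1 : ∀ (T : ℕ) (i : Fin n), ∀ᵐ ω ∂P, ∀ᶠ N in atTop, ∀ t ≤ (T : ℝ≥0),
      |(eulerProc hw A C x A i (N + 1)).integral (fun t _ => (t : ℝ)) t ω -
        (eulerProc hw A C x A i N).integral (fun t _ => (t : ℝ)) t ω| ≤ (3 / 4) ^ N := by
    intro T i
    obtain ⟨K, hK0, hK⟩ := exists_integral_eulerProc_sub_le hw A C x A i T
    have := ae_eventually_notMem_of_le (P := P) (K := T * K)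
      (S := fun N => {ω | ∃ t ≤ (T : ℝ≥0), (3 / 4 : ℝ) ^ N <
        |(eulerProc hw A C x A i (N + 1)).integral (fun t _ => (t : ℝ)) t ω -
        (eulerProc hw A C x A i N).integral (fun t _ => (t : ℝ)) t ω|}) (by
          filter_upwards [eventually_le_two_pow T] with N hN
          refine (ElementaryProcess.measure_exists_lt_abs_integral_time_sub_le _
            (by positivity) _).trans (ENNReal.ofReal_le_ofReal ?_)
          rw [mul_assoc]
          have := hK N hN
          push_cast
          gcongr)
    filter_upwards [this] with ω hω
    filter_upwards [hω] with N hN t ht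
    by_contra h
    exact hN ⟨t, ht, not_le.1 h⟩
  have h2 : ∀ (T : ℕ) (i : Fin n) (l : Fin r), ∀ᵐ ω ∂P, ∀ᶠ N in atTop, ∀ t ≤ (T : ℝ≥0),
      |(eulerProc hw A C x (C l) i (N + 1)).integral (w l) t ω -
        (eulerProc hw A C x (C l) i N).integral (w l) t ω| ≤ (3 / 4) ^ N := by
    intro T i l
    obtain ⟨K, hK0, hK⟩ := exists_integral_eulerProc_sub_le hw A C x (C l) i T
    have := ae_eventually_notMem_of_le (P := P) (K := K)
      (S := fun N => {ω | ∃ t ≤ (T : ℝ≥0), (3 / 4 : ℝ) ^ N <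
        |(eulerProc hw A C x (C l) i (N + 1)).integral (w l) t ω -
        (eulerProc hw A C x (C l) i N).integral (w l) t ω|}) (by
          filter_upwards [eventually_le_two_pow T] with N hN
          refine (ElementaryProcess.measure_exists_lt_abs_integral_sub_le hw _ _ l
            (by positivity) _).trans (ENNReal.ofReal_le_ofReal ?_)
          have := hK N hN
          gcongr)
    filter_upwards [this] with ω hω
    filter_upwards [hω] with N hN t ht
    by_contra h
    exact hN ⟨t, ht, not_le.1 h⟩
  have h1' := ae_all_iff.2 fun T => ae_all_iff.2 (h1 T)
  have h2' := ae_all_iff.2 fun T => ae_all_iff.2 fun i => ae_all_iff.2 (h2 T i)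
  filter_upwards [h1', h2'] with ω g1 g2 T
  filter_upwards [eventually_all.2 (g1 T), eventually_all.2 fun i => eventually_all.2 (g2 T i)]
    with N k1 k2 t ht
  rw [dist_comm, dist_pi_le_iff (by positivity)]
  intro i
  rw [Real.dist_eq]
  simp only [eulerPath]
  rw [add_sub_add_comm, add_sub_add_left_eq_sub, ← Finset.sum_sub_distrib]
  refine (abs_add_le _ _).trans ?_
  have k3 := (Finset.abs_sum_le_sum_abs (fun l => (eulerProc hw A C x (C l) i (N + 1)).integral
    (w l) t ω - (eulerProc hw A C x (C l) i N).integral (w l) t ω) Finset.univ).trans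
    (Finset.sum_le_sum fun l _ => k2 i l t ht)
  rw [Finset.sum_const, Finset.card_univ, Fintype.card_fin, nsmul_eq_mul] at k3
  linarith [k1 i t ht]

/-- The Euler schemes converge, locally uniformly in time, to an adapted continuous process. -/
lemma exists_tendstoUniformlyOn_eulerPath : ∃ X : ℝ≥0 → Ω → Fin n → ℝ,
    (∀ t, Measurable[augmentedFiltration P w t] (X t)) ∧ (∀ ω, Continuous fun t => X t ω) ∧
    ∀ᵐ ω ∂P, ∀ T : ℝ≥0, TendstoUniformlyOn (fun N t => eulerPath hw A C x N t ω)
      (fun t => X t ω) atTop (Set.Iic T) := by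
  have hgood := (ae_eventually_dist_eulerPath_le hw A C x).and hw.ae_continuous
  obtain ⟨G, hG, hGm, hGnull⟩ : ∃ G : Set Ω, (∀ ω ∈ G, (∀ T : ℕ, ∀ᶠ N in atTop, ∀ t ≤ (T : ℝ≥0),
      dist (eulerPath hw A C x N t ω) (eulerPath hw A C x (N + 1) t ω) ≤ (r + 1) * (3 / 4) ^ N) ∧
      ∀ l, Continuous fun t => w l t ω) ∧ MeasurableSet G ∧ P Gᶜ = 0 := by
    obtain ⟨S, hS, hSm, hS0⟩ := exists_measurable_superset_of_null (ae_iff.1 hgood)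
    refine ⟨Sᶜ, fun ω hω => ?_, hSm.compl, by rwa [compl_compl]⟩
    by_contra h
    exact hω (hS h)
  -- Off the good set the path is put equal to zero, so every path is continuous. Adaptedness
  -- survives because null events belong to the filtration at every time.
  have hex : ∀ ω, ∃ g : ℝ≥0 → Fin n → ℝ, (ω ∈ G → ∀ T : ℝ≥0, TendstoUniformlyOn
      (fun N t => eulerPath hw A C x N t ω) g atTop (Set.Iic T)) ∧ (ω ∉ G → g = 0) := by
    intro ω
    by_cases h : ω ∈ G
    · obtain ⟨g, hg⟩ := exists_tendstoUniformlyOn_of_le_geometric (by norm_num) (by norm_num)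
        (hG ω h).1
      exact ⟨g, fun _ => hg, fun h' => absurd h h'⟩
    · exact ⟨0, fun h' => absurd h' h, fun _ => rfl⟩
  choose g hg1 hg2 using hex
  refine ⟨fun t ω => g ω t, fun t => ?_, fun ω => ?_, ?_⟩
  · have hGt : MeasurableSet[augmentedFiltration P w t] G := by
      have := measurableSet_augmentedFiltration_of_null (w := w) hGm.compl hGnull t
      simpa using this.compl
    refine @measurable_of_tendsto_metrizable Ω _ (augmentedFiltration P w t) _ _ _ _
      (fun N => G.indicator (eulerPath hw A C x N t)) _ (fun N => (measurable_eulerPath hw A C x N t).indicator hGt) (tendsto_pi_nhds.2 fun ω => ?_)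
    by_cases h : ω ∈ G
    · simp only [Set.indicator_of_mem h]
      exact (hg1 ω h t).tendsto_at (Set.mem_Iic.2 le_rfl)
    · simp only [Set.indicator_of_notMem h, hg2 ω h]
      exact tendsto_const_nhds
  · by_cases h : ω ∈ G
    · exact continuous_of_forall_tendstoUniformlyOn_Iic (hg1 ω h)
        fun N => continuous_eulerPath hw A C x N (hG ω h).2
    · have := hg2 ω h
      simp only [this]
      exact continuous_const
  · have : ∀ᵐ ω ∂P, ω ∈ G := hGnull
    filter_upwards [this] with ω hω using hg1 ω hω

end EulerLimit

/-! ### L² limits under geometric rates. -/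

section GeometricLTwo

variable {α : Type*} [MeasurableSpace α] {μ : Measure α}

lemma exists_tendsto_eLpNorm_of_le_geometric {f : ℕ → α → ℝ} (hf : ∀ N, MemLp (f N) 2 μ) {K : ℝ}
    (hK : ∀ᶠ N in atTop, ∫ x, (f (N + 1) x - f N x) * (f (N + 1) x - f N x) ∂μ ≤
      K * (1 / 2) ^ N) :
    ∃ g, MemLp g 2 μ ∧ Tendsto (fun N => eLpNorm (f N - g) 2 μ) atTop (𝓝 0) := by
  have hc : CauchySeq fun N => (hf N).toLp (f N) := by
    refine cauchySeq_of_eventually_le_geometric (c := √K) (ρ := √(1 / 2)) ?_ ?_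
    · rw [Real.sqrt_lt' one_pos]; norm_num
    · filter_upwards [hK] with N hN
      rw [dist_comm, dist_eq_norm, ← MemLp.toLp_sub]
      have h1 := norm_toLp_two_sq ((hf (N + 1)).sub (hf N))
      have h2 : √K * √(1 / 2) ^ N = √(K * (1 / 2) ^ N) := by
        rw [Real.sqrt_mul' _ (by positivity)]
        congr 1
        rw [eq_comm, Real.sqrt_eq_iff_mul_self_eq (by positivity) (by positivity), ← mul_pow,
          Real.mul_self_sqrt (by norm_num)]
      rw [h2]
      exact Real.le_sqrt_of_sq_le (h1.le.trans hN)
  obtain ⟨g, hg⟩ := cauchySeq_tendsto_of_complete hc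
  refine ⟨g, Lp.memLp g, ?_⟩
  rw [← Lp.tendsto_Lp_iff_tendsto_eLpNorm'' f hf _ (Lp.memLp g), Lp.toLp_coeFn]
  exact hg

lemma ae_eq_of_tendsto_eLpNorm_of_ae_tendsto {f : ℕ → α → ℝ} {g g' : α → ℝ}
    (hf : ∀ N, MemLp (f N) 2 μ) (hg : MemLp g 2 μ)
    (h : Tendsto (fun N => eLpNorm (f N - g) 2 μ) atTop (𝓝 0))
    (h' : ∀ᵐ x ∂μ, Tendsto (fun N => f N x) atTop (𝓝 (g' x))) : g =ᵐ[μ] g' := by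
  obtain ⟨ns, hns, hlim⟩ := (tendstoInMeasure_of_tendsto_eLpNorm two_ne_zero
    (fun N => (hf N).1) hg.1 h).exists_seq_tendsto_ae
  filter_upwards [hlim, h'] with x h1 h2
  exact tendsto_nhds_unique h1 (h2.comp hns.tendsto_atTop)

/-- Completeness provides some L² limit, and a subsequence converging almost everywhere identifies
it with the pointwise limit g. -/
lemma memLp_and_tendsto_eLpNorm_of_le_geometric {f : ℕ → α → ℝ} {g : α → ℝ}
    (hf : ∀ N, MemLp (f N) 2 μ) {K : ℝ}
    (hK : ∀ᶠ N in atTop, ∫ x, (f (N + 1) x - f N x) * (f (N + 1) x - f N x) ∂μ ≤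
      K * (1 / 2) ^ N) (h : ∀ᵐ x ∂μ, Tendsto (fun N => f N x) atTop (𝓝 (g x))) :
    MemLp g 2 μ ∧ Tendsto (fun N => eLpNorm (f N - g) 2 μ) atTop (𝓝 0) := by
  obtain ⟨g', hg', hlim⟩ := exists_tendsto_eLpNorm_of_le_geometric hf hK
  have he := ae_eq_of_tendsto_eLpNorm_of_ae_tendsto hf hg' hlim h
  refine ⟨(memLp_congr_ae he).1 hg', hlim.congr fun N => eLpNorm_congr_ae ?_⟩
  filter_upwards [he] with x hx
  simp [hx]

end GeometricLTwo

/-! ### Existence of solutions and the Lyapunov criterion for stability. -/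

section Existence

variable {Ω : Type*} [mΩ : MeasurableSpace Ω] {r n : ℕ} {P : Measure Ω} [IsProbabilityMeasure P]
  {w : Fin r → ℝ≥0 → Ω → ℝ}

lemma isItoIntegral_of_tendsto {ℱ : Filtration ℝ≥0 mΩ} {β φ : ℝ≥0 → Ω → ℝ} {t : ℝ≥0} {I : Ω → ℝ}
    (hI : AEMeasurable I P) (hφ : AEMeasurable (spaceTime φ) (timeProd P t))
    {V : ℕ → ElementaryProcess P ℱ}
    (h1 : Tendsto (fun k => eLpNorm (spaceTime (V k).eval - spaceTime φ) 2 (timeProd P t))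
      atTop (𝓝 0))
    (h2 : Tendsto (fun k => eLpNorm ((V k).integral β t - I) 2 P) atTop (𝓝 0)) :
    IsItoIntegral P ℱ β φ t I := by
  refine ⟨hI, V, ?_, tendsto_eLpNorm_two_iff.1 h2⟩
  refine (tendsto_eLpNorm_two_iff.1 h1).congr fun k => ?_
  rw [lintegral_timeProd]
  · rfl
  · exact (((V k).measurable_spaceTime_eval.aemeasurable.sub hφ).enorm).pow_const 2

/-- Integration over (0, t] is bounded from L² of space-time to L²(P), by Cauchy–Schwarz in time. -/
lemma tendsto_eLpNorm_integral_slice {t : ℝ≥0} {f : ℕ → Ω × ℝ → ℝ} {g : Ω × ℝ → ℝ}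
    (hf : ∀ N, MemLp (f N) 2 (timeProd P t)) (hg : MemLp g 2 (timeProd P t))
    (h : Tendsto (fun N => eLpNorm (f N - g) 2 (timeProd P t)) atTop (𝓝 0)) :
    Tendsto (fun N => eLpNorm ((fun ω => ∫ s in Set.Ioc (0 : ℝ) t, f N (ω, s)) -
      fun ω => ∫ s in Set.Ioc (0 : ℝ) t, g (ω, s)) 2 P) atTop (𝓝 0) := by
  have hd : ∀ N, MemLp (f N - g) 2 (timeProd P t) := fun N => (hf N).sub hg
  have h0 : Tendsto (fun N => ∫ z, (f N - g) z * (f N - g) z ∂(timeProd P t)) atTop (𝓝 0) := by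
    have hz : MemLp (0 : Ω × ℝ → ℝ) 2 (timeProd P t) := MemLp.zero
    have := tendsto_integral_mul_of_tendsto_eLpNorm hd hd hz hz (by simpa using h)
      (by simpa using h)
    simpa using this
  have hs : ∀ N, MemLp (fun ω => ∫ s in Set.Ioc (0 : ℝ) t, (f N - g) (ω, s)) 2 P := fun N =>
    memLp_integral_slice (hd N)
  have h1 : Tendsto (fun N => ∫ ω, (∫ s in Set.Ioc (0 : ℝ) t, (f N - g) (ω, s)) *
      (∫ s in Set.Ioc (0 : ℝ) t, (f N - g) (ω, s)) ∂P) atTop (𝓝 0) := by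
    have h2 := h0.const_mul ((volume.restrict (Set.Ioc (0 : ℝ) t)).real Set.univ)
    rw [mul_zero] at h2
    exact squeeze_zero (fun N => integral_nonneg fun ω => mul_self_nonneg _)
      (fun N => integral_sq_integral_slice_le (hd N)) h2
  refine (tendsto_eLpNorm_of_tendsto_integral_sq hs h1).congr fun N => eLpNorm_congr_ae ?_
  filter_upwards [ae_memLp_slice (hf N), ae_memLp_slice hg] with ω g1 g2
  exact integral_sub (g1.integrable (by norm_num)) (g2.integrable (by norm_num))

variable [P.IsComplete]

/-- Along the Euler schemes the frozen integrands converge. -/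
lemma tendsto_eulerProc_eval (hw : IsStandardBrownianMotion P w) {A : Matrix (Fin n) (Fin n) ℝ}
    {C : Fin r → Matrix (Fin n) (Fin n) ℝ} {x : Fin n → ℝ} (B : Matrix (Fin n) (Fin n) ℝ)
    (i : Fin n) {ω : Ω} {g : ℝ≥0 → Fin n → ℝ} (hg : Continuous g)
    (h : ∀ T : ℝ≥0, TendstoUniformlyOn (fun N t => eulerPath hw A C x N t ω) g atTop (Set.Iic T))
    {s : ℝ≥0} (hs : 0 < s) :
    Tendsto (fun N => (eulerProc hw A C x B i N).eval s ω) atTop (𝓝 ((B *ᵥ g s) i)) := by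
  choose k hk using fun N => exists_mem_dyadic_cell N hs
  have hτ : Tendsto (fun N => dyadic N (k N)) atTop (𝓝 s) := by
    rw [← NNReal.tendsto_coe]
    have h1 : Tendsto (fun N : ℕ => (s : ℝ) - (1 / 2) ^ N) atTop (𝓝 s) := by
      have := (tendsto_pow_atTop_nhds_zero_of_lt_one (r := (1 / 2 : ℝ)) (by norm_num)
        (by norm_num)).const_sub (s : ℝ)
      rwa [sub_zero] at this
    refine tendsto_of_tendsto_of_tendsto_of_le_of_le h1 tendsto_const_nhds (fun N => ?_)
      fun N => NNReal.coe_le_coe.2 (hk N).1.le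
    have h2 := NNReal.coe_le_coe.2 (hk N).2
    have h3 := dyadic_succ_sub N (k N)
    simp only
    linarith
  have hlim := (h s).tendsto_comp hg.continuousAt.continuousWithinAt
    (tendsto_nhdsWithin_iff.2 ⟨hτ, Eventually.of_forall fun N => Set.mem_Iic.2 (hk N).1.le⟩)
  have hB : Continuous fun v : Fin n → ℝ => (B *ᵥ v) i :=
    (continuous_apply i).comp (continuous_const.matrix_mulVec continuous_id)
  refine ((hB.tendsto _).comp hlim).congr' ?_
  filter_upwards [eventually_le_two_pow s] with N hN
  have hkN := lt_of_mem_dyadic_cell (hk N) hN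
  rw [ElementaryProcess.eval_of_mem _ hkN (hk N)]
  simp only [Function.comp, eulerPath_dyadic hw A C x hkN.le]
  rfl

/-- Every linear stochastic differential equation has a solution. -/
theorem exists_isSDESolution (hw : IsStandardBrownianMotion P w) (A : Matrix (Fin n) (Fin n) ℝ)
    (C : Fin r → Matrix (Fin n) (Fin n) ℝ) (x : Fin n → ℝ) :
    ∃ X : ℝ≥0 → Ω → Fin n → ℝ, IsSDESolution P w A C x X := by
  obtain ⟨X, hXm, hXc, hX⟩ := exists_tendstoUniformlyOn_eulerPath hw A C x
  have hprog : IsProgressive (augmentedFiltration P w) X :=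
    (StronglyAdapted.isStronglyProgressive_of_continuous
      (fun t => (hXm t).stronglyMeasurable) hXc).isProgressive
  have hmul : ∀ (B : Matrix (Fin n) (Fin n) ℝ) (i : Fin n) (t : ℝ≥0),
      MemLp (spaceTime fun s ω => (B *ᵥ X s ω) i) 2 (timeProd P t) ∧
      Tendsto (fun N => eLpNorm (spaceTime (eulerProc hw A C x B i N).eval -
        spaceTime fun s ω => (B *ᵥ X s ω) i) 2 (timeProd P t)) atTop (𝓝 0) := by
    intro B i t
    obtain ⟨K, -, hK⟩ := exists_integral_eulerProc_sub_le hw A C x B i t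
    refine memLp_and_tendsto_eLpNorm_of_le_geometric (K := K)
      (fun N => (eulerProc hw A C x B i N).memLp_spaceTime_eval t) ?_ ?_
    · filter_upwards [eventually_le_two_pow t] with N hN using hK N hN
    · have h1 : ∀ᵐ z ∂(timeProd P t), ∀ T : ℝ≥0, TendstoUniformlyOn
          (fun N t => eulerPath hw A C x N t z.1) (fun t => X t z.1) atTop (Set.Iic T) :=
        Measure.quasiMeasurePreserving_fst.ae hX
      have h2 : ∀ᵐ z ∂(timeProd P t), z.2 ∈ Set.Ioc (0 : ℝ) t :=
        Measure.quasiMeasurePreserving_snd.ae (ae_restrict_mem measurableSet_Ioc)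
      filter_upwards [h1, h2] with z hz1 hz2
      exact tendsto_eulerProc_eval hw B i (hXc z.1) hz1 (Real.toNNReal_pos.2 hz2.1)
  -- The isometry transports the space-time rate of the integrands to their stochastic integrals,
  -- whose limits serve as the Itô integrals in the equation.
  have hint : ∀ (l : Fin r) (i : Fin n) (t : ℝ≥0), ∃ I, MemLp I 2 P ∧
      Tendsto (fun N => eLpNorm ((eulerProc hw A C x (C l) i N).integral (w l) t - I) 2 P) atTop
        (𝓝 0) := by
    intro l i t
    obtain ⟨K, -, hK⟩ := exists_integral_eulerProc_sub_le hw A C x (C l) i t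
    refine exists_tendsto_eLpNorm_of_le_geometric (K := K)
      (fun N => (eulerProc hw A C x (C l) i N).memLp_integral hw l t) ?_
    filter_upwards [eventually_le_two_pow t] with N hN
    rw [ElementaryProcess.integral_sub_mul_sub hw]
    exact hK N hN
  refine ⟨X, hprog, Eventually.of_forall hXc, fun T => ?_, fun t => ?_⟩
  · have hm : MemLp (spaceTime X) 2 (timeProd P T) := by
      rw [memLp_pi_iff]
      intro i
      have := (hmul 1 i T).1
      simp only [Matrix.one_mulVec] at this
      exact this
    have h2 := eLpNorm_nnreal_pow_eq_lintegral (μ := timeProd P T) (f := spaceTime X) (p := 2)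
      (by norm_num)
    rw [show ((2 : ℝ≥0) : ℝ≥0∞) = 2 by norm_num] at h2
    simp only [NNReal.coe_ofNat, ENNReal.rpow_ofNat] at h2
    rw [lintegral_timeProd (hm.1.enorm.pow_const 2)] at h2
    exact h2.symm ▸ ENNReal.pow_lt_top hm.2
  · choose I hI hI' using hint
    refine ⟨fun l i => I l i t, fun l i => isItoIntegral_of_tendsto (hI l i t).1.aemeasurable
      (hmul (C l) i t).1.1.aemeasurable (hmul (C l) i t).2 (hI' l i t), ae_all_iff.2 fun i => ?_⟩
    set D : Ω → ℝ := fun ω => ∫ s in Set.Ioc (0 : ℝ) t,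
      (spaceTime fun s ω => (A *ᵥ X s ω) i) (ω, s) with hD
    have hDm : MemLp D 2 P := memLp_integral_slice (hmul A i t).1
    have hdrift := tendsto_eLpNorm_integral_slice
      (fun N => (eulerProc hw A C x A i N).memLp_spaceTime_eval t) (hmul A i t).1 (hmul A i t).2
    have hdrift' : Tendsto (fun N => eLpNorm ((eulerProc hw A C x A i N).integral
        (fun t _ => (t : ℝ)) t - D) 2 P) atTop (𝓝 0) := by
      refine hdrift.congr fun N => ?_
      congr 2
      funext ω
      exact (eulerProc hw A C x A i N).setIntegral_eval t ω
    have hpath : ∀ N, MemLp (fun ω => eulerPath hw A C x N t ω i) 2 P := fun N =>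
      ((memLp_const (x i)).add (ElementaryProcess.memLp_integral_time _ t)).add
        (memLp_finsetSum _ fun l _ => ElementaryProcess.memLp_integral hw _ l t)
    have hR : MemLp (fun ω => x i + D ω + ∑ l, I l i t ω) 2 P :=
      ((memLp_const (x i)).add hDm).add (memLp_finsetSum _ fun l _ => hI l i t)
    have hlim : Tendsto (fun N => eLpNorm ((fun ω => eulerPath hw A C x N t ω i) -
        fun ω => x i + D ω + ∑ l, I l i t ω) 2 P) atTop (𝓝 0) := by
      have h0 := hdrift'.add (tendsto_finsetSum Finset.univ fun l _ => hI' l i t)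
      rw [Finset.sum_const_zero, add_zero] at h0
      refine tendsto_of_tendsto_of_tendsto_of_le_of_le tendsto_const_nhds h0
        (fun N => zero_le) fun N => ?_
      have e : ((fun ω => eulerPath hw A C x N t ω i) - fun ω => x i + D ω + ∑ l, I l i t ω) =
          ((eulerProc hw A C x A i N).integral (fun t _ => (t : ℝ)) t - D) +
          ∑ l, ((eulerProc hw A C x (C l) i N).integral (w l) t - I l i t) := by
        funext ω
        simp only [Pi.sub_apply, Pi.add_apply, Finset.sum_apply, eulerPath,
          Finset.sum_sub_distrib]
        ring
      have m1 := ((eulerProc hw A C x A i N).memLp_integral_time t).sub hDm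
      have m2 := fun l => ((eulerProc hw A C x (C l) i N).memLp_integral hw l t).sub (hI l i t)
      simp only [e]
      refine (eLpNorm_add_le m1.1 (memLp_finsetSum' _ fun l _ => m2 l).1 one_le_two).trans ?_
      exact add_le_add le_rfl (eLpNorm_sum_le (fun l _ => (m2 l).1) one_le_two)
    have hae : ∀ᵐ ω ∂P, Tendsto (fun N => eulerPath hw A C x N t ω i) atTop (𝓝 (X t ω i)) := by
      filter_upwards [hX] with ω hω
      exact (tendsto_pi_nhds.1 ((hω t).tendsto_at (Set.mem_Iic.2 le_rfl))) i
    -- The same Euler paths converge in L² to the right side of the equation and almost surely to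
    -- X(t); this identification is the equation.
    filter_upwards [ae_eq_of_tendsto_eLpNorm_of_ae_tendsto hpath hR hlim hae] with ω hω
    rw [← hω, hD, intervalIntegral.integral_of_le t.coe_nonneg]
    rfl

/-- A system is mean-square stable exactly when it has a quadratic Lyapunov function. -/
theorem isMeanSquareStable_iff_isLyapunovStable (hw : IsStandardBrownianMotion P w)
    {A : Matrix (Fin n) (Fin n) ℝ} {C : Fin r → Matrix (Fin n) (Fin n) ℝ} :
    IsMeanSquareStable P w A C ↔ IsLyapunovStable A C := by
  refine ⟨fun h => h.isLyapunovStable hw, fun h x => ?_⟩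
  obtain ⟨X, hX⟩ := exists_isSDESolution hw A C x
  exact ⟨X, hX, hX.tendsto_of_isLyapunovStable hw h⟩

end Existence

/-! ### Positivity and solvability of the Lyapunov equation. -/

section LyapunovPositivity

variable {r n : ℕ} {A : Matrix (Fin n) (Fin n) ℝ} {C : Fin r → Matrix (Fin n) (Fin n) ℝ}
  {M : Matrix (Fin n) (Fin n) ℝ}

lemma quadForm_transpose_mul_mul {m k : Type*} [Fintype m] [Fintype k] (B : Matrix m k ℝ)
    (M : Matrix m m ℝ) (x : k → ℝ) :
    x ⬝ᵥ ((Bᵀ * M * B) *ᵥ x) = (B *ᵥ x) ⬝ᵥ (M *ᵥ (B *ᵥ x)) := by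
  rw [← Matrix.mulVec_mulVec, ← Matrix.mulVec_mulVec, Matrix.dotProduct_mulVec,
    Matrix.vecMul_transpose]

/-- In this form the drift enters only through Mx. On the kernel of M only the noise terms remain,
and the values at x depend on A and C_l only through Ax and C_l x. -/
lemma quadForm_lyapOp (hM : M.IsSymm) (x : Fin n → ℝ) :
    x ⬝ᵥ (lyapOp A C M *ᵥ x) = 2 * ((M *ᵥ x) ⬝ᵥ (A *ᵥ x)) +
      ∑ l, (C l *ᵥ x) ⬝ᵥ (M *ᵥ (C l *ᵥ x)) := by
  have h1 : x ⬝ᵥ ((M * A) *ᵥ x) = (M *ᵥ x) ⬝ᵥ (A *ᵥ x) := by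
    rw [← Matrix.mulVec_mulVec, Matrix.dotProduct_mulVec, ← Matrix.mulVec_transpose, hM.eq]
  have h2 : x ⬝ᵥ ((Aᵀ * M) *ᵥ x) = (M *ᵥ x) ⬝ᵥ (A *ᵥ x) := by
    rw [← Matrix.mulVec_mulVec, Matrix.dotProduct_mulVec, Matrix.vecMul_transpose,
      dotProduct_comm]
  rw [lyapOp, Matrix.add_mulVec, Matrix.add_mulVec, dotProduct_add, dotProduct_add, h1, h2,
    Matrix.sum_mulVec, dotProduct_sum]
  simp only [quadForm_transpose_mul_mul]
  ring

lemma quadForm_pos_of_sphere (h : ∀ x : Fin n → ℝ, x ⬝ᵥ x = 1 → 0 < x ⬝ᵥ (M *ᵥ x))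
    {x : Fin n → ℝ} (hx : x ≠ 0) : 0 < x ⬝ᵥ (M *ᵥ x) := by
  have hp := dotProduct_self_pos_of_ne_zero hx
  set a := (Real.sqrt (x ⬝ᵥ x))⁻¹ with ha
  have h1 := h (a • x) (by
    rw [smul_dotProduct, dotProduct_smul, smul_eq_mul, smul_eq_mul, ← mul_assoc, ← pow_two, ha,
      inv_pow, Real.sq_sqrt hp.le, inv_mul_cancel₀ hp.ne'])
  rw [quadForm_smul] at h1
  exact pos_of_mul_pos_right h1 (sq_nonneg a)

/-- Positivity of the inverse of the Lyapunov operator of a stable system. -/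
lemma IsLyapunovStable.posSemidef (hs : IsLyapunovStable A C) (hM : M.IsSymm)
    (h : ∀ x, x ⬝ᵥ (lyapOp A C M *ᵥ x) ≤ 0) : M.PosSemidef := by
  obtain ⟨H, hH, hL⟩ := hs
  rw [posDef_iff_real] at hH hL
  by_contra hn
  have hneg : ∃ u : Fin n → ℝ, u ⬝ᵥ u = 1 ∧ u ⬝ᵥ (M *ᵥ u) < 0 := by
    by_contra! hc
    refine hn (posSemidef_iff_real.2 ⟨hM, fun x => ?_⟩)
    simpa using forall_mul_le_quadForm hc x
  obtain ⟨u, hu, huM⟩ := hneg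
  have hHpos : ∀ x : Fin n → ℝ, x ⬝ᵥ x = 1 → 0 < x ⬝ᵥ (H *ᵥ x) := fun x hx =>
    hH.2 x (by rintro rfl; simp at hx)
  -- The maximum s of -M/H on the sphere is the least shift for which M + sH ⪰ 0. The maximizer v
  -- then lies in the kernel of M + sH.
  obtain ⟨v, hv, hmax⟩ := isCompact_dotProduct_self_eq_one.exists_isMaxOn ⟨u, hu⟩
    (f := fun x : Fin n → ℝ => -(x ⬝ᵥ (M *ᵥ x)) / (x ⬝ᵥ (H *ᵥ x)))
    ((continuous_quadForm M).neg.continuousOn.div (continuous_quadForm H).continuousOn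
      fun x hx => (hHpos x hx).ne')
  set s := -(v ⬝ᵥ (M *ᵥ v)) / (v ⬝ᵥ (H *ᵥ v)) with hsdef
  have hs0 : 0 < s := (div_pos (neg_pos.2 huM) (hHpos u hu)).trans_le (hmax hu)
  have hq : ∀ x, x ⬝ᵥ ((M + s • H) *ᵥ x) = x ⬝ᵥ (M *ᵥ x) + s * (x ⬝ᵥ (H *ᵥ x)) := fun x => by
    rw [Matrix.add_mulVec, dotProduct_add, Matrix.smul_mulVec, dotProduct_smul, smul_eq_mul]
  have hNs : (M + s • H).IsSymm := hM.add (hH.1.smul s)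
  have hN : (M + s • H).PosSemidef := by
    refine posSemidef_iff_real.2 ⟨hNs, fun x => ?_⟩
    refine (by simp : (0 : ℝ) = 0 * (x ⬝ᵥ x)).trans_le (forall_mul_le_quadForm (fun y hy => ?_) x)
    have := hmax hy
    simp only [Set.mem_ofPred_eq] at this
    rw [div_le_iff₀ (hHpos y hy)] at this
    rw [hq]
    linarith
  have hv0 : v ⬝ᵥ ((M + s • H) *ᵥ v) = 0 := by
    rw [hq, hsdef, div_mul_cancel₀ _ (hHpos v hv).ne']
    ring
  have hNv : (M + s • H) *ᵥ v = 0 := by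
    have := (hN.dotProduct_mulVec_zero_iff v).1 (by simpa using hv0)
    exact this
  -- At a kernel vector the drift contribution vanishes and the noise terms are nonnegative. This
  -- contradicts L(M) ⪯ 0 and sL(H) ≺ 0.
  have h1 : 0 ≤ v ⬝ᵥ (lyapOp A C (M + s • H) *ᵥ v) := by
    rw [quadForm_lyapOp hNs, hNv, zero_dotProduct, mul_zero, zero_add]
    exact Finset.sum_nonneg fun l _ => (posSemidef_iff_real.1 hN).2 _
  rw [lyapOp_add, lyapOp_smul, Matrix.add_mulVec, dotProduct_add, Matrix.smul_mulVec,
    dotProduct_smul, smul_eq_mul] at h1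
  have h2 := hL.2 v (by rintro rfl; simp at hv)
  rw [Matrix.neg_mulVec, dotProduct_neg] at h2
  have h3 := mul_pos hs0 h2
  linarith [h v]

lemma eq_zero_of_posSemidef_neg (h1 : M.PosSemidef) (h2 : (-M).PosSemidef) : M = 0 := by
  have h0 : ∀ x, M *ᵥ x = 0 := fun x => by
    refine (h1.dotProduct_mulVec_zero_iff x).1 ?_
    have g1 := (posSemidef_iff_real.1 h1).2 x
    have g2 := (posSemidef_iff_real.1 h2).2 x
    rw [Matrix.neg_mulVec, dotProduct_neg] at g2
    simpa using le_antisymm (by linarith) g1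
  ext i j
  have := congrFun (h0 (Pi.single j 1)) i
  simpa using this

/-- The symmetric matrices. -/
def symmSubmodule (n : ℕ) : Submodule ℝ (Matrix (Fin n) (Fin n) ℝ) where
  carrier := {M | M.IsSymm}
  add_mem' h1 h2 := Matrix.IsSymm.add h1 h2
  zero_mem' := Matrix.isSymm_zero
  smul_mem' c _ h := Matrix.IsSymm.smul h c

lemma isSymm_lyapOp (hM : M.IsSymm) : (lyapOp A C M).IsSymm := by
  rw [Matrix.IsSymm, transpose_lyapOp, hM.eq]

/-- The Lyapunov equation of a stable system is solvable. -/
lemma IsLyapunovStable.exists_lyapOp_eq (hs : IsLyapunovStable A C)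
    {S : Matrix (Fin n) (Fin n) ℝ} (hS : S.IsSymm) : ∃ M, M.IsSymm ∧ lyapOp A C M = S := by
  let f : symmSubmodule n →ₗ[ℝ] symmSubmodule n :=
    (lyapLinear A C).restrict fun M (hM : M.IsSymm) => isSymm_lyapOp hM
  -- Positivity applied to M and to -M makes the operator injective on symmetric matrices, hence
  -- surjective by finite dimension.
  have hf : Function.Injective f := by
    refine (injective_iff_map_eq_zero f).2 fun ⟨M, hM⟩ h => ?_
    have h0 : lyapOp A C M = 0 := congrArg Subtype.val h
    have h1 := hs.posSemidef hM fun x => by simp [h0]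
    have h2 := hs.posSemidef (Matrix.IsSymm.neg hM) fun x => by simp [lyapOp_neg, h0]
    exact Subtype.ext (eq_zero_of_posSemidef_neg h1 h2)
  obtain ⟨⟨M, hM⟩, h⟩ := LinearMap.injective_iff_surjective.1 hf ⟨S, hS⟩
  exact ⟨M, hM, congrArg Subtype.val h⟩

/-- Finsler's lemma on a compact set. -/
lemma exists_nat_forall_pos_add_mul {X : Type*} [TopologicalSpace X] {K : Set X}
    (hK : IsCompact K) {f g : X → ℝ} (hf : Continuous f) (hg : Continuous g) (hg0 : ∀ x, 0 ≤ g x)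
    (h : ∀ x ∈ K, g x = 0 → 0 < f x) : ∃ c : ℕ, ∀ x ∈ K, 0 < f x + c * g x := by
  -- The sets where c works are open and increase with c, since g ≥ 0. They cover K, so by
  -- compactness a single one does.
  have hmono : Monotone fun c : ℕ => {x | 0 < f x + c * g x} := by
    intro c c' hcc x hx
    have : (c : ℝ) * g x ≤ c' * g x :=
      mul_le_mul_of_nonneg_right (Nat.cast_le.2 hcc) (hg0 x)
    simp only [Set.mem_ofPred_eq] at hx ⊢
    linarith
  obtain ⟨c, hc⟩ := hK.elim_directed_cover (fun c : ℕ => {x | 0 < f x + c * g x})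
    (fun c => isOpen_lt continuous_const (hf.add (continuous_const.mul hg)))
    (fun x hx => by
      rcases (hg0 x).eq_or_lt with h0 | h0
      · exact Set.mem_iUnion.2 ⟨0, by simpa using h x hx h0.symm⟩
      · obtain ⟨c, hc⟩ := exists_nat_gt (-f x / g x)
        rw [div_lt_iff₀ h0] at hc
        exact Set.mem_iUnion.2 ⟨c, by simp only [Set.mem_ofPred_eq]; linarith⟩)
    hmono.directed_le
  exact ⟨c, fun x hx => hc hx⟩

end LyapunovPositivity

/-! ### Completion of the square, detectability and policy iteration. -/

namespace RiccatiData

variable {n m r : ℕ} (d : RiccatiData n m r) {P : Matrix (Fin n) (Fin n) ℝ}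
  {K : Matrix (Fin m) (Fin n) ℝ}

/-- The Lyapunov operator of the system closed by the feedback gain `K`. -/
def closedLyap (K : Matrix (Fin m) (Fin n) ℝ) (P : Matrix (Fin n) (Fin n) ℝ) :
    Matrix (Fin n) (Fin n) ℝ :=
  lyapOp (d.A + d.B * K) (fun l => d.C l + d.D l * K) P

/-- The cost rate `Q + Kᵀ R K` of the feedback gain `K`. -/
def costRate (K : Matrix (Fin m) (Fin n) ℝ) : Matrix (Fin n) (Fin n) ℝ :=
  d.Q + Kᵀ * d.R * K

/-- The left-hand side of the algebraic Riccati equation. -/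
noncomputable def riccati (P : Matrix (Fin n) (Fin n) ℝ) : Matrix (Fin n) (Fin n) ℝ :=
  d.stateBlock P - (d.crossBlock P)ᵀ * (d.controlBlock P)⁻¹ * d.crossBlock P

/-- The gain `K` stabilizes in the sense of Lyapunov. -/
def IsLyapunovStabilizer (K : Matrix (Fin m) (Fin n) ℝ) : Prop :=
  IsLyapunovStable (d.A + d.B * K) (fun l => d.C l + d.D l * K)

lemma closedLyap_add_costRate (hP : P.IsSymm) :
    d.closedLyap K P + d.costRate K = d.stateBlock P + Kᵀ * d.crossBlock P +
      (d.crossBlock P)ᵀ * K + Kᵀ * d.controlBlock P * K := by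
  simp only [closedLyap, lyapOp, costRate, stateBlock, crossBlock, controlBlock,
    Finset.sum_add_distrib, Matrix.transpose_add, Matrix.transpose_mul, Matrix.transpose_sum,
    Matrix.transpose_transpose, hP.eq, Matrix.add_mul, Matrix.mul_add, Matrix.mul_assoc,
    Matrix.sum_mul, Matrix.mul_sum]
  abel

lemma isSymm_controlBlock (hR : d.R.IsSymm) (hP : P.IsSymm) : (d.controlBlock P).IsSymm := by
  simp only [Matrix.IsSymm, controlBlock, Matrix.transpose_add, Matrix.transpose_sum,
    Matrix.transpose_mul, Matrix.transpose_transpose, hR.eq, hP.eq, Matrix.mul_assoc]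

/-- Completion of the square. -/
lemma closedLyap_add_costRate_eq (hR : d.R.IsSymm) (hP : P.IsSymm)
    (hu : IsUnit (d.controlBlock P)) :
    d.closedLyap K P + d.costRate K =
      (K - d.gain P)ᵀ * d.controlBlock P * (K - d.gain P) + d.riccati P := by
  have hdet := (Matrix.isUnit_iff_isUnit_det _).1 hu
  have hS : d.crossBlock P = -(d.controlBlock P * d.gain P) := by
    rw [gain, Matrix.mul_neg, neg_neg, Matrix.mul_nonsing_inv_cancel_left _ _ hdet]
  have hsymm := d.isSymm_controlBlock hR hP
  have h1 : (d.controlBlock P)⁻¹ * d.crossBlock P = -d.gain P := by rw [gain, neg_neg]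
  rw [d.closedLyap_add_costRate hP, riccati, Matrix.mul_assoc (d.crossBlock P)ᵀ, h1, hS]
  simp only [Matrix.transpose_neg, Matrix.transpose_mul, Matrix.transpose_sub, hsymm.eq,
    Matrix.sub_mul, Matrix.mul_sub, Matrix.neg_mul, Matrix.mul_neg, Matrix.mul_assoc]
  abel

lemma posDef_controlBlock (hR : d.R.PosDef) (hP : P.PosSemidef) : (d.controlBlock P).PosDef := by
  refine hR.add_posSemidef (posSemidef_iff_real.2 ⟨?_, fun x => ?_⟩)
  · have := (posSemidef_iff_real.1 hP).1
    simp only [Matrix.IsSymm, Matrix.transpose_sum, Matrix.transpose_mul,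
      Matrix.transpose_transpose, this.eq, Matrix.mul_assoc]
  · rw [Matrix.sum_mulVec, dotProduct_sum]
    refine Finset.sum_nonneg fun l _ => ?_
    rw [quadForm_transpose_mul_mul]
    exact (posSemidef_iff_real.1 hP).2 _

lemma isSymm_costRate (hQ : d.Q.IsSymm) (hR : d.R.IsSymm) : (d.costRate K).IsSymm := by
  simp only [Matrix.IsSymm, costRate, Matrix.transpose_add, Matrix.transpose_mul,
    Matrix.transpose_transpose, hQ.eq, hR.eq, Matrix.mul_assoc]

lemma quadForm_costRate (x : Fin n → ℝ) : x ⬝ᵥ (d.costRate K *ᵥ x) =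
    x ⬝ᵥ (d.Q *ᵥ x) + (K *ᵥ x) ⬝ᵥ (d.R *ᵥ (K *ᵥ x)) := by
  rw [costRate, Matrix.add_mulVec, dotProduct_add, quadForm_transpose_mul_mul]

lemma quadForm_costRate_nonneg (hQ : d.Q.PosSemidef) (hR : d.R.PosDef) (x : Fin n → ℝ) :
    0 ≤ x ⬝ᵥ (d.costRate K *ᵥ x) := by
  rw [quadForm_costRate]
  exact add_nonneg ((posSemidef_iff_real.1 hQ).2 x) ((posSemidef_iff_real.1 hR.posSemidef).2 _)

/-- The output injection hypothesis in Lyapunov form: `Q` is the square of an output that makes the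
uncontrolled system detectable. -/
def IsLyapunovDetectable : Prop :=
  ∃ (q : ℕ) (E₀ : Matrix (Fin q) (Fin n) ℝ) (E : Fin r → Matrix (Fin q) (Fin n) ℝ)
    (Θ : Matrix (Fin n) (Fin q) ℝ), E₀ᵀ * E₀ + ∑ l, (E l)ᵀ * E l = d.Q ∧
    IsLyapunovStable (d.A + Θ * E₀) (fun l => d.C l + Θ * E l)

lemma quadForm_transpose_mul_self {k j : Type*} [Fintype k] [Fintype j] (E : Matrix k j ℝ)
    (x : j → ℝ) : x ⬝ᵥ ((Eᵀ * E) *ᵥ x) = (E *ᵥ x) ⬝ᵥ (E *ᵥ x) := by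
  rw [← Matrix.mulVec_mulVec, Matrix.dotProduct_mulVec, Matrix.vecMul_transpose]

variable {d}

lemma IsLyapunovDetectable.posSemidef (h : d.IsLyapunovDetectable) : d.Q.PosSemidef := by
  obtain ⟨q, E₀, E, Θ, hE, -⟩ := h
  rw [← hE]
  refine posSemidef_iff_real.2 ⟨?_, fun x => ?_⟩
  · simp only [Matrix.IsSymm, Matrix.transpose_add, Matrix.transpose_sum, Matrix.transpose_mul,
      Matrix.transpose_transpose]
  · rw [Matrix.add_mulVec, dotProduct_add, Matrix.sum_mulVec, dotProduct_sum]
    simp only [quadForm_transpose_mul_self]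
    exact add_nonneg (dotProduct_self_nonneg_real _)
      (Finset.sum_nonneg fun l _ => dotProduct_self_nonneg_real _)

/-- For a detectable system, a gain of finite cost is a stabilizer. -/
lemma IsLyapunovDetectable.isLyapunovStabilizer (h : d.IsLyapunovDetectable) (hR : d.R.PosDef)
    (hP : P.PosSemidef)
    (hle : ∀ x, x ⬝ᵥ ((d.closedLyap K P + d.costRate K) *ᵥ x) ≤ 0) :
    d.IsLyapunovStabilizer K := by
  have hQ := h.posSemidef
  obtain ⟨q, E₀, E, Θ, hE, H, hH, hL⟩ := h
  have hPs := posSemidef_iff_real.1 hP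
  rw [posDef_iff_real] at hH hL
  -- The cost rate is a sum of squares of the outputs and, since R ≻ 0, a definite form of the
  -- control Kx; where it vanishes, all of them vanish.
  have hzero : ∀ x, x ⬝ᵥ (d.costRate K *ᵥ x) = 0 →
      K *ᵥ x = 0 ∧ E₀ *ᵥ x = 0 ∧ ∀ l, E l *ᵥ x = 0 := by
    intro x hx
    rw [quadForm_costRate, ← hE, Matrix.add_mulVec, dotProduct_add, Matrix.sum_mulVec,
      dotProduct_sum] at hx
    simp only [quadForm_transpose_mul_self] at hx
    have g0 := dotProduct_self_nonneg_real (E₀ *ᵥ x)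
    have g1 : 0 ≤ ∑ l, (E l *ᵥ x) ⬝ᵥ (E l *ᵥ x) :=
      Finset.sum_nonneg fun l _ => dotProduct_self_nonneg_real _
    have g2 := (posSemidef_iff_real.1 hR.posSemidef).2 (K *ᵥ x)
    refine ⟨?_, ?_, fun l => ?_⟩
    · by_contra hne
      have := (posDef_iff_real.1 hR).2 _ hne
      linarith
    · exact dotProduct_self_eq_zero.1 (by linarith)
    · have g3 : ∑ l, (E l *ᵥ x) ⬝ᵥ (E l *ᵥ x) = 0 := by linarith
      exact dotProduct_self_eq_zero.1 ((Finset.sum_eq_zero_iff_of_nonneg fun l _ =>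
        dotProduct_self_nonneg_real _).1 g3 l (Finset.mem_univ l))
  -- Where the cost rate vanishes, feedback and output injection act trivially, so the closed loop
  -- agrees with the detector system and -L_K(H) is positive there. Finsler's lemma makes -L_K(H) +
  -- c·cost positive on the sphere. As -L_K(P) dominates the cost, H + cP is a Lyapunov matrix for
  -- K.
  obtain ⟨c, hc⟩ := exists_nat_forall_pos_add_mul isCompact_dotProduct_self_eq_one
    (continuous_quadForm (-d.closedLyap K H)) (continuous_quadForm (d.costRate K))
    (d.quadForm_costRate_nonneg hQ hR) (fun x hx hx0 => by
      obtain ⟨hK, h0, hl⟩ := hzero x hx0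
      have hx' : x ≠ 0 := by rintro rfl; simp at hx
      have := hL.2 x hx'
      rw [Matrix.neg_mulVec, dotProduct_neg, quadForm_lyapOp hH.1] at this
      rw [Matrix.neg_mulVec, dotProduct_neg, closedLyap, quadForm_lyapOp hH.1]
      simpa only [Matrix.add_mulVec, ← Matrix.mulVec_mulVec, hK, h0, hl, Matrix.mulVec_zero,
        add_zero] using this)
  have hHs : (H + (c : ℝ) • P).IsSymm := hH.1.add (hPs.1.smul _)
  refine ⟨H + (c : ℝ) • P, posDef_iff_real.2 ⟨hHs, fun x hx => ?_⟩, posDef_iff_real.2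
    ⟨(isSymm_lyapOp hHs).neg, fun x hx => quadForm_pos_of_sphere (fun y hy => ?_) hx⟩⟩
  · rw [Matrix.add_mulVec, dotProduct_add, Matrix.smul_mulVec, dotProduct_smul, smul_eq_mul]
    exact add_pos_of_pos_of_nonneg (hH.2 x hx) (mul_nonneg (Nat.cast_nonneg c) (hPs.2 x))
  · have h1 := hc y hy
    have h2 := hle y
    rw [Matrix.add_mulVec, dotProduct_add] at h2
    have h3 : (c : ℝ) * (y ⬝ᵥ (d.closedLyap K P *ᵥ y)) ≤
        c * -(y ⬝ᵥ (d.costRate K *ᵥ y)) :=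
      mul_le_mul_of_nonneg_left (by linarith) (Nat.cast_nonneg c)
    rw [Matrix.neg_mulVec, dotProduct_neg] at h1 ⊢
    rw [lyapOp_add, lyapOp_smul, Matrix.add_mulVec, dotProduct_add, Matrix.smul_mulVec,
      dotProduct_smul, smul_eq_mul]
    simp only [closedLyap] at h1 h3
    linarith

lemma quadForm_nonneg_square (hR : (d.controlBlock P).PosDef) (G : Matrix (Fin m) (Fin n) ℝ)
    (x : Fin n → ℝ) : 0 ≤ x ⬝ᵥ ((Gᵀ * d.controlBlock P * G) *ᵥ x) := by
  rw [quadForm_transpose_mul_mul]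
  exact (posSemidef_iff_real.1 hR.posSemidef).2 _

/-- The iterates of the policy iteration: the gain is a stabilizer and the Riccati residual is
nonpositive. -/
structure IsPolicyIterate (d : RiccatiData n m r) (P : Matrix (Fin n) (Fin n) ℝ) : Prop where
  posSemidef : P.PosSemidef
  isLyapunovStabilizer : d.IsLyapunovStabilizer (d.gain P)
  riccati_le : ∀ x, x ⬝ᵥ (d.riccati P *ᵥ x) ≤ 0

/-- Policy evaluation: P is the cost matrix of K. Completing the square with K gives Ric(P) =
-(square) ⪯ 0; completing it with the new gain leaves Ric(P), so the new gain has finite cost and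
detectability makes it a stabilizer. -/
lemma exists_isPolicyIterate (hdet : d.IsLyapunovDetectable) (hR : d.R.PosDef)
    (hK : d.IsLyapunovStabilizer K) :
    ∃ P, d.IsPolicyIterate P ∧ d.closedLyap K P + d.costRate K = 0 := by
  have hQ := hdet.posSemidef
  have hRs := (posDef_iff_real.1 hR).1
  obtain ⟨P, hPs, hP⟩ := hK.exists_lyapOp_eq
    ((d.isSymm_costRate (K := K) (posSemidef_iff_real.1 hQ).1 hRs).neg)
  have hPsd : P.PosSemidef := hK.posSemidef hPs fun x => by
    rw [hP, Matrix.neg_mulVec, dotProduct_neg]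
    exact neg_nonpos.2 (d.quadForm_costRate_nonneg hQ hR x)
  have hRP := d.posDef_controlBlock hR hPsd
  have h0 : d.closedLyap K P + d.costRate K = 0 := by
    rw [closedLyap, hP, neg_add_cancel]
  have h1 : ∀ x, x ⬝ᵥ (d.riccati P *ᵥ x) ≤ 0 := fun x => by
    have h2 := d.closedLyap_add_costRate_eq (K := K) hRs hPs hRP.isUnit
    rw [h0, eq_comm, add_comm, add_eq_zero_iff_eq_neg] at h2
    rw [h2, Matrix.neg_mulVec, dotProduct_neg]
    exact neg_nonpos.2 (quadForm_nonneg_square hRP _ x)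
  refine ⟨P, ⟨hPsd, hdet.isLyapunovStabilizer hR hPsd fun x => ?_, h1⟩, h0⟩
  rw [d.closedLyap_add_costRate_eq hRs hPs hRP.isUnit, sub_self, Matrix.mul_zero, zero_add]
  exact h1 x

/-- Policy improvement: under the gain of P, the Lyapunov operator maps P - P' to Ric(P) ⪯ 0, so
stability yields P - P' ⪰ 0. -/
lemma IsPolicyIterate.exists_next (h : d.IsPolicyIterate P) (hdet : d.IsLyapunovDetectable)
    (hR : d.R.PosDef) : ∃ P', d.IsPolicyIterate P' ∧ (P - P').PosSemidef ∧
      d.closedLyap (d.gain P) P' + d.costRate (d.gain P) = 0 := by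
  obtain ⟨P', hP', h0⟩ := exists_isPolicyIterate hdet hR h.isLyapunovStabilizer
  have hPs := (posSemidef_iff_real.1 h.posSemidef).1
  have hRP := d.posDef_controlBlock hR h.posSemidef
  refine ⟨P', hP', h.isLyapunovStabilizer.posSemidef
    (hPs.sub (posSemidef_iff_real.1 hP'.posSemidef).1) fun x => ?_, h0⟩
  have h1 := d.closedLyap_add_costRate_eq (K := d.gain P) (posDef_iff_real.1 hR).1 hPs hRP.isUnit
  rw [sub_self, Matrix.mul_zero, zero_add] at h1
  have h2 : lyapOp (d.A + d.B * d.gain P) (fun l => d.C l + d.D l * d.gain P) (P - P') =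
      d.riccati P := by
    rw [lyapOp_sub, ← h1]
    have : d.closedLyap (d.gain P) P' = -d.costRate (d.gain P) := add_eq_zero_iff_eq_neg.1 h0
    simp only [closedLyap] at this ⊢
    rw [this]
    abel
  rw [h2]
  exact h.riccati_le x

end RiccatiData

/-! ### Monotone limits and the solution of the Riccati equation. -/

/-- A decreasing sequence of positive semidefinite matrices converges. -/
lemma exists_tendsto_of_posSemidef_of_sub_succ {n : ℕ} {S : ℕ → Matrix (Fin n) (Fin n) ℝ}
    (h : ∀ k, (S k).PosSemidef) (hS : ∀ k, (S k - S (k + 1)).PosSemidef) :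
    ∃ L : Matrix (Fin n) (Fin n) ℝ, L.PosSemidef ∧ Tendsto S atTop (𝓝 L) := by
  have hq : ∀ x : Fin n → ℝ, ∃ a, Tendsto (fun k => x ⬝ᵥ (S k *ᵥ x)) atTop (𝓝 a) := by
    intro x
    refine ⟨_, tendsto_atTop_ciInf (antitone_nat_of_succ_le fun k => ?_)
      ⟨0, fun y ⟨k, hk⟩ => hk ▸ (posSemidef_iff_real.1 (h k)).2 x⟩⟩
    have := (posSemidef_iff_real.1 (hS k)).2 x
    rw [Matrix.sub_mulVec, dotProduct_sub] at this
    linarith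
  choose a ha using hq
  have hsymm := fun k => (posSemidef_iff_real.1 (h k)).1
  -- Polarization transfers the monotone convergence of the quadratic forms to the entries.
  have hent : ∀ i j k, S k i j = ((Pi.single i 1 + Pi.single j 1 : Fin n → ℝ) ⬝ᵥ
      (S k *ᵥ (Pi.single i 1 + Pi.single j 1)) - Pi.single i 1 ⬝ᵥ (S k *ᵥ Pi.single i 1) -
      Pi.single j 1 ⬝ᵥ (S k *ᵥ Pi.single j 1)) / 2 := by
    intro i j k
    simp only [Matrix.mulVec_add, add_dotProduct, dotProduct_add, single_one_dotProduct,
      Matrix.mulVec_single_one, Matrix.col_apply]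
    rw [(hsymm k).apply i j]
    ring
  have hlim : Tendsto S atTop (𝓝 (Matrix.of fun i j => (a (Pi.single i 1 + Pi.single j 1) -
      a (Pi.single i 1) - a (Pi.single j 1)) / 2)) := by
    refine tendsto_pi_nhds.2 fun i => tendsto_pi_nhds.2 fun j => ?_
    simp only [hent i j]
    exact (((ha _).sub (ha _)).sub (ha _)).div_const 2
  refine ⟨_, posSemidef_iff_real.2 ⟨?_, fun x => ?_⟩, hlim⟩
  · have h1 := (continuous_id.matrix_transpose.tendsto _).comp hlim
    refine tendsto_nhds_unique (h1.congr fun k => ?_) hlim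
    exact (hsymm k).eq
  · have h1 : Continuous fun M : Matrix (Fin n) (Fin n) ℝ => x ⬝ᵥ (M *ᵥ x) :=
      continuous_const.dotProduct (continuous_id.matrix_mulVec continuous_const)
    exact ge_of_tendsto' ((h1.tendsto _).comp hlim) fun k => (posSemidef_iff_real.1 (h k)).2 x

namespace RiccatiData

variable {n m r : ℕ} {d : RiccatiData n m r} {P P' : Matrix (Fin n) (Fin n) ℝ}

lemma continuous_controlBlock : Continuous d.controlBlock := by
  unfold controlBlock
  fun_prop

lemma continuous_crossBlock : Continuous d.crossBlock := by
  unfold crossBlock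
  fun_prop

lemma continuousAt_gain (h : IsUnit (d.controlBlock P)) : ContinuousAt d.gain P := by
  have hdet := ((Matrix.isUnit_iff_isUnit_det _).1 h).ne_zero
  have h1 : ContinuousAt (fun P => (d.controlBlock P)⁻¹) P := by
    simp only [Matrix.inv_def, Ring.inverse_eq_inv']
    exact (continuous_controlBlock.matrix_det.continuousAt.inv₀ hdet).smul
      continuous_controlBlock.matrix_adjugate.continuousAt
  have h2 : Continuous fun p : Matrix (Fin m) (Fin m) ℝ × Matrix (Fin m) (Fin n) ℝ =>
      -(p.1 * p.2) := (continuous_fst.matrix_mul continuous_snd).neg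
  exact h2.continuousAt.comp (h1.prodMk continuous_crossBlock.continuousAt)

lemma continuous_closedLyap_add_costRate :
    Continuous fun p : Matrix (Fin m) (Fin n) ℝ × Matrix (Fin n) (Fin n) ℝ =>
      d.closedLyap p.1 p.2 + d.costRate p.1 := by
  unfold closedLyap costRate lyapOp
  fun_prop

/-- The policy iteration converges to a solution of the Riccati equation. -/
lemma exists_riccati_eq_zero (hdet : d.IsLyapunovDetectable) (hR : d.R.PosDef)
    {K : Matrix (Fin m) (Fin n) ℝ} (hK : d.IsLyapunovStabilizer K) :
    ∃ P : Matrix (Fin n) (Fin n) ℝ, P.PosSemidef ∧ d.riccati P = 0 ∧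
      d.IsLyapunovStabilizer (d.gain P) := by
  obtain ⟨P₀, hP₀, -⟩ := exists_isPolicyIterate hdet hR hK
  choose f hf1 hf2 hf3 using fun S : {P // d.IsPolicyIterate P} => S.2.exists_next hdet hR
  let S : ℕ → {P // d.IsPolicyIterate P} := fun k => (fun S => ⟨f S, hf1 S⟩)^[k] ⟨P₀, hP₀⟩
  have hS : ∀ k, ((S (k + 1) : {P // d.IsPolicyIterate P}) : Matrix (Fin n) (Fin n) ℝ) = f (S k) :=
    fun k => by simp only [S, Function.iterate_succ_apply']
  obtain ⟨P, hP, hlim⟩ := exists_tendsto_of_posSemidef_of_sub_succ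
    (S := fun k => (S k : Matrix (Fin n) (Fin n) ℝ)) (fun k => (S k).2.posSemidef)
    fun k => by rw [hS]; exact hf2 (S k)
  have hPs := (posSemidef_iff_real.1 hP).1
  have hRs := (posDef_iff_real.1 hR).1
  have hRP := d.posDef_controlBlock hR hP
  have hgain := (continuousAt_gain hRP.isUnit).tendsto.comp hlim
  -- The evaluation equation couples the gain of step k with the matrix of step k + 1; both indices
  -- have the same limit. Thus P is the cost matrix of its own gain, and completing the square at
  -- that gain leaves Ric(P) = 0.
  have h0 : d.closedLyap (d.gain P) P + d.costRate (d.gain P) = 0 := by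
    have h1 := (continuous_closedLyap_add_costRate (d := d).tendsto (d.gain P, P)).comp
      (hgain.prodMk_nhds (hlim.comp (tendsto_add_atTop_nat 1)))
    refine tendsto_nhds_unique h1 (tendsto_const_nhds.congr fun k => ?_)
    simp only [Function.comp, hS]
    exact (hf3 (S k)).symm
  have h1 := d.closedLyap_add_costRate_eq (K := d.gain P) hRs hPs hRP.isUnit
  rw [sub_self, Matrix.mul_zero, zero_add, h0] at h1
  -- Strict Lyapunov inequalities need not survive a limit, so stability of the limiting gain is
  -- obtained afresh from detectability.
  exact ⟨P, hP, h1.symm, hdet.isLyapunovStabilizer hR hP fun x => by simp [h0]⟩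

/-- A symmetric solution of the Riccati equation whose gain stabilizes is nonnegative. -/
lemma posSemidef_of_riccati_eq_zero (hQ : d.Q.PosSemidef) (hR : d.R.PosDef) (hP : P.IsSymm)
    (hu : IsUnit (d.controlBlock P)) (h0 : d.riccati P = 0)
    (hK : d.IsLyapunovStabilizer (d.gain P)) : P.PosSemidef := by
  refine hK.posSemidef hP fun x => ?_
  have h1 := d.closedLyap_add_costRate_eq (K := d.gain P) (posDef_iff_real.1 hR).1 hP hu
  rw [sub_self, Matrix.mul_zero, zero_add, h0, add_eq_zero_iff_eq_neg, closedLyap] at h1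
  rw [h1, Matrix.neg_mulVec, dotProduct_neg]
  exact neg_nonpos.2 (d.quadForm_costRate_nonneg hQ hR x)

/-- Comparison of solutions of the Riccati equation. -/
lemma posSemidef_sub_of_riccati_eq_zero (hR : d.R.PosDef) (hP : P.PosSemidef)
    (hP' : P'.PosSemidef) (h0 : d.riccati P = 0) (h0' : d.riccati P' = 0)
    (hK : d.IsLyapunovStabilizer (d.gain P')) : (P' - P).PosSemidef := by
  have hs := (posSemidef_iff_real.1 hP).1
  have hs' := (posSemidef_iff_real.1 hP').1
  have hRs := (posDef_iff_real.1 hR).1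
  have hRP := d.posDef_controlBlock hR hP
  refine hK.posSemidef (hs'.sub hs) fun x => ?_
  have h1 := d.closedLyap_add_costRate_eq (K := d.gain P') hRs hs hRP.isUnit
  have h2 := d.closedLyap_add_costRate_eq (K := d.gain P') hRs hs'
    (d.posDef_controlBlock hR hP').isUnit
  rw [h0, add_zero] at h1
  rw [sub_self, Matrix.mul_zero, zero_add, h0'] at h2
  -- With the gain of P', completing the square at P' leaves nothing and at P leaves a nonnegative
  -- square. The costs cancel in the difference.
  have h3 : lyapOp (d.A + d.B * d.gain P') (fun l => d.C l + d.D l * d.gain P') (P' - P) =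
      -((d.gain P' - d.gain P)ᵀ * d.controlBlock P * (d.gain P' - d.gain P)) := by
    rw [lyapOp_sub, ← h1]
    simp only [closedLyap] at h2 ⊢
    rw [add_eq_zero_iff_eq_neg.1 h2]
    abel
  rw [h3, Matrix.neg_mulVec, dotProduct_neg]
  exact neg_nonpos.2 (quadForm_nonneg_square hRP _ x)

end RiccatiData

/-! ### Assembly of the main theorem. -/

theorem mainTheorem2 {Ω : Type*} [MeasurableSpace Ω] (μ : Measure Ω) [IsProbabilityMeasure μ]
    [μ.IsComplete] {n m r : ℕ} (w : Fin r → ℝ≥0 → Ω → ℝ) (hw : IsStandardBrownianMotion μ w)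
    (d : RiccatiData n m r)
    (hΓ : (0 : Matrix (Fin n) (Fin n) ℝ) ∈ d.Gam)
    (hstab : d.IsStabilizable μ w)
    (hdet : ∃ (q : ℕ) (E₀ : Matrix (Fin q) (Fin n) ℝ) (E : Fin r → Matrix (Fin q) (Fin n) ℝ),
      E₀ᵀ * E₀ + ∑ l, (E l)ᵀ * E l = d.Q ∧ IsStochasticallyDetectable μ w E₀ E d.A d.C) :
    ∃ P : Matrix (Fin n) (Fin n) ℝ,
      d.IsStabilizingSolution μ w P ∧ P.PosSemidef ∧ (d.controlBlock P).PosDef ∧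
      ∀ P' : Matrix (Fin n) (Fin n) ℝ, d.IsStabilizingSolution μ w P' → P' = P := by
  -- At P = 0 the control block is R itself.
  have hR : d.R.PosDef := by
    have := hΓ.2.2
    simpa [RiccatiData.controlBlock] using this
  have hdet' : d.IsLyapunovDetectable := by
    obtain ⟨q, E₀, E, hE, Θ, hΘ⟩ := hdet
    exact ⟨q, E₀, E, Θ, hE, (isMeanSquareStable_iff_isLyapunovStable hw).1 hΘ⟩
  obtain ⟨K, hK⟩ := hstab
  obtain ⟨P, hP, h0, hPK⟩ := RiccatiData.exists_riccati_eq_zero hdet' hR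
    ((isMeanSquareStable_iff_isLyapunovStable hw).1 hK)
  have hRP := d.posDef_controlBlock hR hP
  refine ⟨P, ⟨(posSemidef_iff_real.1 hP).1, ⟨hRP.isUnit, h0⟩,
    (isMeanSquareStable_iff_isLyapunovStable hw).2 hPK⟩, hP, hRP, fun P' hP' => ?_⟩
  have hPK' : d.IsLyapunovStabilizer (d.gain P') :=
    (isMeanSquareStable_iff_isLyapunovStable hw).1 hP'.isStabilizer
  -- A competing solution comes only with an invertible control block. Its nonnegativity, forced by
  -- stability of its gain, makes that block positive definite, so the comparison applies in both
  -- directions.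
  have hpos' := RiccatiData.posSemidef_of_riccati_eq_zero hdet'.posSemidef hR hP'.isSymm
    hP'.isARESolution.1 hP'.isARESolution.2 hPK'
  have h1 := RiccatiData.posSemidef_sub_of_riccati_eq_zero hR hP hpos' h0 hP'.isARESolution.2 hPK'
  have h2 := RiccatiData.posSemidef_sub_of_riccati_eq_zero hR hpos' hP hP'.isARESolution.2 h0 hPK
  rw [← neg_sub] at h2
  exact sub_eq_zero.1 (eq_zero_of_posSemidef_neg h1 h2)
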